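/- Let $\mathbb K$ be an algebraically closed field of characteristic $0$, let $n\ge 0$, and let $u\in SL_n(\mathbb K)$ be a unipotent element of Jordan type $(n)$, i.e. consisting of a single Jordan block. Let $X_n$ be the variety of complete quadrics in $\mathbb K^n$. Its points are the pairs $(\mathcal F,Q)$ consisting of a flag $\mathcal F: 0=V_0\subsetneq V_1\subsetneq\dots\subsetneq V_k=\mathbb K^n$ and a tuple $Q=(Q_1,\dots,Q_k)$ where $Q_i$ is a non-degenerate quadric in $V_i/V_{i-1}$ (a non-degenerate quadratic form up to scalars); the flag type of $(\mathcal F,Q)$ is the composition $(\dim V_1/V_0,\dots,\dim V_k/V_{k-1})$ of $n$. As a variety, $X_n$ is the closure of the space of non-degenerate quadrics, embedded in $\prod_{0<d<n}\mathbb P(\mathrm{Sym}^2(\Lambda^d \mathbb K^n)^*)$ by sending an invertible symmetric matrix to all its compound matrices; it carries the Zariski topology. An element $g\in SL_n(\mathbb K)$ acts on $X_n$ on the right by taking preimages of the $V_i$ and of the quadrics under $g$. Let $F_n$ be the set of compositions of $n$ all of whose parts are odd. For $\gamma\in F_n$ let $Y_{n,\gamma}$ be the set of all $P\in X_n$ of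 flag type $\gamma$ with $P\cdot u=P$, and for $\rho,\gamma\in F_n$ put $$\rho\le\gamma\iff Y_{n,\rho}\subseteq\overline{Y_{n,\gamma}},$$ the closure being taken in $X_n$. Then $\le$ is a partial order on $F_n$, and the poset $(F_n,\le)$ is graded, i.e. it has a rank function: a function $\ell:F_n\to\mathbb N$ such that $\ell(\rho)<\ell(\gamma)$ whenever $\rho<\gamma$, and $\ell(\gamma)=\ell(\rho)+1$ whenever $\gamma$ covers $\rho$. A rank function is given by $$\ell(\gamma)=\frac{n-k}{2}=\dim Y_{n,\gamma},$$ where $k$ is the number of parts of $\gamma$ (in particular $n-k$ is even). -/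

import Mathlib

open scoped LinearAlgebra.Projectivization Polynomial

noncomputable section

/-! ### Graded posets -/

/-- `ℓ` is a rank function on the poset `P`. A poset is graded if it has a rank function. -/
def IsRankFunction {P : Type*} [PartialOrder P] (ℓ : P → ℕ) : Prop :=
  (∀ x y : P, x < y → ℓ x < ℓ y) ∧ (∀ x y : P, x ⋖ y → ℓ y = ℓ x + 1)

/-- A poset is graded if it has a rank function. -/
def IsGradedPoset (P : Type*) [PartialOrder P] : Prop :=
  ∃ ℓ : P → ℕ, IsRankFunction ℓ

/-- The set of compositions of `n` all of whose parts are odd. -/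
def OddComposition (n : ℕ) : Type :=
  {γ : Composition n // ∀ i ∈ γ.blocks, Odd i}

/-- The number of parts. -/
def OddComposition.numParts {n : ℕ} (γ : OddComposition n) : ℕ := γ.1.length

/-! ### Complete quadrics -/

/-- A complete quadric in `Kⁿ`: a flag `0 = V₀ ⊂ V₁ ⊂ ⋯ ⊂ V_k = Kⁿ` together with, on each
`V_{j+1}` (`j = 0, …, k - 1`), a quadric (a nonzero quadratic form up to scalars) whose singular
locus, i.e. the radical of the polar form, is `V_j`. Equivalently, this is a non-degenerate quadric
in each quotient `V_{j+1} / V_j`. -/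
structure CompleteQuadric (K : Type*) [Field K] (n : ℕ) where
  k : ℕ
  V : Fin (k + 1) → Submodule K (Fin n → K)
  strictMono : StrictMono V
  V_zero : V 0 = ⊥
  V_last : V (Fin.last k) = ⊤
  Q : ∀ j : Fin k, ℙ K (QuadraticForm K (V j.succ))
  singular : ∀ (j : Fin k) (v : V j.succ),
    (∀ w : V j.succ, QuadraticMap.polar (Q j).rep v w = 0) ↔ (v : Fin n → K) ∈ V j.castSucc

namespace CompleteQuadric

variable {K : Type*} [Field K] {n : ℕ}

/-- The flag of `x` has type `γ`, i.e. the parts of `γ` are, in order, the numbers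
`dim (V_{j+1} / V_j)`. -/
def HasFlagType (x : CompleteQuadric K n) (γ : Composition n) : Prop :=
  γ.blocks = List.ofFn fun j : Fin x.k =>
    Module.finrank K (x.V j.succ) - Module.finrank K (x.V j.castSucc)

/-- Pull-back of quadratic forms along a linear isomorphism. -/
def pullForm {M N : Type*} [AddCommGroup M] [Module K M] [AddCommGroup N] [Module K N]
    (e : M ≃ₗ[K] N) : QuadraticForm K N →ₗ[K] QuadraticForm K M where
  toFun q := q.comp e.toLinearMap
  map_add' _ _ := rfl
  map_smul' _ _ := rfl

theorem pullForm_apply {M N : Type*} [AddCommGroup M] [Module K M] [AddCommGroup N] [Module K N]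
    (e : M ≃ₗ[K] N) (q : QuadraticForm K N) (v : M) : pullForm e q v = q (e v) := rfl

theorem pullForm_injective {M N : Type*} [AddCommGroup M] [Module K M] [AddCommGroup N]
    [Module K N] (e : M ≃ₗ[K] N) : Function.Injective (pullForm (K := K) e) := by
  intro q q' h
  ext x
  have := congrArg (fun r : QuadraticForm K M => r (e.symm x)) h
  simpa only [pullForm_apply, LinearEquiv.apply_symm_apply] using this

/-- The right action of a linear automorphism `g` of `Kⁿ`: the flag `(V_j)` is sent to
`(g⁻¹ V_j)`, and each quadric is sent to its preimage under `g`. -/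
def act (x : CompleteQuadric K n) (g : (Fin n → K) ≃ₗ[K] (Fin n → K)) : CompleteQuadric K n where
  k := x.k
  V j := (x.V j).comap g.toLinearMap
  strictMono := by
    intro i j hij
    have h := x.strictMono hij
    refine lt_of_le_of_ne (Submodule.comap_mono h.le) fun he => h.ne ?_
    exact Submodule.comap_injective_of_surjective g.surjective he
  V_zero := by
    rw [x.V_zero]
    exact LinearEquiv.ker g
  V_last := by
    rw [x.V_last]
    rfl
  Q j := (x.Q j).map (pullForm (g.ofSubmodule' (x.V j.succ))) (pullForm_injective _)
  singular := by
    intro j v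
    obtain ⟨a, ha⟩ := Projectivization.exists_smul_eq_mk_rep K
      (pullForm (g.ofSubmodule' (x.V j.succ)) (x.Q j).rep)
      (fun h0 => (x.Q j).rep_nonzero (pullForm_injective _ (h0.trans (map_zero _).symm)))
    have hmk : (x.Q j).map (pullForm (g.ofSubmodule' (x.V j.succ))) (pullForm_injective _)
        = Projectivization.mk K (pullForm (g.ofSubmodule' (x.V j.succ)) (x.Q j).rep)
      (fun h0 => (x.Q j).rep_nonzero (pullForm_injective _ (h0.trans (map_zero _).symm))) := by
      conv_lhs => rw [← (x.Q j).mk_rep]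
      rw [Projectivization.map_mk]
    rw [hmk, ← ha]
    have key := x.singular j (g.ofSubmodule' (x.V j.succ) v)
    have hp : ∀ w, QuadraticMap.polar
        (a • pullForm (g.ofSubmodule' (x.V j.succ)) (x.Q j).rep) v w =
        (a : K) * QuadraticMap.polar (x.Q j).rep (g.ofSubmodule' (x.V j.succ) v)
          (g.ofSubmodule' (x.V j.succ) w) := by
      intro w
      simp only [QuadraticMap.polar, smul_apply, pullForm_apply, map_add, Units.smul_def,
        smul_eq_mul]
      ring
    simp only [hp, mul_eq_zero, Units.ne_zero, false_or]
    refine Iff.trans ⟨fun h w => ?_, fun h w => h _⟩ key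
    simpa using h ((g.ofSubmodule' (x.V j.succ)).symm w)

/-! ### The variety of complete quadrics

The variety of complete quadrics is the closure of the set of non-degenerate quadrics, embedded in
`∏_{0 < d < n} ℙ(Sym² (Λᵈ Kⁿ)*)` by sending a symmetric matrix `A` to the classes of its
compounds (the collections of all its `d × d` minors). The complete quadric `(V, Q)` corresponds to
the limit at `t = 0` of the non-degenerate quadrics `∑ⱼ t ^ (k - 1 - j) • Bⱼ`, where `Bⱼ` is a
symmetric form on `Kⁿ` that represents `Qⱼ` on `V_{j+1}`, extended by a projection onto `V_{j+1}`.
-/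

/-- A symmetric matrix representing the `j`-th quadric, extended to `Kⁿ` by means of a linear
projection of `Kⁿ` onto `V_{j+1}`. -/
def gram (x : CompleteQuadric K n) (j : Fin x.k) : Matrix (Fin n) (Fin n) K :=
  Matrix.of fun a b =>
    QuadraticMap.polar (x.Q j).rep
      ((x.V j.succ).subtype.leftInverse (Pi.single a 1))
      ((x.V j.succ).subtype.leftInverse (Pi.single b 1))

/-- The one-parameter family `∑ⱼ t ^ (k - 1 - j) • Bⱼ` of symmetric matrices, which is
non-degenerate for generic `t`. -/
def arc (x : CompleteQuadric K n) : Matrix (Fin n) (Fin n) K[X] :=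
  ∑ j : Fin x.k, (Polynomial.X : K[X]) ^ (j.rev : ℕ) • (x.gram j).map Polynomial.C

/-- The least power of `t` that occurs in a `d × d` minor of a matrix over `K[t]`. -/
def minorOrder (A : Matrix (Fin n) (Fin n) K[X]) (d : ℕ) : ℕ :=
  sInf {m | ∃ s t : Fin d → Fin n, (A.submatrix s t).det.coeff m ≠ 0}

/-- Index set for the homogeneous coordinates on `∏_{0 < d < n} ℙ(Sym² (Λᵈ Kⁿ)*)`: the factor
belonging to `d = i + 1` has the coordinates `(e_{s 1} ∧ ⋯ ∧ e_{s d}, e_{t 1} ∧ ⋯ ∧ e_{t d})`,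
indexed by all pairs of `d`-tuples `s, t` (with the redundancy coming from the alternating law). -/
abbrev CoordIndex (n : ℕ) : Type :=
  Σ i : Fin (n - 1), (Fin (i + 1) → Fin n) × (Fin (i + 1) → Fin n)

/-- Homogeneous coordinates of a complete quadric: the limits at `t = 0` of the (rescaled)
compounds of the one-parameter family `x.arc`. -/
def coord (x : CompleteQuadric K n) (c : CoordIndex n) : K :=
  (x.arc.submatrix c.2.1 c.2.2).det.coeff (minorOrder x.arc (c.1 + 1))

/-- Polynomials which are homogeneous in each group of homogeneous coordinates. -/
def IsMultihomogeneous (f : MvPolynomial (CoordIndex n) K) : Prop :=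
  ∃ e : Fin (n - 1) → ℕ,
    MvPolynomial.IsWeightedHomogeneous
      (fun c : CoordIndex n => (Pi.single c.1 1 : Fin (n - 1) → ℕ)) f e

/-- The common zero set of a set of polynomials in the homogeneous coordinates. -/
def zeroSet (I : Set (MvPolynomial (CoordIndex n) K)) : Set (CompleteQuadric K n) :=
  {x | ∀ f ∈ I, MvPolynomial.eval x.coord f = 0}

/-- The Zariski topology on the variety of complete quadrics: the closed sets are the zero sets of
multihomogeneous polynomials in the homogeneous coordinates. -/
instance zariskiTopology : TopologicalSpace (CompleteQuadric K n) :=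
  TopologicalSpace.ofClosed
    {Z | ∃ I : Set (MvPolynomial (CoordIndex n) K), (∀ f ∈ I, IsMultihomogeneous f) ∧ Z = zeroSet I}
    ⟨{1}, by
      rintro f rfl
      exact ⟨0, MvPolynomial.isWeightedHomogeneous_one _ _⟩, by
      ext x
      simp [zeroSet]⟩
    (by
      intro A hA
      refine ⟨{f | IsMultihomogeneous f ∧ ∃ Z ∈ A, ∀ x ∈ Z, MvPolynomial.eval x.coord f = 0},
        fun f hf => hf.1, ?_⟩
      ext x
      constructor
      · rintro hx f ⟨-, Z, hZ, hf⟩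
        exact hf x (hx Z hZ)
      · intro hx Z hZ
        obtain ⟨I, hI, rfl⟩ := hA hZ
        exact fun f hf => hx f ⟨hI f hf, _, hZ, fun y hy => hy f hf⟩)
    (by
      rintro _ ⟨I, hI, rfl⟩ _ ⟨J, hJ, rfl⟩
      refine ⟨{h | ∃ f ∈ I, ∃ g ∈ J, h = f * g}, ?_, ?_⟩
      · rintro _ ⟨f, hf, g, hg, rfl⟩
        obtain ⟨a, ha⟩ := hI f hf
        obtain ⟨b, hb⟩ := hJ g hg
        exact ⟨a + b, ha.mul hb⟩
      · ext x
        constructor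
        · rintro (hx | hx)
          · rintro _ ⟨f, hf, g, hg, rfl⟩
            rw [map_mul, hx f hf, zero_mul]
          · rintro _ ⟨f, hf, g, hg, rfl⟩
            rw [map_mul, hx g hg, mul_zero]
        · intro hx
          by_contra hcon
          obtain ⟨h1, h2⟩ := not_or.mp hcon
          simp only [zeroSet, Set.mem_ofPred_eq, not_forall] at h1 h2
          obtain ⟨f, hf, hf'⟩ := h1
          obtain ⟨g, hg, hg'⟩ := h2
          have := hx _ ⟨f, hf, g, hg, rfl⟩
          rw [map_mul] at this
          exact (mul_ne_zero hf' hg') this)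

end CompleteQuadric

/-! ### Unipotent fixed points -/

/-- `u ∈ SLₙ(K)` is unipotent and consists of a single Jordan block: the nilpotent matrix `u - 1`
has nilpotency index exactly `n`. -/
def IsRegularUnipotent {K : Type*} [Field K] {n : ℕ}
    (u : Matrix.SpecialLinearGroup (Fin n) K) : Prop :=
  ((u : Matrix (Fin n) (Fin n) K) - 1) ^ n = 0 ∧
    ∀ m < n, ((u : Matrix (Fin n) (Fin n) K) - 1) ^ m ≠ 0

/-- The set of complete quadrics with flag of type `γ` that are fixed by `u`. -/
def fixedCell {K : Type*} [Field K] {n : ℕ} (u : Matrix.SpecialLinearGroup (Fin n) K)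
    (γ : OddComposition n) : Set (CompleteQuadric K n) :=
  {x | x.HasFlagType γ.1 ∧ x.act (Matrix.SpecialLinearGroup.toLin' u) = x}

end

/-! Let `T = (u - 1)(u + 1)⁻¹` be the Cayley transform of `u`. It is nilpotent with a single Jordan
block, and some basis `e` is shifted down by it. The `u`-stable subspaces are the spans of initial
segments of `e`, so the flag of a fixed complete quadric is determined by its type. A form on a step
of the flag that is `u`-invariant up to a scalar is invariant because `u` is unipotent, and then `T`
is skew for it. The skew relation moves along antidiagonals: in each block the Gram matrix has
alternating signs along antidiagonals, vanishes above the main antidiagonal and is determined by its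
last row. Symmetry kills every second entry of that row; nondegeneracy says that its first entry is
nonzero, hence can be scaled to `1`. A block of odd size `m` therefore leaves `(m - 1) / 2` free
parameters, and each cell is parametrized by an affine space of dimension `(n - k) / 2`
(`exists_hasNormalForm`, `exists_fixedCell_hasNormalForm`). The parameters are ratios of homogeneous
coordinates, so the Nullstellensatz gives the Krull dimension
(`IsCellChart.topologicalKrullDim_eq`).

In the basis `e`, the coordinates of a point of a cell are the minors `limitMinor` of its normal
form, with one scaling factor for each size `d` (`HasNormalForm.changeCoord_coord`). The kernel
`cellIdeal` of this parametrization is prime, and inclusions of closures of cells are reversed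
inclusions of these ideals (`IsCellChart.subset_closure_iff`). Coordinates that vanish on one cell
but not on another show that a cell in the closure of another has the finer set of cuts
(`subset_of_cellIdeal_le`). This yields antisymmetry and the strict growth of the rank.

For gradedness, let `ρ < γ`. The product `boundaryPoly` does not vanish identically on the cell of
`γ`, but vanishes on all cells with strictly finer cuts. Choose a minimal prime `p` over the ideal
of `γ` and this product, inside the ideal of `ρ`; by Krull it has codimension at most one over the
ideal of `γ`. The main point is that `p` is itself the ideal of a cell. Take a valuation ring
dominating the coordinate ring at `p`. Over it, the generic form of the cell of `γ` is decomposed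
orthogonally by splitting off blocks from the top (`PeelState.exists_step`). After rescaling, each
split block reduces to a normal form of odd size, and inside a block of `γ` the scales get strictly
smaller at each step. Hence the coordinates of the generic point of `p` are those of a normal form
for a finer decomposition `E` (`exists_limit`, `exists_cellIdeal_le`), so that the ideal of `E` lies
in `p`. Comparing transcendence degrees gives equality (`exists_cellIdeal_between`). So there is
always a cell between `ρ` and `γ` of dimension one less than that of `γ`; if `γ` covers `ρ`, it must
be the cell of `ρ`. -/

noncomputable section

/-! ### Cut sets -/

/-- The left end of the block of `i` among the blocks separated by the cuts in `D`. -/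
def cutLo (D : Finset ℕ) (i : ℕ) : ℕ := (D.filter (· ≤ i)).sup id

/-- The right end (exclusive) of the block of `i` among the blocks separated by the cuts in `D`. -/
def cutHi (D : Finset ℕ) (i : ℕ) : ℕ := sInf {c | c ∈ D ∧ i < c}

/-- `D` is the set of the end points of a decomposition of `[r, n)` into intervals. -/
structure IsCutSet (D : Finset ℕ) (r n : ℕ) : Prop where
  left_mem : r ∈ D
  right_mem : n ∈ D
  left_le : ∀ c ∈ D, r ≤ c
  le_right : ∀ c ∈ D, c ≤ n

theorem le_cutLo {D : Finset ℕ} {c i : ℕ} (hc : c ∈ D) (h : c ≤ i) : c ≤ cutLo D i :=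
  Finset.le_sup (f := id) (by simp [hc, h])

theorem cutLo_le (D : Finset ℕ) (i : ℕ) : cutLo D i ≤ i :=
  Finset.sup_le fun c hc => by simp at hc; exact hc.2

theorem cutLo_mono (D : Finset ℕ) {i j : ℕ} (h : i ≤ j) : cutLo D i ≤ cutLo D j :=
  Finset.sup_mono fun c hc => by
    simp only [Finset.mem_filter] at hc ⊢
    exact ⟨hc.1, hc.2.trans h⟩

theorem cutHi_le {D : Finset ℕ} {c i : ℕ} (hc : c ∈ D) (h : i < c) : cutHi D i ≤ c :=
  Nat.sInf_le ⟨hc, h⟩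

theorem cutLo_eq_self {D : Finset ℕ} {i : ℕ} (hi : i ∈ D) : cutLo D i = i :=
  le_antisymm (cutLo_le D i) (le_cutLo hi le_rfl)

namespace IsCutSet

variable {D : Finset ℕ} {r n i j : ℕ}

theorem cutLo_mem (h : IsCutSet D r n) (hi : r ≤ i) : cutLo D i ∈ D := by
  have hne : (D.filter (· ≤ i)).Nonempty := ⟨r, by simp [h.left_mem, hi]⟩
  have := Finset.exists_mem_eq_sup _ hne id
  obtain ⟨c, hc, he⟩ := this
  rw [cutLo, he]
  exact (Finset.mem_filter.mp hc).1

theorem cutHi_spec (h : IsCutSet D r n) (hi : i < n) : cutHi D i ∈ D ∧ i < cutHi D i :=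
  Nat.sInf_mem (s := {c | c ∈ D ∧ i < c}) ⟨n, h.right_mem, hi⟩

theorem cutHi_mem (h : IsCutSet D r n) (hi : i < n) : cutHi D i ∈ D := (h.cutHi_spec hi).1

theorem lt_cutHi (h : IsCutSet D r n) (hi : i < n) : i < cutHi D i := (h.cutHi_spec hi).2

theorem cutHi_le_right (h : IsCutSet D r n) (hi : i < n) : cutHi D i ≤ n :=
  cutHi_le h.right_mem hi

theorem left_le_cutLo (h : IsCutSet D r n) (hi : r ≤ i) : r ≤ cutLo D i :=
  le_cutLo h.left_mem hi

theorem cutLo_eq_of_mem (h : IsCutSet D r n)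
    (h1 : cutLo D i ≤ j) (h2 : j < cutHi D i) (hr : r ≤ i) : cutLo D j = cutLo D i := by
  refine le_antisymm ?_ (le_cutLo (h.cutLo_mem hr) h1)
  have hj : cutLo D j ∈ D := h.cutLo_mem ((h.left_le_cutLo hr).trans h1)
  by_contra hlt
  push Not at hlt
  have h3 : cutLo D j ≤ j := cutLo_le D j
  have h4 : i < cutLo D j := by
    by_contra hle
    exact absurd (le_cutLo hj (not_lt.mp hle)) (not_le.mpr hlt)
  exact absurd (cutHi_le hj h4) (by omega)

theorem lt_cutHi_of_cutLo_eq (h : IsCutSet D r n) (hi : i < n)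
    (he : cutLo D i = cutLo D j) : j < cutHi D i := by
  by_contra hle
  have h1 := le_cutLo (h.cutHi_mem hi) (not_lt.mp hle)
  have h2 := cutLo_le D i
  have h3 := h.lt_cutHi hi
  omega

theorem cutHi_eq_of_cutLo_eq (h : IsCutSet D r n) (hi : i < n) (hj : j < n)
    (he : cutLo D i = cutLo D j) : cutHi D i = cutHi D j :=
  le_antisymm (cutHi_le (h.cutHi_mem hj) (h.lt_cutHi_of_cutLo_eq hj he.symm |>.trans_le le_rfl))
    (cutHi_le (h.cutHi_mem hi) (h.lt_cutHi_of_cutLo_eq hi he))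

theorem cutLo_mono_of_subset {D' : Finset ℕ} (hs : D ⊆ D') : cutLo D i ≤ cutLo D' i :=
  Finset.sup_mono (Finset.filter_subset_filter _ hs)

/-- Blocks of a finer decomposition are contained in blocks of a coarser one. -/
theorem cutLo_eq_of_subset {D' : Finset ℕ} {r' : ℕ} (h : IsCutSet D r n) (h' : IsCutSet D' r' n)
    (hs : ∀ c ∈ D, r' ≤ c → c ∈ D') (hi : i < n) (hj : j < n) (hri : r' ≤ i)
    (he : cutLo D' i = cutLo D' j) (hrr : r ≤ r') : cutLo D i = cutLo D j := by
  wlog hij : i ≤ j generalizing i j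
  · have hrj : r' ≤ j := by
      have := h'.left_le_cutLo hri
      have := cutLo_le D' j
      omega
    exact (this hj hi hrj he.symm (le_of_not_ge hij)).symm
  refine le_antisymm (cutLo_mono D hij) ?_
  by_contra hlt
  push Not at hlt
  have hjm : cutLo D j ∈ D := h.cutLo_mem (by omega)
  have h1 : i < cutLo D j := by
    by_contra hle
    exact absurd (le_cutLo hjm (not_lt.mp hle)) (not_le.mpr hlt)
  have h2 : cutLo D j ∈ D' := hs _ hjm (by omega)
  have h3 := le_cutLo h2 (cutLo_le D j)
  have h4 := cutLo_le D' i
  omega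

end IsCutSet

/-! ### Minors -/

section Minors

variable {R : Type*} [CommRing R] {n d : ℕ}

/-- Cauchy–Binet with only one factor kept as a determinant. Multilinearity in the columns gives a
sum over all tuples `L`, so there is no restriction to increasing tuples and no division by `d!`. -/
theorem det_mul_submatrix {m : Type*} [Fintype m] [DecidableEq m]
    (A : Matrix m (Fin n) R) (B : Matrix (Fin n) m R) (I J : Fin d → m) :
    ((A * B).submatrix I J).det =
      ∑ L : Fin d → Fin n, (A.submatrix I L).det * ∏ i, B (L i) (J i) := by
  classical
  simp only [Matrix.det_apply', Matrix.submatrix_apply, Matrix.mul_apply,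
    Finset.prod_univ_sum, Fintype.piFinset_univ, Finset.mul_sum, Finset.sum_mul]
  rw [Finset.sum_comm]
  refine Finset.sum_congr rfl fun L _ => Finset.sum_congr rfl fun σ _ => ?_
  rw [Finset.prod_mul_distrib, mul_assoc]

theorem det_transpose_mul_submatrix {m : Type*} [Fintype m] [DecidableEq m]
    (A : Matrix (Fin n) m R) (B : Matrix (Fin n) m R) (I J : Fin d → m) :
    ((A.transpose * B).submatrix I J).det =
      ∑ L : Fin d → Fin n, (∏ i, A (L i) (I i)) * (B.submatrix L J).det := by
  rw [← Matrix.det_transpose, Matrix.transpose_submatrix, Matrix.transpose_mul,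
    Matrix.transpose_transpose, det_mul_submatrix]
  refine Finset.sum_congr rfl fun L _ => ?_
  rw [← Matrix.transpose_submatrix, Matrix.det_transpose, mul_comm]

theorem det_congruence_submatrix (P A Q : Matrix (Fin n) (Fin n) R) (I J : Fin d → Fin n) :
    ((P.transpose * A * Q).submatrix I J).det =
      ∑ L : Fin d → Fin n, ∑ L' : Fin d → Fin n,
        (∏ i, P (L i) (I i)) * (∏ i, Q (L' i) (J i)) * (A.submatrix L L').det := by
  rw [Matrix.mul_assoc, det_transpose_mul_submatrix]
  refine Finset.sum_congr rfl fun L _ => ?_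
  rw [det_mul_submatrix, Finset.mul_sum]
  refine Finset.sum_congr rfl fun L' _ => ?_
  ring

/-- If all minors with rows `I` vanished, the expansion of the `I × I` minor of `A * A⁻¹ = 1` would
give `1 = 0`. -/
theorem exists_det_submatrix_ne_zero [Nontrivial R] (A : Matrix (Fin n) (Fin n) R)
    (hA : IsUnit A.det) {I : Fin d → Fin n} (hI : Function.Injective I) :
    ∃ J : Fin d → Fin n, (A.submatrix I J).det ≠ 0 := by
  by_contra hcon
  push Not at hcon
  have h := det_mul_submatrix A A⁻¹ I I
  rw [Matrix.mul_nonsing_inv A hA, Matrix.submatrix_one I hI, Matrix.det_one] at h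
  simp [hcon] at h

/-- The `i`-th smallest of `d` distinct elements of `{0, …, n - 1}` is at most `n - d + i`. -/
theorem exists_perm_le_of_injective {I : Fin d → Fin n} (hI : Function.Injective I) :
    ∃ σ : Equiv.Perm (Fin d), ∀ i, (I (σ i) : ℕ) ≤ n - d + i := by
  refine ⟨Tuple.sort I, fun i => ?_⟩
  have hmono : StrictMono (I ∘ Tuple.sort I) :=
    (Tuple.monotone_sort I).strictMono_of_injective (hI.comp (Tuple.sort I).injective)
  have key : ∀ m : ℕ, ∀ i : Fin d, (i : ℕ) + m + 1 = d →
      ((I ∘ Tuple.sort I) i : ℕ) + m + 1 ≤ n := by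
    intro m
    induction m with
    | zero => intro i _; have := ((I ∘ Tuple.sort I) i).2; omega
    | succ m ih =>
      intro i hi
      have h1 := ih ⟨i + 1, by omega⟩ (by simp; omega)
      have h2 := hmono (show i < ⟨i + 1, by omega⟩ from Fin.mk_lt_mk.mpr (by simp))
      rw [Fin.lt_def] at h2
      omega
  have := key (d - 1 - i) i (by omega)
  simp only [Function.comp_apply] at this
  omega

end Minors

/-! ### Leading minors -/

/-- The index tuple `I` uses the blocks separated by `D` in the same way as the last `d`
indices. -/
def IsTopTuple (D : Finset ℕ) {n d : ℕ} (I : Fin d → Fin n) : Prop :=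
  ∑ i, cutLo D (I i) = ∑ i : Fin d, cutLo D (n - d + i)

instance (D : Finset ℕ) {n d : ℕ} (I : Fin d → Fin n) : Decidable (IsTopTuple D I) :=
  inferInstanceAs (Decidable (_ = _))

/-- The last `d` indices maximize this sum among injective tuples, so `IsTopTuple` is an extremality
condition. -/
theorem sum_cutLo_le (D : Finset ℕ) {n d : ℕ} {I : Fin d → Fin n} (hI : Function.Injective I) :
    ∑ i, cutLo D (I i) ≤ ∑ i : Fin d, cutLo D (n - d + i) := by
  obtain ⟨σ, hσ⟩ := exists_perm_le_of_injective hI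
  rw [← Equiv.sum_comp σ]
  exact Finset.sum_le_sum fun i _ => cutLo_mono D (hσ i)

/-- Equality of two sums that are comparable term by term forces equality of all terms. -/
theorem IsTopTuple.exists_perm {D : Finset ℕ} {n d : ℕ} {I : Fin d → Fin n}
    (hI : Function.Injective I) (h : IsTopTuple D I) :
    ∃ σ : Equiv.Perm (Fin d), ∀ i, (I (σ i) : ℕ) ≤ n - d + i ∧
      cutLo D (I (σ i)) = cutLo D (n - d + i) := by
  obtain ⟨σ, hσ⟩ := exists_perm_le_of_injective hI
  refine ⟨σ, fun i => ⟨hσ i, ?_⟩⟩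
  rw [IsTopTuple, ← Equiv.sum_comp σ] at h
  exact (Finset.sum_eq_sum_iff_of_le fun i _ => cutLo_mono D (hσ i)).mp h i (Finset.mem_univ i)

theorem isTopTuple_of_perm {D : Finset ℕ} {n d : ℕ} {I : Fin d → Fin n}
    {σ : Equiv.Perm (Fin d)} (h : ∀ i, cutLo D (I (σ i)) = cutLo D (n - d + i)) : IsTopTuple D I := by
  rw [IsTopTuple, ← Equiv.sum_comp σ]
  exact Finset.sum_congr rfl fun i _ => h i

/-- The normal form of the symmetric forms that are block diagonal with respect to `D` and for
which the standard nilpotent matrix is skew on each block. The vector `β` is the concatenation of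
the last rows of all blocks. -/
def hankelForm {R : Type*} [CommRing R] (n : ℕ) (D : Finset ℕ) (β : ℕ → R) :
    Matrix (Fin n) (Fin n) R :=
  Matrix.of fun i j =>
    if cutLo D i = cutLo D j ∧ cutHi D i + cutLo D i ≤ i + j + 1 then
      (-1) ^ (cutHi D i - 1 - i) * β (i + j + 1 - cutHi D i)
    else 0

/-- The leading coefficients of the `d × d` minors of the family `t ^ e * S`, where `S` is in normal
form and the diagonal matrix `t ^ e` is constant on blocks with decreasing exponents. -/
def limitMinor {R : Type*} [CommRing R] {n d : ℕ} (D : Finset ℕ) (β : ℕ → R)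
    (I J : Fin d → Fin n) : R :=
  if IsTopTuple D I then ((hankelForm n D β).submatrix I J).det else 0

section Hankel

variable {R : Type*} [CommRing R] {n d : ℕ} {D : Finset ℕ} {β : ℕ → R}

theorem hankelForm_apply_of_ne {i j : Fin n} (h : cutLo D i ≠ cutLo D j) :
    hankelForm n D β i j = 0 := by
  simp [hankelForm, h]

theorem hankelForm_map {S : Type*} [CommRing S] (f : R →+* S) :
    (hankelForm n D β).map f = hankelForm n D (fun j => f (β j)) := by
  ext i j
  simp only [hankelForm, Matrix.map_apply, Matrix.of_apply]
  split_ifs <;> simp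

/-- Naturality in the ring lets one formula serve for the generic form, its values in a valued field
and their residues. -/
theorem map_limitMinor {S : Type*} [CommRing S] (f : R →+* S) (I J : Fin d → Fin n) :
    f (limitMinor D β I J) = limitMinor D (fun j => f (β j)) I J := by
  unfold limitMinor
  split_ifs
  · rw [RingHom.map_det, ← hankelForm_map f]
    rfl
  · simp

theorem limitMinor_of_not_injective {I J : Fin d → Fin n} (hI : ¬ Function.Injective I) :
    limitMinor D β I J = 0 := by
  unfold limitMinor
  split_ifs
  · simp only [Function.Injective, not_forall] at hI
    obtain ⟨a, b, hab, hne⟩ := hI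
    exact Matrix.det_zero_of_row_eq hne (by ext j; simp [hab])
  · rfl

/-- Reversing the rows inside each block makes the matrix upper triangular, and its diagonal entries
become `±β (cutLo D i) = ±1`. -/
theorem isUnit_det_hankelForm (hD : IsCutSet D 0 n) (hβ : ∀ i < n, β (cutLo D i) = 1) :
    IsUnit (hankelForm n D β).det := by
  let ρ : Fin n → Fin n := fun i => ⟨cutLo D i + cutHi D i - 1 - i, by
    have h1 := cutLo_le D i
    have h2 := hD.lt_cutHi i.2
    have h3 := hD.cutHi_le_right i.2
    omega⟩
  have hρlo : ∀ i : Fin n, cutLo D (ρ i) = cutLo D i := fun i => by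
    have h1 := cutLo_le D i
    have h2 := hD.lt_cutHi i.2
    exact hD.cutLo_eq_of_mem (by simp only [ρ]; omega) (by simp only [ρ]; omega) (Nat.zero_le _)
  have hρhi : ∀ i : Fin n, cutHi D (ρ i) = cutHi D i := fun i =>
    hD.cutHi_eq_of_cutLo_eq (ρ i).2 i.2 (hρlo i)
  have hinv : Function.Involutive ρ := fun i => by
    ext
    have h1 := cutLo_le D i
    have h2 := hD.lt_cutHi i.2
    have h3 : ((ρ (ρ i) : Fin n) : ℕ) = cutLo D (ρ i) + cutHi D (ρ i) - 1 - (ρ i : ℕ) := rfl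
    have h4 : ((ρ i : Fin n) : ℕ) = cutLo D i + cutHi D i - 1 - (i : ℕ) := rfl
    rw [h3, hρlo, hρhi, h4]
    omega
  have htri : ((hankelForm n D β).submatrix (hinv.toPerm ρ) id).BlockTriangular id := by
    intro i j hij
    have hij' : (j : ℕ) < i := hij
    simp only [Matrix.submatrix_apply, hankelForm, Matrix.of_apply, id, Function.Involutive.coe_toPerm]
    rw [if_neg]
    rw [hρlo, hρhi]
    rintro ⟨-, h⟩
    have h1 := cutLo_le D i
    have h2 := hD.lt_cutHi i.2
    simp only [ρ] at h
    omega
  have hdet := Matrix.det_of_isUpperTriangular htri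
  rw [Matrix.det_permute] at hdet
  have hprod : IsUnit (∏ i, ((hankelForm n D β).submatrix (hinv.toPerm ρ) id) i i) := by
    rw [IsUnit.prod_univ_iff]
    intro i
    have h1 := cutLo_le D i
    have h2 := hD.lt_cutHi i.2
    simp only [Matrix.submatrix_apply, hankelForm, Matrix.of_apply, id,
      Function.Involutive.coe_toPerm]
    have e1 : (ρ i : ℕ) + i + 1 = cutHi D i + cutLo D i := by simp only [ρ]; omega
    rw [if_pos ⟨hρlo i, by rw [hρlo, hρhi]; omega⟩, hρhi, e1, Nat.add_sub_cancel_left, hβ i i.2,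
      mul_one]
    exact (isUnit_one.neg).pow _
  rw [← hdet] at hprod
  exact isUnit_of_mul_isUnit_right hprod

/-- A matrix whose blocks with respect to `D` are antidiagonal-triangular: a skew relation
determines all entries from the last row. -/
theorem skew_recursion {A : Type*} [AddCommGroup A] (N : AddSubgroup A) {lo r : ℕ}
    (g : ℕ → ℕ → A)
    (h1 : ∀ i j, lo < i → i < r → lo < j → j < r → g (i - 1) j + g i (j - 1) ∈ N)
    (h2 : ∀ i, lo < i → i < r → g (i - 1) lo ∈ N) :
    ∀ i j, lo ≤ i → i < r → lo ≤ j → j < r →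
      (r + lo ≤ i + j + 1 → g i j - (-1 : ℤ) ^ (r - 1 - i) • g (r - 1) (i + j + 1 - r) ∈ N) ∧
      (i + j + 1 < r + lo → g i j ∈ N) := by
  -- Induction on the distance to the last row: the relation trades `(i, j)` for `(i + 1, j - 1)`
  -- with a sign, until the path reaches the last row or the column `lo`, where `h2` applies. The
  -- subgroup `N` covers both exact relations (`N = ⊥`) and congruences modulo a maximal ideal.
  have key : ∀ m i j, r - 1 - i = m → lo ≤ i → i < r → lo ≤ j → j < r →
      (r + lo ≤ i + j + 1 → g i j - (-1 : ℤ) ^ (r - 1 - i) • g (r - 1) (i + j + 1 - r) ∈ N) ∧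
      (i + j + 1 < r + lo → g i j ∈ N) := by
    intro m
    induction m with
    | zero =>
      intro i j hm hi hir hj hjr
      have : i = r - 1 := by omega
      subst this
      refine ⟨fun h => ?_, fun h => by omega⟩
      have e : r - 1 + j + 1 - r = j := by omega
      rw [e]
      simp [N.zero_mem]
    | succ m ih =>
      intro i j hm hi hir hj hjr
      rcases Nat.eq_or_lt_of_le hj with hjl | hjl
      · subst hjl
        refine ⟨fun h => by omega, fun _ => ?_⟩
        simpa using h2 (i + 1) (by omega) (by omega)
      · have hr := h1 (i + 1) j (by omega) (by omega) hjl hjr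
        obtain ⟨ih1, ih2⟩ := ih (i + 1) (j - 1) (by omega) (by omega) (by omega) (by omega)
          (by omega)
        rw [Nat.add_sub_cancel] at hr
        refine ⟨fun h => ?_, fun h => ?_⟩
        · have h3 := ih1 (by omega)
          have h4 := N.sub_mem hr h3
          have e1 : r - 1 - i = (r - 1 - (i + 1)) + 1 := by omega
          have e2 : i + 1 + (j - 1) + 1 - r = i + j + 1 - r := by omega
          rw [e2] at h4
          rw [e1, pow_succ]
          convert h4 using 1
          simp only [mul_neg, mul_one, neg_smul]
          abel
        · have h3 := N.sub_mem hr (ih2 (by omega))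
          simpa using h3
  intro i j
  exact key _ i j rfl

end Hankel

end

noncomputable section

/-! ### Congruences modulo the maximal ideal of a valuation -/

section Valuation

variable {L : Type*} [Field L] {Γ₀ : Type*} [LinearOrderedCommGroupWithZero Γ₀] (v : Valuation L Γ₀)

theorem Valuation.map_prod_le_one {ι : Type*} (s : Finset ι) (f : ι → L)
    (h : ∀ i ∈ s, v (f i) ≤ 1) : v (∏ i ∈ s, f i) ≤ 1 := by
  rw [map_prod]
  exact Finset.prod_le_one' h

theorem Valuation.map_prod_lt_one {ι : Type*} [DecidableEq ι] (s : Finset ι) (f : ι → L)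
    (h : ∀ i ∈ s, v (f i) ≤ 1) (h' : ∃ i ∈ s, v (f i) < 1) : v (∏ i ∈ s, f i) < 1 := by
  obtain ⟨i, hi, hlt⟩ := h'
  rw [← Finset.mul_prod_erase s f hi, map_mul]
  exact mul_lt_one_of_lt_of_le hlt
    (v.map_prod_le_one _ _ fun j hj => h j (Finset.mem_of_mem_erase hj))

variable {v}

theorem Valuation.le_one_of_sub_lt_one {x y : L} (h : v (x - y) < 1) (hy : v y ≤ 1) : v x ≤ 1 := by
  have := v.map_add (x - y) y
  rw [sub_add_cancel] at this
  exact this.trans (max_le h.le hy)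

theorem Valuation.sub_lt_one_symm {x y : L} (h : v (x - y) < 1) : v (y - x) < 1 := by
  rwa [v.map_sub_swap]

theorem Valuation.mul_sub_mul_lt_one {a a' b b' : L} (ha : v (a - a') < 1) (hb : v (b - b') < 1)
    (ha' : v a' ≤ 1) (hb' : v b' ≤ 1) : v (a * b - a' * b') < 1 := by
  have e : a * b - a' * b' = (a - a') * b + a' * (b - b') := by ring
  rw [e]
  refine v.map_add_lt ?_ ?_
  · rw [map_mul]
    exact mul_lt_one_of_lt_of_le ha (le_one_of_sub_lt_one hb hb')
  · rw [map_mul, mul_comm]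
    exact mul_lt_one_of_lt_of_le hb ha'

theorem Valuation.prod_sub_prod_lt_one {ι : Type*} (s : Finset ι) {f g : ι → L}
    (h : ∀ i ∈ s, v (f i - g i) < 1) (hg : ∀ i ∈ s, v (g i) ≤ 1) :
    v (∏ i ∈ s, f i - ∏ i ∈ s, g i) < 1 := by
  classical
  induction s using Finset.induction_on with
  | empty => simp
  | insert a s has ih =>
    rw [Finset.prod_insert has, Finset.prod_insert has]
    refine mul_sub_mul_lt_one (h a (Finset.mem_insert_self a s))
      (ih (fun i hi => h i (Finset.mem_insert_of_mem hi))
        (fun i hi => hg i (Finset.mem_insert_of_mem hi)))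
      (hg a (Finset.mem_insert_self a s))
      (v.map_prod_le_one _ _ fun i hi => hg i (Finset.mem_insert_of_mem hi))

theorem Valuation.map_sign {n : ℕ} (σ : Equiv.Perm (Fin n)) :
    v ((Equiv.Perm.sign σ : ℤ) : L) = 1 := by
  rcases Int.units_eq_one_or (Equiv.Perm.sign σ) with h | h <;> simp [h]

theorem Valuation.map_det_le_one {n : ℕ} {A : Matrix (Fin n) (Fin n) L} (h : ∀ i j, v (A i j) ≤ 1) :
    v A.det ≤ 1 := by
  rw [Matrix.det_apply']
  refine v.map_sum_le fun σ _ => ?_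
  rw [map_mul, map_sign, one_mul]
  exact v.map_prod_le_one _ _ fun i _ => h _ _

theorem Valuation.det_sub_det_lt_one {n : ℕ} {A B : Matrix (Fin n) (Fin n) L}
    (h : ∀ i j, v (A i j - B i j) < 1) (hB : ∀ i j, v (B i j) ≤ 1) :
    v (A.det - B.det) < 1 := by
  rw [Matrix.det_apply', Matrix.det_apply', ← Finset.sum_sub_distrib]
  refine v.map_sum_lt one_ne_zero fun σ _ => ?_
  rw [← mul_sub, map_mul, map_sign, one_mul]
  exact prod_sub_prod_lt_one _ (fun i _ => h _ _) fun i _ => hB _ _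

/-- Erasing the entries below the diagonal changes the determinant only by something of valuation `<
1`, and leaves the product of the diagonal. -/
theorem Valuation.map_det_eq_one_of_triangular {n : ℕ} {A : Matrix (Fin n) (Fin n) L}
    (h : ∀ i j, v (A i j) ≤ 1) (hd : ∀ i, v (A i i) = 1) (hl : ∀ i j, j < i → v (A i j) < 1) :
    v A.det = 1 := by
  let B : Matrix (Fin n) (Fin n) L := Matrix.of fun i j => if j < i then 0 else A i j
  have hB : B.det = ∏ i, A i i := by
    rw [Matrix.det_of_isUpperTriangular (M := B) (fun i j hij => by
      simp only [B, Matrix.of_apply]; exact if_pos hij)]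
    simp [B]
  have h1 : v (A.det - B.det) < 1 := by
    refine det_sub_det_lt_one (fun i j => ?_) (fun i j => ?_)
    · simp only [B, Matrix.of_apply]
      split_ifs with hij
      · simpa using hl i j hij
      · simp
    · simp only [B, Matrix.of_apply]
      split_ifs with hij
      · simp
      · exact h i j
  have h2 : v B.det = 1 := by
    rw [hB, map_prod]
    exact Finset.prod_eq_one fun i _ => hd i
  have h3 : A.det = (A.det - B.det) + B.det := by ring
  rw [h3, v.map_add_eq_of_lt_right (by rwa [h2]), h2]

/-- The entries of the adjugate are determinants of integral matrices, and the determinant is a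
unit. -/
theorem Valuation.map_inv_apply_le_one {n : ℕ} {A : Matrix (Fin n) (Fin n) L}
    (h : ∀ i j, v (A i j) ≤ 1) (hd : v A.det = 1) (i j : Fin n) : v (A⁻¹ i j) ≤ 1 := by
  rw [Matrix.inv_def, Matrix.smul_apply, Ring.inverse_eq_inv', smul_eq_mul, map_mul, map_inv₀, hd,
    inv_one, one_mul, Matrix.adjugate_apply]
  refine map_det_le_one fun a b => ?_
  rw [Matrix.updateRow_apply]
  split_ifs
  · rw [Pi.single_apply]
    split_ifs <;> simp
  · exact h a b

end Valuation

end

noncomputable section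

/-! ### Orthogonal decomposition over a valuation ring -/

/-- The nilpotent matrix that is a single Jordan block on each block of `D`. -/
def blockNilpotent (R : Type*) [CommRing R] (n : ℕ) (D : Finset ℕ) : Matrix (Fin n) (Fin n) R :=
  Matrix.of fun k i => if (k : ℕ) + 1 = i ∧ cutLo D k = cutLo D i then 1 else 0

theorem sum_blockNilpotent_mul {R : Type*} [CommRing R] {n : ℕ} (D : Finset ℕ) (i : Fin n)
    (f : Fin n → R) (hi : cutLo D i < i) :
    ∑ k, blockNilpotent R n D k i * f k = f ⟨i - 1, by omega⟩ := by
  rw [Finset.sum_eq_single ⟨(i : ℕ) - 1, by omega⟩]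
  · rw [blockNilpotent, Matrix.of_apply, if_pos, one_mul]
    refine ⟨by simp only; omega, ?_⟩
    have h1 := cutLo_mono D (show (i : ℕ) - 1 ≤ i by omega)
    refine le_antisymm h1 ?_
    simp only [cutLo]
    refine Finset.sup_mono fun c hc => ?_
    simp only [Finset.mem_filter] at hc ⊢
    refine ⟨hc.1, ?_⟩
    have := le_cutLo hc.1 hc.2
    omega
  · intro k _ hk
    rw [blockNilpotent, Matrix.of_apply, if_neg, zero_mul]
    rintro ⟨h, -⟩
    exact hk (Fin.ext (by simp only; omega))
  · simp

theorem sum_blockNilpotent_mul_of_eq {R : Type*} [CommRing R] {n : ℕ} (D : Finset ℕ) (i : Fin n)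
    (f : Fin n → R) (hi : cutLo D i = i) :
    ∑ k, blockNilpotent R n D k i * f k = 0 := by
  refine Finset.sum_eq_zero fun k _ => ?_
  rw [blockNilpotent, Matrix.of_apply, if_neg, zero_mul]
  rintro ⟨h, h'⟩
  have := cutLo_le D k
  omega

section Peel

variable {L : Type*} [Field L] {Γ₀ : Type*} [LinearOrderedCommGroupWithZero Γ₀]
  {n : ℕ}

/-- An orthogonal decomposition of the form `B`, adapted to the standard flag modulo the maximal
ideal, that has been carried out for the indices `≥ r`. -/
structure PeelState (v : Valuation L Γ₀) (D₀ : Finset ℕ) (B : Matrix (Fin n) (Fin n) L) (r : ℕ)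
    (G M W : Matrix (Fin n) (Fin n) L) (D : Finset ℕ) (E β : ℕ → L) : Prop where
  cut : IsCutSet D r n
  sub : ∀ c ∈ D₀, r ≤ c → c ∈ D
  congruence : B = W.transpose * G * W
  W_close : ∀ i j, v (W i j - (1 : Matrix (Fin n) (Fin n) L) i j) < 1
  W_block : ∀ i j : Fin n, cutLo D₀ i ≠ cutLo D₀ j → W i j = 0
  symm : ∀ i j, G i j = G j i
  block : ∀ i j : Fin n, cutLo D₀ i ≠ cutLo D₀ j → G i j = 0
  skew : M.transpose * G + G * M = 0
  M_close : ∀ i j, v (M i j - blockNilpotent L n D₀ i j) < 1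
  det_ne : G.det ≠ 0
  orth : ∀ i j : Fin n, r ≤ i → cutLo D i ≠ cutLo D j → G i j = 0
  form : ∀ i j : Fin n, r ≤ i → cutLo D i = cutLo D j →
    v (G i j / E (cutLo D i) - hankelForm n D β i j) < 1
  E_ne : ∀ i, r ≤ i → i < n → E (cutLo D i) ≠ 0
  β_lo : ∀ i, r ≤ i → i < n → β (cutLo D i) = 1
  β_odd : ∀ i, r ≤ i → i < n → Odd (i - cutLo D i) → β i = 0
  β_le : ∀ i, r ≤ i → i < n → v (β i) ≤ 1
  odd : ∀ i, r ≤ i → i < n → Odd (cutHi D i - cutLo D i)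
  -- `chain` says that the scales strictly decrease with each block split off from a block of `D₀`.
  -- It is kept alive by `small`: what remains is smaller than every scale already used in the same
  -- block of `D₀`.
  chain : ∀ i j, r ≤ i → i < n → j < n → cutLo D₀ i = cutLo D₀ j → cutLo D i < cutLo D j →
    v (E (cutLo D i)) < v (E (cutLo D j))
  small : ∀ i j : Fin n, (i : ℕ) < r → (j : ℕ) < r → cutLo D₀ i = cutLo D₀ j → ∀ k, r ≤ k → k < n →
    cutLo D₀ k = cutLo D₀ i → v (G i j) < v (E (cutLo D k))

/-- The entries of `A` divided by `η`, with indices in `ℕ`. -/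
def scaledEntry (A : Matrix (Fin n) (Fin n) L) (η : L) (i j : ℕ) : L :=
  if h : i < n ∧ j < n then A ⟨i, h.1⟩ ⟨j, h.2⟩ / η else 0

/-- The analysis of the top block of the undecomposed part. -/
theorem PeelState.exists_top_block {v : Valuation L Γ₀} (hv2 : v 2 = 1) {D₀ : Finset ℕ}
    (hD₀ : IsCutSet D₀ 0 n) {B : Matrix (Fin n) (Fin n) L} {r : ℕ} (hr : 0 < r)
    {G M W : Matrix (Fin n) (Fin n) L} {D : Finset ℕ} {E β : ℕ → L}
    (s : PeelState v D₀ B r G M W D E β) :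
    ∃ (c : ℕ) (η : L), cutLo D₀ (r - 1) ≤ c ∧ c < r ∧ Odd (r - c) ∧ η ≠ 0 ∧
      scaledEntry G η (r - 1) c = 1 ∧
      (∀ i j : Fin n, cutLo D₀ i = cutLo D₀ (r - 1) → (i : ℕ) < r → (j : ℕ) < r →
        v (G i j / η) ≤ 1) ∧
      (∀ i j : Fin n, cutLo D₀ i = cutLo D₀ (r - 1) → (i : ℕ) < r → (j : ℕ) < r →
        (i : ℕ) + j + 1 < r + c → v (G i j / η) < 1) ∧
      (∀ i j : Fin n, c ≤ i → (i : ℕ) < r → c ≤ j → (j : ℕ) < r → r + c ≤ (i : ℕ) + j + 1 →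
        v (G i j / η - (-1) ^ (r - 1 - (i : ℕ)) * scaledEntry G η (r - 1) (i + j + 1 - r)) < 1) ∧
      (∀ k, c ≤ k → k < r → Odd (k - c) → v (scaledEntry G η (r - 1) k) < 1) ∧
      (∃ i j : Fin n, cutLo D₀ i = cutLo D₀ (r - 1) ∧ cutLo D₀ j = cutLo D₀ (r - 1) ∧
        (i : ℕ) < r ∧ (j : ℕ) < r ∧ η = G i j) := by
  classical
  have hrn : r ≤ n := s.cut.left_le n s.cut.right_mem
  set lo := cutLo D₀ (r - 1) with hlo
  have hlor : lo < r := lt_of_le_of_lt (cutLo_le D₀ (r - 1)) (by omega)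
  have hlo0 : lo ∈ D₀ := hD₀.cutLo_mem (Nat.zero_le _)
  have hmem : ∀ i, lo ≤ i → i < r → cutLo D₀ i = lo := fun i h1 h2 =>
    le_antisymm ((cutLo_mono D₀ (by omega : i ≤ r - 1))) (le_cutLo hlo0 h1)
  have hlow : ∀ i j : Fin n, (i : ℕ) < r → r ≤ (j : ℕ) → G i j = 0 := fun i j hi hj => by
    rw [s.symm]
    refine s.orth j i hj (Ne.symm (ne_of_lt ?_))
    have h1 := s.cut.left_le_cutLo hj
    have h2 := cutLo_le D i
    omega
  -- a largest entry of the block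
  let R : Fin n := ⟨r - 1, by omega⟩
  let S : Finset (Fin n × Fin n) := Finset.univ.filter fun p =>
    cutLo D₀ p.1 = lo ∧ cutLo D₀ p.2 = lo ∧ (p.1 : ℕ) < r ∧ (p.2 : ℕ) < r
  have hS : (R, R) ∈ S := by simp [S, R]; omega
  obtain ⟨⟨p, q⟩, hpq, hmax⟩ := S.exists_max_image (fun p => v (G p.1 p.2)) ⟨_, hS⟩
  -- As `G` is nonsingular, row `r - 1` has a nonzero entry. Orthogonality puts it in the block
  -- under consideration, so the largest entry there is nonzero.
  have hne : ∃ j, G R j ≠ 0 := by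
    by_contra hcon
    push Not at hcon
    exact s.det_ne (Matrix.det_eq_zero_of_row_eq_zero R hcon)
  obtain ⟨j₀, hj₀⟩ := hne
  have hη₀ : G p q ≠ 0 := by
    have h1 : cutLo D₀ j₀ = lo := by
      by_contra h
      exact hj₀ (s.block R j₀ (Ne.symm h))
    have h2 : (j₀ : ℕ) < r := by
      by_contra h
      exact hj₀ (hlow R j₀ (by simp only [R]; omega) (not_lt.mp h))
    have h3 := hmax (R, j₀) (by simp [S, R, h1, h2, hr]; rfl)
    intro h0
    simp only [h0, map_zero, le_zero_iff, map_eq_zero] at h3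
    exact hj₀ h3
  simp only [S, Finset.mem_filter, Finset.mem_univ, true_and] at hpq
  have hle : ∀ i j : Fin n, cutLo D₀ i = lo → (i : ℕ) < r → (j : ℕ) < r →
      v (G i j) ≤ v (G p q) := by
    intro i j hi hir hjr
    by_cases hj : cutLo D₀ j = lo
    · exact hmax (i, j) (by simp [S, hi, hj, hir, hjr])
    · rw [s.block i j (by rw [hi]; exact Ne.symm hj), map_zero]
      exact zero_le
  have hvp : 0 < v (G p q) := (v.pos_iff).mpr hη₀
  have hle' : ∀ i j : Fin n, cutLo D₀ i = lo → (i : ℕ) < r → (j : ℕ) < r →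
      v (G i j / G p q) ≤ 1 := fun i j h1 h2 h3 => by
    rw [map_div₀, div_le_one₀ hvp]
    exact hle i j h1 h2 h3
  -- The maximal ideal as an additive subgroup: after division by the largest entry, the skew
  -- relation holds for the standard nilpotent modulo `N`, which is what `skew_recursion` needs.
  let N : AddSubgroup L := v.ltAddSubgroup 1
  have hN : ∀ x, x ∈ N ↔ v x < 1 := fun x => by simp [N, Valuation.mem_ltAddSubgroup_iff]
  set η₀ := G p q with hη₀def
  -- the skew relation modulo the maximal ideal
  have hsum : ∀ i j : Fin n, cutLo D₀ i = lo → cutLo D₀ j = lo → (i : ℕ) < r → (j : ℕ) < r →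
      v (∑ k, blockNilpotent L n D₀ k i * (G k j / η₀) +
        ∑ k, blockNilpotent L n D₀ k j * (G k i / η₀)) < 1 := by
    have hone : ∀ i j : Fin n, cutLo D₀ j = lo → (j : ℕ) < r →
        v (∑ k, M k i * (G k j / η₀) - ∑ k, blockNilpotent L n D₀ k i * (G k j / η₀)) < 1 := by
      intro i j hj hjr
      rw [← Finset.sum_sub_distrib]
      refine v.map_sum_lt one_ne_zero fun k _ => ?_
      rw [← sub_mul, map_mul]
      refine mul_lt_one_of_lt_of_le (s.M_close k i) ?_
      rw [s.symm k j]
      by_cases hk : (k : ℕ) < r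
      · exact hle' j k hj hjr hk
      · rw [hlow j k hjr (not_lt.mp hk), zero_div, map_zero]
        exact zero_le_one
    intro i j hi hj hir hjr
    have h1 := hone i j hj hjr
    have h2 := hone j i hi hir
    have h3 := congrFun (congrFun s.skew i) j
    simp only [Matrix.add_apply, Matrix.mul_apply, Matrix.transpose_apply, Matrix.zero_apply] at h3
    have h4 : ∑ k, M k i * (G k j / η₀) + ∑ k, M k j * (G k i / η₀) = 0 := by
      have : ∑ k, M k i * (G k j / η₀) + ∑ k, M k j * (G k i / η₀) =
          (∑ k, M k i * G k j + ∑ k, G i k * M k j) / η₀ := by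
        rw [add_div, Finset.sum_div, Finset.sum_div]
        congr 1
        · exact Finset.sum_congr rfl fun k _ => by ring
        · exact Finset.sum_congr rfl fun k _ => by rw [s.symm k i]; ring
      rw [this, h3, zero_div]
    have h5 := v.map_add_lt (Valuation.sub_lt_one_symm h1) (Valuation.sub_lt_one_symm h2)
    convert h5 using 2
    linear_combination h4
  let g : ℕ → ℕ → L := scaledEntry G η₀
  have hg : ∀ i j : Fin n, g i j = G i j / η₀ := fun i j => by simp [g, scaledEntry]
  have hrec := skew_recursion N (lo := lo) (r := r) g
    (fun i j hi hir hj hjr => by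
      have hin : i < n := by omega
      have hjn : j < n := by omega
      have hil : cutLo D₀ i = lo := hmem i hi.le hir
      have hjl : cutLo D₀ j = lo := hmem j hj.le hjr
      have := hsum ⟨i, hin⟩ ⟨j, hjn⟩ hil hjl hir hjr
      rw [sum_blockNilpotent_mul _ _ _ (by simp only; omega),
        sum_blockNilpotent_mul _ _ _ (by simp only; omega), ← hg, ← hg] at this
      rw [hN]
      convert this using 3
      simp only [g, scaledEntry]
      rw [dif_pos ⟨hin, by omega⟩, dif_pos ⟨by omega, hin⟩, s.symm])
    (fun i hi hir => by
      have hin : i < n := by omega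
      have hil : cutLo D₀ i = lo := hmem i hi.le hir
      have hll : cutLo D₀ lo = lo := hmem lo le_rfl hlor
      have := hsum ⟨i, hin⟩ ⟨lo, by omega⟩ hil hll hir hlor
      rw [sum_blockNilpotent_mul _ _ _ (by simp only; omega),
        sum_blockNilpotent_mul_of_eq _ _ _ hll, ← hg, add_zero] at this
      rw [hN]
      exact this)
  have hgsymm : ∀ i j, g i j = g j i := fun i j => by
    simp only [g, scaledEntry]
    by_cases h : i < n ∧ j < n
    · rw [dif_pos h, dif_pos h.symm, s.symm]
    · rw [dif_neg h, dif_neg (fun h' => h h'.symm)]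
  -- the first nonzero entry of the last row
  have hex : ∃ k, lo ≤ k ∧ k < r ∧ g (r - 1) k ∉ N := by
    by_contra hcon
    push Not at hcon
    have hpl : lo ≤ (p : ℕ) := hpq.1 ▸ cutLo_le D₀ p
    have hql : lo ≤ (q : ℕ) := hpq.2.1 ▸ cutLo_le D₀ q
    obtain ⟨h1, h2⟩ := hrec p q hpl hpq.2.2.1 hql hpq.2.2.2
    have hmem1 : g p q ∈ N := by
      rcases lt_or_ge ((p : ℕ) + q + 1) (r + lo) with h | h
      · exact h2 h
      · have h3 := h1 h
        have h4 := hcon ((p : ℕ) + q + 1 - r) (by omega) (by omega)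
        have h5 := N.add_mem h3 (N.zsmul_mem h4 ((-1 : ℤ) ^ (r - 1 - (p : ℕ))))
        simpa using h5
    rw [hN, hg, div_self hη₀, map_one] at hmem1
    exact lt_irrefl _ hmem1
  let c := Nat.find hex
  obtain ⟨hc1, hc2, hc3⟩ := Nat.find_spec hex
  have hcmin : ∀ k, lo ≤ k → k < c → g (r - 1) k ∈ N := fun k h1 h2 => by
    have := Nat.find_min hex h2
    push Not at this
    exact this h1 (by omega)
  -- By symmetry and the sign in the recursion, such an entry is congruent to its own negative, and
  -- `2` is a unit. This is what forces the block that is split off to have odd size.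
  have hparity : ∀ k, lo ≤ k → k < r → Odd (r - 1 - k) → g (r - 1) k ∈ N := by
    intro k h1 h2 h3
    have h4 := (hrec k (r - 1) h1 h2 (by omega) (by omega)).1 (by omega)
    rw [h3.neg_one_pow, hgsymm k (r - 1)] at h4
    have e : k + (r - 1) + 1 - r = k := by omega
    rw [e, neg_one_smul, sub_neg_eq_add, ← two_mul, hN, map_mul, hv2, one_mul] at h4
    exact (hN _).mpr h4
  have hceven : Odd (r - c) := by
    by_contra h
    refine hc3 (hparity c hc1 hc2 ?_)
    rw [Nat.not_odd_iff_even] at h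
    have : r - c = (r - 1 - c) + 1 := by omega
    rw [this, Nat.even_add_one, Nat.not_even_iff_odd] at h
    exact h
  have hcn : c < n := by omega
  have hRc : g (r - 1) c = G R ⟨c, hcn⟩ / η₀ := hg R ⟨c, hcn⟩
  have hvc : v (g (r - 1) c) = 1 := by
    refine le_antisymm ?_ (not_lt.mp fun h => hc3 ((hN _).mpr h))
    rw [hRc]
    exact hle' _ _ rfl (by simp only [R]; omega) hc2
  have hgc0 : g (r - 1) c ≠ 0 := fun h => by rw [h, map_zero] at hvc; exact zero_ne_one hvc
  -- The scale is the first unit entry of the last row rather than the largest entry, so that the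
  -- normalized row starts with `1`. Their quotient has valuation `1`, so no estimate changes.
  let η := G R ⟨c, hcn⟩
  have hη : η = g (r - 1) c * η₀ := by rw [hRc, div_mul_cancel₀ _ hη₀]
  have hη0 : η ≠ 0 := by rw [hη]; exact mul_ne_zero hgc0 hη₀
  have hscale : ∀ x : L, x / η = (g (r - 1) c)⁻¹ * (x / η₀) := fun x => by
    rw [hη]
    field_simp
  have hvscale : ∀ x : L, v (x / η) = v (x / η₀) := fun x => by
    rw [hscale, map_mul, map_inv₀, hvc, inv_one, one_mul]
  have hse : ∀ i j, scaledEntry G η i j = (g (r - 1) c)⁻¹ * g i j := fun i j => by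
    by_cases h : i < n ∧ j < n
    · rw [show g i j = G ⟨i, h.1⟩ ⟨j, h.2⟩ / η₀ from dif_pos h,
        show scaledEntry G η i j = G ⟨i, h.1⟩ ⟨j, h.2⟩ / η from dif_pos h]
      exact hscale _
    · rw [show g i j = 0 from dif_neg h, show scaledEntry G η i j = 0 from dif_neg h, mul_zero]
  have hvse : ∀ i j, v (scaledEntry G η i j) = v (g i j) := fun i j => by
    rw [hse, map_mul, map_inv₀, hvc, inv_one, one_mul]
  have hge : ∀ i : Fin n, cutLo D₀ i = lo → lo ≤ (i : ℕ) := fun i h => h ▸ cutLo_le D₀ i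
  refine ⟨c, η, hc1, hc2, hceven, hη0, ?_, ?_, ?_, ?_, ?_, R, ⟨c, hcn⟩, rfl,
    hmem c hc1 hc2, by simp only [R]; omega, hc2, rfl⟩
  · rw [hse, inv_mul_cancel₀ hgc0]
  · intro i j hi hir hjr
    rw [hvscale]
    exact hle' i j hi hir hjr
  · intro i j hi hir hjr hlt
    rw [hvscale]
    by_cases hj : cutLo D₀ j = lo
    · obtain ⟨h1, h2⟩ := hrec i j (hge i hi) hir (hge j hj) hjr
      rw [← hg, ← hN]
      rcases lt_or_ge ((i : ℕ) + j + 1) (r + lo) with h | h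
      · exact h2 h
      · have h5 := N.add_mem (h1 h) (N.zsmul_mem (hcmin ((i : ℕ) + j + 1 - r) (by omega)
          (by omega)) ((-1 : ℤ) ^ (r - 1 - (i : ℕ))))
        simpa using h5
    · rw [s.block i j (by rw [hi]; exact Ne.symm hj), zero_div, map_zero]
      exact zero_lt_one
  · intro i j hi hir hj hjr hle2
    have h1 := (hrec i j (hc1.trans hi) hir (hc1.trans hj) hjr).1 (by omega)
    rw [hN, hg] at h1
    rw [hse, hscale]
    have e : (g (r - 1) c)⁻¹ * (G i j / η₀) - (-1) ^ (r - 1 - (i : ℕ)) *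
        ((g (r - 1) c)⁻¹ * g (r - 1) (i + j + 1 - r)) = (g (r - 1) c)⁻¹ *
        (G i j / η₀ - (-1 : ℤ) ^ (r - 1 - (i : ℕ)) • g (r - 1) (i + j + 1 - r)) := by
      rw [zsmul_eq_mul]
      push_cast
      ring
    rw [e, map_mul, map_inv₀, hvc, inv_one, one_mul]
    exact h1
  · intro k hk hkr hodd
    rw [hvse, ← hN]
    refine hparity k (hc1.trans hk) hkr ?_
    have e1 : r - c = (r - 1 - k) + (k - c) + 1 := by omega
    rw [e1] at hceven
    rw [Nat.odd_add_one, Nat.not_odd_iff_even, Nat.even_add'] at hceven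
    exact hceven.mpr hodd

end Peel

end

noncomputable section

/-! ### Clearing off-diagonal entries over a valuation ring -/

section Peel

variable {L : Type*} [Field L] {Γ₀ : Type*} [LinearOrderedCommGroupWithZero Γ₀]
  {n : ℕ}

theorem Valuation.matrix_mul_lt_one {v : Valuation L Γ₀} {A B : Matrix (Fin n) (Fin n) L}
    (hA : ∀ i j, v (A i j) < 1) (hB : ∀ i j, v (B i j) ≤ 1) (i j : Fin n) :
    v ((A * B) i j) < 1 := by
  rw [Matrix.mul_apply]
  refine v.map_sum_lt one_ne_zero fun k _ => ?_
  rw [map_mul]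
  exact mul_lt_one_of_lt_of_le (hA i k) (hB k j)

theorem Valuation.matrix_mul_lt_one' {v : Valuation L Γ₀} {A B : Matrix (Fin n) (Fin n) L}
    (hA : ∀ i j, v (A i j) ≤ 1) (hB : ∀ i j, v (B i j) < 1) (i j : Fin n) :
    v ((A * B) i j) < 1 := by
  rw [Matrix.mul_apply]
  refine v.map_sum_lt one_ne_zero fun k _ => ?_
  rw [map_mul, mul_comm]
  exact mul_lt_one_of_lt_of_le (hB k j) (hA i k)

/-- The matrix that clears the entries of `G` between the indices in `[c, r)` and in `[lo, c)`. -/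
theorem exists_clearing_matrix {v : Valuation L Γ₀} {G : Matrix (Fin n) (Fin n) L} {lo c r : ℕ}
    {η : L} (hη : η ≠ 0) (hr : r ≤ n)
    (h1 : ∀ i j : Fin n, c ≤ i → (i : ℕ) < r → c ≤ j → (j : ℕ) < r → v (G i j / η) ≤ 1)
    (h2 : ∀ i j : Fin n, c ≤ i → (i : ℕ) < r → c ≤ j → (j : ℕ) < r →
      (i : ℕ) + j + 1 = r + c → v (G i j / η) = 1)
    (h3 : ∀ i j : Fin n, c ≤ i → (i : ℕ) < r → lo ≤ j → (j : ℕ) < r →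
      (i : ℕ) + j + 1 < r + c → v (G i j / η) < 1) (hlo : lo ≤ c) :
    ∃ Y : Matrix (Fin n) (Fin n) L, (∀ i j, v (Y i j) < 1) ∧
      (∀ i j : Fin n, ¬ (c ≤ (i : ℕ) ∧ (i : ℕ) < r) → Y i j = 0) ∧
      (∀ i j : Fin n, ¬ (lo ≤ (j : ℕ) ∧ (j : ℕ) < c) → Y i j = 0) ∧
      (∀ i j : Fin n, c ≤ (i : ℕ) → (i : ℕ) < r → lo ≤ (j : ℕ) → (j : ℕ) < c →
        (G * Y) i j = G i j) := by
  -- The block of `G / η` on `[c, r)`, padded by the identity. The clearing matrix is the solution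
  -- `Y = T⁻¹ * Z` of `T * Y = Z`, where `Z` holds the entries to be cleared.
  let T : Matrix (Fin n) (Fin n) L := Matrix.of fun i j =>
    if (c ≤ (i : ℕ) ∧ (i : ℕ) < r) ∧ (c ≤ (j : ℕ) ∧ (j : ℕ) < r) then G i j / η
    else if i = j then 1 else 0
  have hT1 : ∀ i j : Fin n, (c ≤ (i : ℕ) ∧ (i : ℕ) < r) ∧ (c ≤ (j : ℕ) ∧ (j : ℕ) < r) →
      T i j = G i j / η := fun i j h => by simp only [T, Matrix.of_apply]; rw [if_pos h]
  have hT2 : ∀ i j : Fin n, ¬ ((c ≤ (i : ℕ) ∧ (i : ℕ) < r) ∧ (c ≤ (j : ℕ) ∧ (j : ℕ) < r)) →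
      T i j = if i = j then 1 else 0 := fun i j h => by
    simp only [T, Matrix.of_apply]; rw [if_neg h]
  have hTle : ∀ i j, v (T i j) ≤ 1 := fun i j => by
    by_cases h : (c ≤ (i : ℕ) ∧ (i : ℕ) < r) ∧ (c ≤ (j : ℕ) ∧ (j : ℕ) < r)
    · rw [hT1 i j h]
      exact h1 i j h.1.1 h.1.2 h.2.1 h.2.2
    · rw [hT2 i j h]
      split_ifs <;> simp
  -- Reversing `[c, r)` makes `T` upper triangular modulo the maximal ideal with unit diagonal, so
  -- `T` is invertible over the valuation ring and `Y` inherits smallness from `Z`.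
  let ρ : Fin n → Fin n := fun i =>
    if h : c ≤ (i : ℕ) ∧ (i : ℕ) < r then ⟨r + c - 1 - i, by omega⟩ else i
  have hρ1 : ∀ i : Fin n, c ≤ (i : ℕ) ∧ (i : ℕ) < r → ((ρ i : Fin n) : ℕ) = r + c - 1 - i :=
    fun i h => by simp only [ρ]; rw [dif_pos h]
  have hρ2 : ∀ i : Fin n, ¬ (c ≤ (i : ℕ) ∧ (i : ℕ) < r) → ρ i = i :=
    fun i h => by simp only [ρ]; rw [dif_neg h]
  have hinv : Function.Involutive ρ := fun i => by
    by_cases h : c ≤ (i : ℕ) ∧ (i : ℕ) < r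
    · ext
      have e := hρ1 i h
      rw [hρ1 (ρ i) (by rw [e]; omega), e]
      omega
    · rw [hρ2 i h, hρ2 i h]
  have hdetT : v T.det = 1 := by
    have h := Valuation.map_det_eq_one_of_triangular (v := v)
      (A := T.submatrix (hinv.toPerm ρ) id) (fun i j => hTle _ _) (fun i => ?_) (fun i j hij => ?_)
    · rwa [Matrix.det_permute, map_mul, Valuation.map_sign, one_mul] at h
    · simp only [Matrix.submatrix_apply, Function.Involutive.coe_toPerm, id]
      by_cases hi : c ≤ (i : ℕ) ∧ (i : ℕ) < r
      · have e := hρ1 i hi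
        rw [hT1 _ _ ⟨by rw [e]; omega, hi⟩]
        exact h2 _ _ (by omega) (by omega) hi.1 hi.2 (by omega)
      · rw [hρ2 i hi, hT2 _ _ (fun h => hi h.1), if_pos rfl, map_one]
    · have hij' : (j : ℕ) < i := hij
      simp only [Matrix.submatrix_apply, Function.Involutive.coe_toPerm, id]
      by_cases hi : c ≤ (i : ℕ) ∧ (i : ℕ) < r
      · have e := hρ1 i hi
        by_cases hj : c ≤ (j : ℕ) ∧ (j : ℕ) < r
        · rw [hT1 _ _ ⟨by rw [e]; omega, hj⟩]
          exact h3 _ _ (by omega) (by omega) (by omega) hj.2 (by omega)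
        · rw [hT2 _ _ (fun h => hj h.2), if_neg, map_zero]
          · exact zero_lt_one
          · intro h
            rw [← h] at hj
            exact hj (by rw [e]; omega)
      · rw [hρ2 i hi, hT2 _ _ (fun h => hi h.1), if_neg (by intro h; rw [h] at hij'; omega), map_zero]
        exact zero_lt_one
  have hTu : IsUnit T.det := by
    rw [isUnit_iff_ne_zero]
    intro h
    rw [h, map_zero] at hdetT
    exact zero_ne_one hdetT
  let Z : Matrix (Fin n) (Fin n) L := Matrix.of fun k i =>
    if (c ≤ (k : ℕ) ∧ (k : ℕ) < r) ∧ (lo ≤ (i : ℕ) ∧ (i : ℕ) < c) then G k i / η else 0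
  have hZ1 : ∀ k i : Fin n, (c ≤ (k : ℕ) ∧ (k : ℕ) < r) ∧ (lo ≤ (i : ℕ) ∧ (i : ℕ) < c) →
      Z k i = G k i / η := fun k i h => by simp only [Z, Matrix.of_apply]; rw [if_pos h]
  have hZ2 : ∀ k i : Fin n, ¬ ((c ≤ (k : ℕ) ∧ (k : ℕ) < r) ∧ (lo ≤ (i : ℕ) ∧ (i : ℕ) < c)) →
      Z k i = 0 := fun k i h => by simp only [Z, Matrix.of_apply]; rw [if_neg h]
  have hZlt : ∀ i j, v (Z i j) < 1 := fun i j => by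
    by_cases h : (c ≤ (i : ℕ) ∧ (i : ℕ) < r) ∧ (lo ≤ (j : ℕ) ∧ (j : ℕ) < c)
    · rw [hZ1 i j h]
      exact h3 i j h.1.1 h.1.2 h.2.1 (by omega) (by omega)
    · rw [hZ2 i j h, map_zero]
      exact zero_lt_one
  have hTY : T * (T⁻¹ * Z) = Z := by rw [← Matrix.mul_assoc, Matrix.mul_nonsing_inv _ hTu, one_mul]
  have hrow : ∀ i j : Fin n, ¬ (c ≤ (i : ℕ) ∧ (i : ℕ) < r) → (T⁻¹ * Z) i j = 0 := fun i j h => by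
    have h4 := congrFun (congrFun hTY i) j
    rw [hZ2 i j (fun h' => h h'.1), Matrix.mul_apply, Finset.sum_eq_single i] at h4
    · rwa [hT2 i i (fun h' => h h'.1), if_pos rfl, one_mul] at h4
    · intro k _ hk
      rw [hT2 i k (fun h' => h h'.1), if_neg (Ne.symm hk), zero_mul]
    · simp
  refine ⟨T⁻¹ * Z, Valuation.matrix_mul_lt_one' (Valuation.map_inv_apply_le_one hTle hdetT) hZlt,
    hrow, fun i j h => ?_, fun i j hi hir hj hjc => ?_⟩
  · rw [Matrix.mul_apply]
    exact Finset.sum_eq_zero fun k _ => by rw [hZ2 k j (fun h' => h h'.2), mul_zero]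
  · have h4 := congrFun (congrFun hTY i) j
    rw [hZ1 i j ⟨⟨hi, hir⟩, hj, hjc⟩, eq_div_iff hη, Matrix.mul_apply, Finset.sum_mul] at h4
    rw [← h4, Matrix.mul_apply]
    refine Finset.sum_congr rfl fun k _ => ?_
    by_cases hk : c ≤ (k : ℕ) ∧ (k : ℕ) < r
    · rw [hT1 i k ⟨⟨hi, hir⟩, hk⟩]
      field_simp
    · rw [hrow k j hk, mul_zero, mul_zero, zero_mul]

theorem cutLo_insert_of_le {D : Finset ℕ} {c r n i : ℕ} (hD : IsCutSet D r n) (hc : c ≤ r)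
    (hi : r ≤ i) : cutLo (insert c D) i = cutLo D i := by
  refine le_antisymm (Finset.sup_le fun d hd => ?_)
    (IsCutSet.cutLo_mono_of_subset (Finset.subset_insert c D))
  simp only [Finset.mem_filter, Finset.mem_insert] at hd
  rcases hd with ⟨rfl | hd, h⟩
  · exact hc.trans (hD.left_le_cutLo hi)
  · exact le_cutLo hd h

theorem cutHi_insert_of_le {D : Finset ℕ} {c r n i : ℕ} (hD : IsCutSet D r n) (hc : c ≤ r)
    (hi : r ≤ i) (hin : i < n) : cutHi (insert c D) i = cutHi D i := by
  refine le_antisymm (cutHi_le (Finset.mem_insert_of_mem (hD.cutHi_mem hin)) (hD.lt_cutHi hin)) ?_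
  refine le_csInf ⟨n, by simp [hD.right_mem], hin⟩ ?_
  rintro d ⟨hd, hid⟩
  rcases Finset.mem_insert.mp hd with rfl | hd
  · omega
  · exact cutHi_le hd hid

theorem IsCutSet.insert_left {D : Finset ℕ} {c r n : ℕ} (hD : IsCutSet D r n) (hc : c ≤ r) :
    IsCutSet (insert c D) c n where
  left_mem := Finset.mem_insert_self c D
  right_mem := Finset.mem_insert_of_mem hD.right_mem
  left_le d hd := by
    rcases Finset.mem_insert.mp hd with rfl | hd
    · exact le_rfl
    · exact hc.trans (hD.left_le d hd)
  le_right d hd := by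
    rcases Finset.mem_insert.mp hd with rfl | hd
    · exact hc.trans (hD.le_right r hD.left_mem)
    · exact hD.le_right d hd

theorem cutLo_insert_of_lt {D : Finset ℕ} {c r n i : ℕ} (hD : IsCutSet D r n)
    (hi : c ≤ i) (hir : i < r) : cutLo (insert c D) i = c := by
  refine le_antisymm (Finset.sup_le fun d hd => ?_) (le_cutLo (Finset.mem_insert_self c D) hi)
  simp only [Finset.mem_filter, Finset.mem_insert] at hd
  rcases hd with ⟨rfl | hd, h⟩
  · exact le_rfl
  · have := hD.left_le d hd
    omega

theorem cutHi_insert_of_lt {D : Finset ℕ} {c r n i : ℕ} (hD : IsCutSet D r n)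
    (hi : c ≤ i) (hir : i < r) : cutHi (insert c D) i = r := by
  refine le_antisymm (cutHi_le (Finset.mem_insert_of_mem hD.left_mem) hir) ?_
  refine le_csInf ⟨r, by simp [hD.left_mem], hir⟩ ?_
  rintro d ⟨hd, hid⟩
  rcases Finset.mem_insert.mp hd with rfl | hd
  · omega
  · exact hD.left_le d hd

end Peel

end

noncomputable section

/-! ### One step of the orthogonal decomposition -/

section Peel

variable {L : Type*} [Field L] {Γ₀ : Type*} [LinearOrderedCommGroupWithZero Γ₀]
  {n : ℕ}

/-- The block `[c, r)` provided by `exists_top_block` is nonsingular modulo the maximal ideal after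
division by `η`, so congruence with `1 - Y` splits it off from the rest of its `D₀`-block. Since `Y`
reduces to zero, `M` and `W` keep their reductions. -/
theorem PeelState.exists_step {v : Valuation L Γ₀} (hv2 : v 2 = 1) {D₀ : Finset ℕ}
    (hD₀ : IsCutSet D₀ 0 n) {B : Matrix (Fin n) (Fin n) L} {r : ℕ} (hr : 0 < r)
    {G M W : Matrix (Fin n) (Fin n) L} {D : Finset ℕ} {E β : ℕ → L}
    (s : PeelState v D₀ B r G M W D E β) :
    ∃ c < r, ∃ G' M' W' : Matrix (Fin n) (Fin n) L, ∃ (D' : Finset ℕ) (E' β' : ℕ → L),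
      PeelState v D₀ B c G' M' W' D' E' β' := by
  obtain ⟨c, η, hc1, hcr, hcodd, hη, hec, hle, hlt, hrec, hpar, p, q, hp, hq, hpr, hqr, hηG⟩ :=
    s.exists_top_block hv2 hD₀ hr
  have hrn : r ≤ n := s.cut.left_le n s.cut.right_mem
  set lo := cutLo D₀ (r - 1) with hlo
  have hlo0 : lo ∈ D₀ := hD₀.cutLo_mem (Nat.zero_le _)
  have hmem : ∀ i, lo ≤ i → i < r → cutLo D₀ i = lo := fun i h1 h2 =>
    le_antisymm ((cutLo_mono D₀ (by omega : i ≤ r - 1))) (le_cutLo hlo0 h1)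
  have hge : ∀ i, cutLo D₀ i = lo → lo ≤ i := fun i h => h ▸ cutLo_le D₀ i
  have hlow : ∀ i j : Fin n, (i : ℕ) < r → r ≤ (j : ℕ) → G i j = 0 := fun i j hi hj => by
    rw [s.symm]
    refine s.orth j i hj (Ne.symm (ne_of_lt ?_))
    have h1 := s.cut.left_le_cutLo hj
    have h2 := cutLo_le D i
    omega
  have hGu : ∀ i j : Fin n, c ≤ (i : ℕ) → (i : ℕ) < r → c ≤ (j : ℕ) → (j : ℕ) < r →
      (i : ℕ) + j + 1 = r + c → v (G i j / η) = 1 := fun i j hi hir hj hjr h => by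
    have h1 := hrec i j hi hir hj hjr (by omega)
    have e : (i : ℕ) + j + 1 - r = c := by omega
    rw [e, hec, mul_one] at h1
    have h2 : v ((-1 : L) ^ (r - 1 - (i : ℕ))) = 1 := by
      rw [map_pow, Valuation.map_neg, map_one, one_pow]
    have h3 := v.map_add_eq_of_lt_right (x := G i j / η - (-1) ^ (r - 1 - (i : ℕ)))
      (y := (-1) ^ (r - 1 - (i : ℕ))) (by rwa [h2])
    rwa [sub_add_cancel, h2] at h3
  obtain ⟨Y, hYlt, hYrow, hYcol, hGY⟩ := exists_clearing_matrix (v := v) (G := G) (lo := lo)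
    (c := c) (r := r) hη hrn
    (fun i j hi hir hj hjr => hle i j (hmem i (hc1.trans hi) hir) hir hjr) hGu
    (fun i j hi hir hj hjr h => hlt i j (hmem i (hc1.trans hi) hir) hir hjr h) hc1
  have hYle : ∀ i j, v (Y i j) ≤ 1 := fun i j => (hYlt i j).le
  -- The rows of `Y` lie in `[c, r)` and its columns in the disjoint range `[lo, c)`. Hence `1 + Y`
  -- is the inverse of `1 - Y`.
  have hYY : Y * Y = 0 := by
    ext i j
    rw [Matrix.mul_apply]
    refine Finset.sum_eq_zero fun k _ => ?_
    by_cases hk : c ≤ (k : ℕ) ∧ (k : ℕ) < r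
    · rw [hYcol i k (by omega), zero_mul]
    · rw [hYrow k j hk, mul_zero]
  have hinv1 : (1 - Y) * (1 + Y) = 1 := by
    rw [sub_mul, mul_add, mul_add, hYY]; simp
  have hinv2 : (1 + Y) * (1 - Y) = 1 := by
    rw [add_mul, mul_sub, mul_sub, hYY]; simp
  have hGT : G.transpose = G := by ext i j; exact s.symm j i
  let G' : Matrix (Fin n) (Fin n) L := (1 - Y).transpose * G * (1 - Y)
  have hG'T : G'.transpose = G' := by
    simp only [G', Matrix.transpose_mul, Matrix.transpose_transpose, hGT, Matrix.mul_assoc]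
  have hG'symm : ∀ i j, G' i j = G' j i := fun i j => congrFun (congrFun hG'T j) i
  -- `H = G * (1 - Y)` already vanishes on `[c, r) × [lo, c)`, so multiplying by `(1 - Y)ᵀ` on the
  -- left does not disturb the columns in `[lo, c)`.
  let H : Matrix (Fin n) (Fin n) L := G - G * Y
  have hG'H : ∀ k i, G' k i = H k i - ∑ j, Y j k * H j i := fun k i => by
    have : G' = H - Y.transpose * H := by
      simp only [G', H, Matrix.transpose_sub, Matrix.transpose_one]
      noncomm_ring
    rw [this, Matrix.sub_apply, Matrix.mul_apply]
    rfl
  have hHcol : ∀ k i : Fin n, ¬ (lo ≤ (i : ℕ) ∧ (i : ℕ) < c) → H k i = G k i := fun k i hi => by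
    simp only [H, Matrix.sub_apply, Matrix.mul_apply]
    rw [Finset.sum_eq_zero (fun j _ => by rw [hYcol j i hi, mul_zero]), sub_zero]
  have hH0 : ∀ k i : Fin n, (c ≤ (k : ℕ) ∧ (k : ℕ) < r) → (lo ≤ (i : ℕ) ∧ (i : ℕ) < c) →
      H k i = 0 := fun k i hk hi => by
    simp only [H, Matrix.sub_apply]
    rw [hGY k i hk.1 hk.2 hi.1 hi.2, sub_self]
  have hG'col : ∀ k i : Fin n, (lo ≤ (i : ℕ) ∧ (i : ℕ) < c) → G' k i = H k i := fun k i hi => by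
    rw [hG'H, Finset.sum_eq_zero, sub_zero]
    intro j _
    by_cases hj : c ≤ (j : ℕ) ∧ (j : ℕ) < r
    · rw [hH0 j i hj hi, mul_zero]
    · rw [hYrow j k hj, zero_mul]
  have hG1 : ∀ k i : Fin n, ¬ (lo ≤ (k : ℕ) ∧ (k : ℕ) < c) → ¬ (lo ≤ (i : ℕ) ∧ (i : ℕ) < c) →
      G' k i = G k i := fun k i hk hi => by
    rw [hG'H, Finset.sum_eq_zero (fun j _ => by rw [hYcol j k hk, zero_mul]), sub_zero,
      hHcol k i hi]
  have hGdiff : ∀ k i : Fin n, ¬ (lo ≤ (k : ℕ) ∧ (k : ℕ) < r) → (lo ≤ (i : ℕ) ∧ (i : ℕ) < r) →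
      G k i = 0 := fun k i hk hi => by
    by_cases hkr : (k : ℕ) < r
    · refine s.block k i fun h => hk ⟨hge k ?_, hkr⟩
      rw [h, hmem i hi.1 hi.2]
    · rw [s.symm]
      exact hlow i k hi.2 (not_lt.mp hkr)
  have hG2 : ∀ k i : Fin n, ¬ (lo ≤ (k : ℕ) ∧ (k : ℕ) < c) → (lo ≤ (i : ℕ) ∧ (i : ℕ) < c) →
      G' k i = 0 := fun k i hk hi => by
    rw [hG'col k i hi]
    by_cases hk' : c ≤ (k : ℕ) ∧ (k : ℕ) < r
    · exact hH0 k i hk' hi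
    · have hk'' : ¬ (lo ≤ (k : ℕ) ∧ (k : ℕ) < r) := by omega
      simp only [H, Matrix.sub_apply, Matrix.mul_apply]
      rw [hGdiff k i hk'' ⟨hi.1, by omega⟩, zero_sub, neg_eq_zero]
      refine Finset.sum_eq_zero fun j _ => ?_
      by_cases hj : c ≤ (j : ℕ) ∧ (j : ℕ) < r
      · rw [hGdiff k j hk'' ⟨by omega, hj.2⟩, zero_mul]
      · rw [hYrow j i hj, mul_zero]
  have hvη : 0 < v η := v.pos_iff.mpr hη
  -- Both indices are below `c`, hence the entry of `G` lies above the antidiagonal `r + c` and is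
  -- smaller than `η`; the correction contains a factor from `Y`.
  have hG3 : ∀ k i : Fin n, (lo ≤ (k : ℕ) ∧ (k : ℕ) < c) → (lo ≤ (i : ℕ) ∧ (i : ℕ) < c) →
      v (G' k i) < v η := fun k i hk hi => by
    have hkl : cutLo D₀ k = lo := hmem k hk.1 (by omega)
    have hb : ∀ x, v (x / η) < 1 → v x < v η := fun x h => by
      rwa [map_div₀, div_lt_one₀ hvη] at h
    rw [hG'col k i hi]
    refine hb _ ?_
    simp only [H, Matrix.sub_apply, Matrix.mul_apply]
    rw [sub_div, Finset.sum_div]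
    refine v.map_sub_lt (hlt k i hkl (by omega) (by omega) (by omega)) ?_
    refine v.map_sum_lt one_ne_zero fun j _ => ?_
    by_cases hj : c ≤ (j : ℕ) ∧ (j : ℕ) < r
    · rw [mul_comm, mul_div_assoc, map_mul]
      exact mul_lt_one_of_lt_of_le (hYlt j i) (hle k j hkl (by omega) hj.2)
    · rw [hYrow j i hj, mul_zero, zero_div, map_zero]
      exact zero_lt_one
  have hWle : ∀ i j, v (W i j) ≤ 1 := fun i j =>
    Valuation.le_one_of_sub_lt_one (s.W_close i j) (by rw [Matrix.one_apply]; split_ifs <;> simp)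
  have hMle : ∀ i j, v (M i j) ≤ 1 := fun i j =>
    Valuation.le_one_of_sub_lt_one (s.M_close i j) (by
      rw [blockNilpotent, Matrix.of_apply]; split_ifs <;> simp)
  -- The entries at odd offset are merely small. They may be replaced by exact zeros because `form`
  -- is only a congruence.
  let β' : ℕ → L := fun k =>
    if k < r then (if Odd (k - c) then 0 else scaledEntry G η (r - 1) k) else β k
  have hβ'ge : ∀ k, r ≤ k → β' k = β k := fun k h => by
    simp only [β']; rw [if_neg (not_lt.mpr h)]
  have hE' : ∀ i, r ≤ i → Function.update E c η (cutLo D i) = E (cutLo D i) := fun i h => by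
    rw [Function.update_of_ne]
    have := s.cut.left_le_cutLo h
    omega
  have hlo1 : ∀ i, r ≤ i → cutLo (insert c D) i = cutLo D i := fun i h =>
    cutLo_insert_of_le s.cut hcr.le h
  have hlo2 : ∀ i, c ≤ i → i < r → cutLo (insert c D) i = c := fun i h h' =>
    cutLo_insert_of_lt s.cut h h'
  have hhi1 : ∀ i, r ≤ i → i < n → cutHi (insert c D) i = cutHi D i := fun i h h' =>
    cutHi_insert_of_le s.cut hcr.le h h'
  have hhi2 : ∀ i, c ≤ i → i < r → cutHi (insert c D) i = r := fun i h h' =>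
    cutHi_insert_of_lt s.cut h h'
  -- `η` is an entry of the part not yet decomposed, so the old `small` places it below all earlier
  -- scales; this is the new instance of `chain`.
  have hsmallη : ∀ k, r ≤ k → k < n → cutLo D₀ k = lo → v η < v (E (cutLo D k)) :=
    fun k h1 h2 h3 => by
      rw [hηG]
      exact s.small p q hpr hqr (hp.trans hq.symm) k h1 h2 (h3.trans hp.symm)
  have hse : ∀ k, c ≤ k → k < r → v (scaledEntry G η (r - 1) k) ≤ 1 := fun k _ h2 => by
    have h : r - 1 < n ∧ k < n := ⟨by omega, by omega⟩
    rw [scaledEntry, dif_pos h]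
    exact hle _ _ rfl (by simp only; omega) h2
  refine ⟨c, hcr, G', (1 + Y) * M * (1 - Y), (1 + Y) * W, insert c D, Function.update E c η, β', ?_⟩
  constructor
  · exact s.cut.insert_left hcr.le
  · intro d hd hcd
    rcases lt_or_ge d r with h | h
    · have h1 : cutLo D₀ d = lo := hmem d (hc1.trans hcd) h
      rw [cutLo_eq_self hd] at h1
      have : d = c := by omega
      rw [this]
      exact Finset.mem_insert_self c D
    · exact Finset.mem_insert_of_mem (s.sub d hd h)
  · have : ((1 + Y) * W).transpose * G' * ((1 + Y) * W) =
        W.transpose * (((1 - Y) * (1 + Y)).transpose * G * ((1 - Y) * (1 + Y))) * W := by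
      simp only [G', Matrix.transpose_mul, Matrix.mul_assoc]
    rw [this, hinv1, Matrix.transpose_one, Matrix.one_mul, Matrix.mul_one]
    exact s.congruence
  · intro i j
    have e : ((1 + Y) * W) i j - (1 : Matrix (Fin n) (Fin n) L) i j =
        (W i j - (1 : Matrix (Fin n) (Fin n) L) i j) + (Y * W) i j := by
      rw [Matrix.add_mul, Matrix.one_mul, Matrix.add_apply]
      ring
    rw [e]
    exact v.map_add_lt (s.W_close i j) (Valuation.matrix_mul_lt_one hYlt hWle i j)
  · intro i j hij
    rw [Matrix.add_mul, Matrix.one_mul, Matrix.add_apply, s.W_block i j hij, zero_add,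
      Matrix.mul_apply]
    refine Finset.sum_eq_zero fun k _ => ?_
    by_cases hi : c ≤ (i : ℕ) ∧ (i : ℕ) < r
    · by_cases hk : lo ≤ (k : ℕ) ∧ (k : ℕ) < c
      · rw [s.W_block k j (by
          rw [hmem k hk.1 (by omega), ← hmem i (by omega) hi.2]; exact hij), mul_zero]
      · rw [hYcol i k hk, zero_mul]
    · rw [hYrow i k hi, zero_mul]
  · exact hG'symm
  · intro i j hij
    by_cases hi : lo ≤ (i : ℕ) ∧ (i : ℕ) < c
    · by_cases hj : lo ≤ (j : ℕ) ∧ (j : ℕ) < c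
      · exact absurd ((hmem i hi.1 (by omega)).trans (hmem j hj.1 (by omega)).symm) hij
      · rw [hG'symm]
        exact hG2 j i hj hi
    · by_cases hj : lo ≤ (j : ℕ) ∧ (j : ℕ) < c
      · exact hG2 i j hi hj
      · rw [hG1 i j hi hj]
        exact s.block i j hij
  · have e : ((1 + Y) * M * (1 - Y)).transpose * G' + G' * ((1 + Y) * M * (1 - Y)) =
        (1 - Y).transpose * (M.transpose * ((1 - Y) * (1 + Y)).transpose * G +
          G * ((1 - Y) * (1 + Y)) * M) * (1 - Y) := by
      simp only [G', Matrix.transpose_mul]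
      noncomm_ring
    rw [e, hinv1, Matrix.transpose_one, Matrix.mul_one, Matrix.mul_one, s.skew, Matrix.mul_zero,
      Matrix.zero_mul]
  · intro i j
    have e : (1 + Y) * M * (1 - Y) = M + (Y * M - M * Y - Y * (M * Y)) := by noncomm_ring
    have hMY : ∀ i j, v ((M * Y) i j) < 1 := Valuation.matrix_mul_lt_one' hMle hYlt
    have h1 : v ((Y * M - M * Y - Y * (M * Y)) i j) < 1 := by
      rw [Matrix.sub_apply, Matrix.sub_apply]
      exact v.map_sub_lt (v.map_sub_lt (Valuation.matrix_mul_lt_one hYlt hMle i j) (hMY i j))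
        (Valuation.matrix_mul_lt_one hYlt (fun i j => (hMY i j).le) i j)
    rw [e, Matrix.add_apply, add_sub_right_comm]
    exact v.map_add_lt (s.M_close i j) h1
  · have h1 : (1 - Y).det ≠ 0 := fun h => by
      have := congrArg Matrix.det hinv1
      rw [Matrix.det_mul, h, zero_mul, Matrix.det_one] at this
      exact zero_ne_one this
    simp only [G', Matrix.det_mul, Matrix.det_transpose]
    exact mul_ne_zero (mul_ne_zero h1 s.det_ne) h1
  · intro i j hi hij
    have hi' : ¬ (lo ≤ (i : ℕ) ∧ (i : ℕ) < c) := by omega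
    by_cases hj : lo ≤ (j : ℕ) ∧ (j : ℕ) < c
    · exact hG2 i j hi' hj
    · rw [hG1 i j hi' hj]
      rcases lt_or_ge (i : ℕ) r with hir | hir
      · rcases lt_or_ge (j : ℕ) r with hjr | hjr
        · rcases lt_or_ge (j : ℕ) c with hjc | hjc
          · rw [s.symm]
            exact hGdiff j i (by omega) (by omega)
          · exact absurd ((hlo2 i hi hir).trans (hlo2 j hjc hjr).symm) hij
        · exact hlow i j hir hjr
      · rcases lt_or_ge (j : ℕ) r with hjr | hjr
        · rw [s.symm]
          exact hlow j i hjr hir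
        · refine s.orth i j hir ?_
          rwa [hlo1 i hir, hlo1 j hjr] at hij
  · intro i j hi hij
    have hi' : ¬ (lo ≤ (i : ℕ) ∧ (i : ℕ) < c) := by omega
    rcases lt_or_ge (i : ℕ) r with hir | hir
    · have hj : c ≤ (j : ℕ) ∧ (j : ℕ) < r := by
        rw [hlo2 i hi hir] at hij
        constructor
        · rw [hij]
          exact cutLo_le _ _
        · by_contra h
          rw [hlo1 j (not_lt.mp h)] at hij
          have := s.cut.left_le_cutLo (not_lt.mp h)
          omega
      have hj' : ¬ (lo ≤ (j : ℕ) ∧ (j : ℕ) < c) := by omega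
      rw [hG1 i j hi' hj', hlo2 i hi hir, Function.update_self]
      simp only [hankelForm, Matrix.of_apply]
      rw [hlo2 i hi hir, hlo2 j hj.1 hj.2, hhi2 i hi hir]
      by_cases h : r + c ≤ (i : ℕ) + j + 1
      · rw [if_pos ⟨rfl, h⟩]
        have h1 := hrec i j hi hir hj.1 hj.2 h
        simp only [β']
        rw [if_pos (by omega)]
        split_ifs with hodd
        · rw [mul_zero, sub_zero]
          have h2 := hpar _ (by omega) (by omega) hodd
          have h3 : v ((-1) ^ (r - 1 - (i : ℕ)) * scaledEntry G η (r - 1) (i + j + 1 - r)) < 1 := by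
            rw [map_mul, map_pow, Valuation.map_neg, map_one, one_pow, one_mul]
            exact h2
          have := v.map_add_lt h1 h3
          rwa [sub_add_cancel] at this
        · exact h1
      · rw [if_neg (fun h' => h h'.2), sub_zero]
        exact hlt i j (hmem i (hc1.trans hi) hir) hir hj.2 (not_le.mp h)
    · have hjr : r ≤ (j : ℕ) := by
        rw [hlo1 i hir] at hij
        have h1 := s.cut.left_le_cutLo hir
        have h2 := cutLo_le (insert c D) j
        omega
      have hj' : ¬ (lo ≤ (j : ℕ) ∧ (j : ℕ) < c) := by omega
      rw [hG1 i j hi' hj', hlo1 i hir, hE' i hir]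
      rw [hlo1 i hir, hlo1 j hjr] at hij
      have h1 := s.form i j hir hij
      simp only [hankelForm, Matrix.of_apply] at h1 ⊢
      rw [hlo1 i hir, hlo1 j hjr, hhi1 i hir i.2]
      by_cases h : cutLo D i = cutLo D j ∧ cutHi D i + cutLo D i ≤ (i : ℕ) + j + 1
      · rw [if_pos h] at h1 ⊢
        rw [hβ'ge]
        · exact h1
        · have := s.cut.left_le_cutLo hir
          omega
      · rw [if_neg h] at h1 ⊢
        exact h1
  · intro i hi hin
    rcases lt_or_ge i r with hir | hir
    · rw [hlo2 i hi hir, Function.update_self]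
      exact hη
    · rw [hlo1 i hir, hE' i hir]
      exact s.E_ne i hir hin
  · intro i hi hin
    rcases lt_or_ge i r with hir | hir
    · rw [hlo2 i hi hir]
      simp only [β']
      rw [if_pos hcr, Nat.sub_self, if_neg (by simp), hec]
    · rw [hlo1 i hir, hβ'ge _ (s.cut.left_le_cutLo hir)]
      exact s.β_lo i hir hin
  · intro i hi hin hodd
    rcases lt_or_ge i r with hir | hir
    · rw [hlo2 i hi hir] at hodd
      simp only [β']
      rw [if_pos hir, if_pos hodd]
    · rw [hlo1 i hir] at hodd
      rw [hβ'ge i hir]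
      exact s.β_odd i hir hin hodd
  · intro i hi hin
    rcases lt_or_ge i r with hir | hir
    · simp only [β']
      rw [if_pos hir]
      split_ifs
      · simp
      · exact hse i hi hir
    · rw [hβ'ge i hir]
      exact s.β_le i hir hin
  · intro i hi hin
    rcases lt_or_ge i r with hir | hir
    · rw [hlo2 i hi hir, hhi2 i hi hir]
      exact hcodd
    · rw [hlo1 i hir, hhi1 i hir hin]
      exact s.odd i hir hin
  · intro i j hi hin hjn hij hlt'
    have hji : i ≤ j := by
      by_contra h
      exact absurd (cutLo_mono (insert c D) (not_le.mp h).le) (not_le.mpr hlt')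
    rcases lt_or_ge j r with hjr | hjr
    · rw [hlo2 i hi (by omega), hlo2 j (by omega) hjr] at hlt'
      exact absurd hlt' (lt_irrefl _)
    · rcases lt_or_ge i r with hir | hir
      · rw [hlo2 i hi hir, hlo1 j hjr, Function.update_self, hE' j hjr]
        exact hsmallη j hjr hjn (hij.symm.trans (hmem i (hc1.trans hi) hir))
      · rw [hlo1 i hir, hlo1 j hjr] at hlt' ⊢
        rw [hE' i hir, hE' j hjr]
        exact s.chain i j hir hin hjn hij hlt'
  · intro i j hi hj hij k hk hkn hki
    by_cases hil : lo ≤ (i : ℕ)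
    · have hil' := hmem i hil (by omega)
      have hjl : lo ≤ (j : ℕ) := hge j (hij.symm.trans hil')
      have h3 := hG3 i j ⟨hil, hi⟩ ⟨hjl, hj⟩
      rcases lt_or_ge k r with hkr | hkr
      · rw [hlo2 k hk hkr, Function.update_self]
        exact h3
      · rw [hlo1 k hkr, hE' k hkr]
        exact h3.trans (hsmallη k hkr hkn (hki.trans hil'))
    · have hjl : ¬ lo ≤ (j : ℕ) := fun h => hil (hge i (hij.trans (hmem j h (by omega))))
      rw [hG1 i j (by omega) (by omega)]
      rcases lt_or_ge k r with hkr | hkr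
      · exact absurd (hge i (hki.symm.trans (hmem k (hc1.trans hk) hkr))) hil
      · rw [hlo1 k hkr, hE' k hkr]
        exact s.small i j (by omega) (by omega) hij k hkr hkn hki

end Peel

end

/-! ### Symmetry and skewness of the normal form -/

noncomputable section

/-- All blocks of the decomposition `D` of `[0, n)` have odd length. -/
def OddBlocks (D : Finset ℕ) (n : ℕ) : Prop := ∀ i < n, Odd (cutHi D i - cutLo D i)

/-- `β` consists, block by block, of the normalized last rows of symmetric skew-invariant forms. -/
structure IsNormalVector {R : Type*} [CommRing R] (D : Finset ℕ) (n : ℕ) (β : ℕ → R) : Prop where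
  lo : ∀ i < n, β (cutLo D i) = 1
  odd : ∀ i < n, Odd (i - cutLo D i) → β i = 0

section Hankel

variable {R : Type*} [CommRing R] {n : ℕ} {D : Finset ℕ} {β : ℕ → R}

/-- Exchanging `i` and `j` multiplies the entry by `(-1) ^ (i + j)`. In a block of odd length, `i +
j` is odd exactly when the entry comes from an odd offset, where `β` vanishes. -/
theorem hankelForm_symm (hD : IsCutSet D 0 n) (ho : OddBlocks D n) (hβ : IsNormalVector D n β)
    (i j : Fin n) : hankelForm n D β i j = hankelForm n D β j i := by
  simp only [hankelForm, Matrix.of_apply]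
  by_cases he : cutLo D i = cutLo D j
  · have hh := hD.cutHi_eq_of_cutLo_eq i.2 j.2 he
    rw [← he, ← hh, add_comm (j : ℕ) (i : ℕ)]
    by_cases hle : cutHi D i + cutLo D i ≤ (i : ℕ) + j + 1
    · rw [if_pos ⟨rfl, hle⟩, if_pos ⟨rfl, hle⟩]
      have h1 := hD.lt_cutHi i.2
      have h2 := hD.lt_cutHi j.2
      have h3 := cutLo_le D i
      have h4 := cutLo_le D j
      have hk : cutLo D ((i : ℕ) + j + 1 - cutHi D i) = cutLo D i :=
        hD.cutLo_eq_of_mem (by omega) (by omega) (Nat.zero_le _)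
      rcases Nat.even_or_odd ((i : ℕ) + j + 1 - cutHi D i - cutLo D i) with hev | hodd
      · congr 1
        have h5 := ho i i.2
        rw [neg_one_pow_eq_pow_mod_two, neg_one_pow_eq_pow_mod_two (n := cutHi D i - 1 - (j : ℕ))]
        congr 1
        rw [Nat.even_iff] at hev
        rw [Nat.odd_iff] at h5
        omega
      · rw [hβ.odd _ (by omega) (by rwa [hk]), mul_zero, mul_zero]
    · rw [if_neg (fun h => hle h.2), if_neg (fun h => hle h.2)]
  · rw [if_neg (fun h => he h.1), if_neg (fun h => he h.1.symm)]

theorem cutLo_sub_one {i : ℕ} (h : cutLo D i < i) : cutLo D (i - 1) = cutLo D i := by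
  refine le_antisymm (cutLo_mono D (by omega)) (Finset.sup_mono fun c hc => ?_)
  simp only [Finset.mem_filter] at hc ⊢
  refine ⟨hc.1, ?_⟩
  have := le_cutLo hc.1 hc.2
  omega

theorem cutHi_sub_one (hD : IsCutSet D 0 n) {i : ℕ} (hi : i < n) (h : cutLo D i < i) :
    cutHi D (i - 1) = cutHi D i :=
  hD.cutHi_eq_of_cutLo_eq (by omega) hi (cutLo_sub_one h)

/-- Along an antidiagonal of a block the sign alternates while the factor from `β` is constant. At
the left end of a block only one term survives, and it lies above the main antidiagonal. -/
theorem hankelForm_skew (hD : IsCutSet D 0 n) :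
    (blockNilpotent R n D).transpose * hankelForm n D β +
      hankelForm n D β * blockNilpotent R n D = 0 := by
  ext i j
  simp only [Matrix.add_apply, Matrix.mul_apply, Matrix.transpose_apply, Matrix.zero_apply]
  simp only [fun k => mul_comm (hankelForm n D β i k) (blockNilpotent R n D k j)]
  have hi := cutLo_le D i
  have hj := cutLo_le D j
  by_cases he : cutLo D i = cutLo D j
  · have hh := hD.cutHi_eq_of_cutLo_eq i.2 j.2 he
    have h1 := hD.lt_cutHi i.2
    have h2 := hD.lt_cutHi j.2
    rcases hi.lt_or_eq with hi | hi <;> rcases hj.lt_or_eq with hj | hj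
    · rw [sum_blockNilpotent_mul D i _ hi, sum_blockNilpotent_mul D j _ hj]
      simp only [hankelForm, Matrix.of_apply]
      rw [cutLo_sub_one hi, cutLo_sub_one hj, cutHi_sub_one hD i.2 hi]
      have e1 : (i : ℕ) - 1 + j + 1 = i + j := by omega
      have e2 : (i : ℕ) + (j - 1) + 1 = i + j := by omega
      rw [e1, e2]
      split_ifs with h
      · have e3 : cutHi D i - 1 - ((i : ℕ) - 1) = (cutHi D i - 1 - i) + 1 := by omega
        rw [e3, pow_succ]
        ring
      · ring
    · rw [sum_blockNilpotent_mul D i _ hi, sum_blockNilpotent_mul_of_eq D j _ hj, add_zero]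
      simp only [hankelForm, Matrix.of_apply]
      rw [if_neg]
      rw [cutHi_sub_one hD i.2 hi, cutLo_sub_one hi]
      rintro ⟨-, h⟩
      omega
    · rw [sum_blockNilpotent_mul D j _ hj, sum_blockNilpotent_mul_of_eq D i _ hi, zero_add]
      simp only [hankelForm, Matrix.of_apply]
      rw [if_neg]
      rintro ⟨-, h⟩
      omega
    · rw [sum_blockNilpotent_mul_of_eq D i _ hi, sum_blockNilpotent_mul_of_eq D j _ hj, zero_add]
  · have h1 : ∑ k, blockNilpotent R n D k i * hankelForm n D β k j = 0 := by
      rcases hi.lt_or_eq with hi | hi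
      · rw [sum_blockNilpotent_mul D i _ hi, hankelForm_apply_of_ne]
        simp only
        rwa [cutLo_sub_one hi]
      · rw [sum_blockNilpotent_mul_of_eq D i _ hi]
    have h2 : ∑ k, blockNilpotent R n D k j * hankelForm n D β i k = 0 := by
      rcases hj.lt_or_eq with hj | hj
      · rw [sum_blockNilpotent_mul D j _ hj, hankelForm_apply_of_ne]
        simp only
        rwa [cutLo_sub_one hj]
      · rw [sum_blockNilpotent_mul_of_eq D j _ hj]
    rw [h1, h2, add_zero]

end Hankel

/-! ### Limits of leading minors over a valued field -/

section Limit

variable {L : Type*} [Field L] {Γ₀ : Type*} [LinearOrderedCommGroupWithZero Γ₀] {n : ℕ}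

/-- The normal form is symmetric, nonsingular and skew for the standard nilpotent, so the
decomposition can start at `r = n`; every step lowers `r`. -/
theorem exists_peelState_zero {v : Valuation L Γ₀} (hv2 : v 2 = 1) {D₀ : Finset ℕ}
    (hD₀ : IsCutSet D₀ 0 n) (ho : OddBlocks D₀ n) {β₀ : ℕ → L} (hβ₀ : IsNormalVector D₀ n β₀) :
    ∃ (G M W : Matrix (Fin n) (Fin n) L) (D : Finset ℕ) (E β : ℕ → L),
      PeelState v D₀ (hankelForm n D₀ β₀) 0 G M W D E β := by
  have key : ∀ r, ∀ (G M W : Matrix (Fin n) (Fin n) L) (D : Finset ℕ) (E β : ℕ → L),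
      PeelState v D₀ (hankelForm n D₀ β₀) r G M W D E β →
      ∃ (G M W : Matrix (Fin n) (Fin n) L) (D : Finset ℕ) (E β : ℕ → L),
      PeelState v D₀ (hankelForm n D₀ β₀) 0 G M W D E β := by
    intro r
    induction r using Nat.strong_induction_on with
    | _ r ih =>
      intro G M W D E β s
      rcases Nat.eq_zero_or_pos r with rfl | hr
      · exact ⟨G, M, W, D, E, β, s⟩
      · obtain ⟨c, hc, G', M', W', D', E', β', s'⟩ := s.exists_step hv2 hD₀ hr
        exact ih c hc _ _ _ _ _ _ s'
  -- With the single cut `n` nothing has been split off, and all conditions on indices `≥ n` are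
  -- vacuous; the scales `1` and the vector `0` are placeholders.
  refine key n (hankelForm n D₀ β₀) (blockNilpotent L n D₀) 1 {n} 1 0 ?_
  have hlt : ∀ i : Fin n, ¬ n ≤ (i : ℕ) := fun i => not_le.mpr i.2
  constructor
  · constructor <;> simp
  · intro c hc hn
    simp only [Finset.mem_singleton]
    exact le_antisymm (hD₀.le_right c hc) hn
  · simp
  · simp
  · intro i j hij
    exact Matrix.one_apply_ne (fun h => hij (by rw [h]))
  · exact hankelForm_symm hD₀ ho hβ₀
  · exact fun i j hij => hankelForm_apply_of_ne hij
  · exact hankelForm_skew hD₀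
  · simp
  · exact (isUnit_det_hankelForm hD₀ hβ₀.lo).ne_zero
  · exact fun i _ h => absurd h (hlt i)
  · exact fun i _ h => absurd h (hlt i)
  all_goals intros; omega

/-- Indices in the same block of the finer decomposition are in the same block of the coarser one.
-/
theorem IsTopTuple.of_subset {D D₀ : Finset ℕ} {d : ℕ} (hD₀ : IsCutSet D₀ 0 n)
    (hD : IsCutSet D 0 n) (hs : D₀ ⊆ D) {I : Fin d → Fin n} (hI : Function.Injective I)
    (h : IsTopTuple D I) : IsTopTuple D₀ I := by
  obtain ⟨σ, hσ⟩ := h.exists_perm hI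
  refine isTopTuple_of_perm (σ := σ) fun i => ?_
  have hd : d ≤ n := by simpa using Fintype.card_le_of_injective I hI
  exact hD₀.cutLo_eq_of_subset hD (fun c hc _ => hs hc) (I (σ i)).2 (by omega) (Nat.zero_le _)
    (hσ i).2 le_rfl

/-- The leading minors of a form in normal form over a valued field specialize, up to a scalar, to
the leading minors of a form in normal form for a finer decomposition. -/
theorem exists_limit {v : Valuation L Γ₀} (hv2 : v 2 = 1) {D₀ : Finset ℕ}
    (hD₀ : IsCutSet D₀ 0 n) (ho : OddBlocks D₀ n) {β₀ : ℕ → L} (hβ₀ : IsNormalVector D₀ n β₀) :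
    ∃ (D : Finset ℕ) (β : ℕ → L), IsCutSet D 0 n ∧ D₀ ⊆ D ∧ OddBlocks D n ∧
      IsNormalVector D n β ∧ (∀ i < n, v (β i) ≤ 1) ∧
      ∀ d, ∃ σ : L, σ ≠ 0 ∧ ∀ I J : Fin d → Fin n,
        v (limitMinor D₀ β₀ I J / σ - limitMinor D β I J) < 1 := by
  obtain ⟨G, M, W, D, E, β, s⟩ := exists_peelState_zero hv2 hD₀ ho hβ₀
  have hs : D₀ ⊆ D := fun c hc => s.sub c hc (Nat.zero_le _)
  have hβ : IsNormalVector D n β :=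
    ⟨fun i hi => s.β_lo i (Nat.zero_le _) hi, fun i hi => s.β_odd i (Nat.zero_le _) hi⟩
  refine ⟨D, β, s.cut, hs, fun i hi => s.odd i (Nat.zero_le _) hi, hβ,
    fun i hi => s.β_le i (Nat.zero_le _) hi, fun d => ?_⟩
  rcases lt_or_ge n d with hdn | hdn
  · refine ⟨1, one_ne_zero, fun I J => ?_⟩
    have hI : ¬ Function.Injective I := fun h => by
      have := Fintype.card_le_of_injective I h
      simp at this
      omega
    rw [limitMinor_of_not_injective hI, limitMinor_of_not_injective hI]
    simp
  -- The scale of each index, constant on the blocks of `D`. Dividing the rows of `G` by it gives a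
  -- matrix that reduces to the normal form.
  let e : ℕ → L := fun i => E (cutLo D i)
  have he : ∀ i < n, e i ≠ 0 := fun i hi => s.E_ne i (Nat.zero_le _) hi
  let S : Matrix (Fin n) (Fin n) L := Matrix.of fun i j => G i j / e i
  have hGS : G = Matrix.of fun i j : Fin n => e i * S i j := by
    ext i j
    simp only [S, Matrix.of_apply]
    rw [mul_div_cancel₀ _ (he i i.2)]
  have hH : ∀ i j, v (hankelForm n D β i j) ≤ 1 := fun i j => by
    simp only [hankelForm, Matrix.of_apply]
    split_ifs with h
    · rw [map_mul, map_pow, Valuation.map_neg, map_one, one_pow, one_mul]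
      refine s.β_le _ (Nat.zero_le _) ?_
      have h1 := s.cut.lt_cutHi i.2
      omega
    · simp
  have hS : ∀ i j, v (S i j - hankelForm n D β i j) < 1 := fun i j => by
    by_cases h : cutLo D i = cutLo D j
    · exact s.form i j (Nat.zero_le _) h
    · simp only [S, Matrix.of_apply]
      rw [s.orth i j (Nat.zero_le _) h, zero_div, hankelForm_apply_of_ne h, sub_zero, map_zero]
      exact zero_lt_one
  -- The product of scales for the last `d` indices. By `chain`, its valuation is the largest among
  -- the tuples that are top for `D₀`, which are the only ones that matter.
  let σ : L := ∏ i : Fin d, e (n - d + i)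
  have hσ : σ ≠ 0 := Finset.prod_ne_zero_iff.mpr fun i _ => he _ (by omega)
  refine ⟨σ, hσ, ?_⟩
  let x : (Fin d → Fin n) → (Fin d → Fin n) → L := fun K K' =>
    (if IsTopTuple D₀ K then (∏ i, e (K i)) * (S.submatrix K K').det else 0) / σ
  have hmin : ∀ K K' : Fin d → Fin n, v (limitMinor D β K K') ≤ 1 := fun K K' => by
    unfold limitMinor
    split_ifs
    · exact Valuation.map_det_le_one fun i j => hH _ _
    · simp
  have hdet : ∀ K K' : Fin d → Fin n,
      v ((S.submatrix K K').det - ((hankelForm n D β).submatrix K K').det) < 1 := fun K K' =>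
    Valuation.det_sub_det_lt_one (fun i j => hS _ _) fun i j => hH _ _
  -- For a tuple that is top for `D₀`, the quotient `(∏ e (K i)) / σ` equals `1` if the tuple is
  -- also top for `D`, and otherwise is small because some index falls into a lower block of `D`
  -- inside the same block of `D₀`. This is how the finer top condition arises.
  have hx : ∀ K K', v (x K K' - limitMinor D β K K') < 1 := by
    intro K K'
    by_cases hK : Function.Injective K
    swap
    · have h0 : (S.submatrix K K').det = 0 := by
        simp only [Function.Injective, not_forall] at hK
        obtain ⟨a, b, hab, hne⟩ := hK
        exact Matrix.det_zero_of_row_eq hne (by ext j; simp [hab])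
      simp only [x]
      rw [limitMinor_of_not_injective hK, h0, mul_zero, ite_self, zero_div, sub_zero, map_zero]
      exact zero_lt_one
    by_cases h0 : IsTopTuple D₀ K
    swap
    · have h1 : ¬ IsTopTuple D K := fun h => h0 (h.of_subset hD₀ s.cut hs hK)
      simp only [x, limitMinor]
      rw [if_neg h0, if_neg h1, zero_div, sub_zero, map_zero]
      exact zero_lt_one
    obtain ⟨τ, hτ⟩ := h0.exists_perm hK
    have hquot : (∏ i, e (K i)) / σ = ∏ i : Fin d, e (K (τ i)) / e (n - d + i) := by
      rw [Finset.prod_div_distrib, Equiv.prod_comp τ (fun i => e (K i))]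
    have hle : ∀ i : Fin d, v (e (K (τ i)) / e (n - d + i)) ≤ 1 ∧
        (cutLo D (K (τ i)) ≠ cutLo D (n - d + i) → v (e (K (τ i)) / e (n - d + i)) < 1) := by
      intro i
      have hlt : cutLo D (K (τ i)) ≠ cutLo D (n - d + i) →
          v (e (K (τ i)) / e (n - d + i)) < 1 := fun hne => by
        rw [map_div₀, div_lt_one₀ (v.pos_iff.mpr (he _ (by omega)))]
        exact s.chain _ _ (Nat.zero_le _) (K (τ i)).2 (by omega) (hτ i).2
          (lt_of_le_of_ne (cutLo_mono D (hτ i).1) hne)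
      refine ⟨?_, hlt⟩
      by_cases h : cutLo D (K (τ i)) = cutLo D (n - d + i)
      · simp only [e]
        rw [h, div_self (s.E_ne _ (Nat.zero_le _) (by omega)), map_one]
      · exact (hlt h).le
    simp only [x]
    rw [if_pos h0, mul_div_right_comm, hquot]
    by_cases h1 : IsTopTuple D K
    · have hone : ∏ i : Fin d, e (K (τ i)) / e (n - d + i) = 1 := by
        rw [← hquot]
        obtain ⟨τ', hτ'⟩ := h1.exists_perm hK
        rw [← Equiv.prod_comp τ' (fun i => e (K i)), ← Finset.prod_div_distrib]
        refine Finset.prod_eq_one fun i _ => ?_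
        simp only [e]
        rw [(hτ' i).2, div_self (s.E_ne _ (Nat.zero_le _) (by omega))]
      rw [hone, one_mul, limitMinor, if_pos h1]
      exact hdet K K'
    · have hex : ∃ i : Fin d, cutLo D (K (τ i)) ≠ cutLo D (n - d + i) := by
        by_contra hcon
        push Not at hcon
        exact h1 (isTopTuple_of_perm hcon)
      obtain ⟨i, hi⟩ := hex
      rw [limitMinor, if_neg h1, sub_zero, map_mul]
      refine mul_lt_one_of_lt_of_le ?_ ?_
      · exact v.map_prod_lt_one _ _ (fun i _ => (hle i).1) ⟨i, Finset.mem_univ i, (hle i).2 hi⟩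
      · exact Valuation.le_one_of_sub_lt_one (hdet K K')
          (Valuation.map_det_le_one fun i j => hH _ _)
  intro I J
  -- The coefficients with which the congruence by `W` acts on minors; they reduce to the identity
  -- because `W` does.
  let w : (Fin d → Fin n) → (Fin d → Fin n) → L := fun K I => ∏ i, W (K i) (I i)
  have hw : ∀ K I : Fin d → Fin n, v (w K I - if K = I then 1 else 0) < 1 := fun K I => by
    have h1 : (if K = I then (1 : L) else 0) =
        ∏ i, (1 : Matrix (Fin n) (Fin n) L) (K i) (I i) := by
      split_ifs with h
      · rw [h]
        exact (Finset.prod_eq_one fun i _ => Matrix.one_apply_eq _).symm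
      · obtain ⟨i, hi⟩ := Function.ne_iff.mp h
        exact (Finset.prod_eq_zero (Finset.mem_univ i) (by rw [Matrix.one_apply_ne hi])).symm
    rw [h1]
    exact Valuation.prod_sub_prod_lt_one _ (fun i _ => s.W_close _ _) fun i _ => by
      rw [Matrix.one_apply]; split_ifs <;> simp
  have hLHS : limitMinor D₀ β₀ I J / σ = ∑ K, ∑ K', (w K I * w K' J) * x K K' := by
    have h1 : limitMinor D₀ β₀ I J = ∑ K, ∑ K', (w K I * w K' J) *
        (if IsTopTuple D₀ K then (∏ i, e (K i)) * (S.submatrix K K').det else 0) := by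
      -- `W` respects the blocks of `D₀`, so a nonzero coefficient `w K I` forces `K` and `I` to
      -- meet the same blocks. The top condition for `D₀` can thus be moved from `I` to `K`.
      have hterm : ∀ K K' : Fin d → Fin n, (w K I * w K' J) *
          (if IsTopTuple D₀ K then (∏ i, e (K i)) * (S.submatrix K K').det else 0) =
          if IsTopTuple D₀ I then (w K I * w K' J) * (G.submatrix K K').det else 0 := by
        intro K K'
        have hG : (G.submatrix K K').det = (∏ i, e (K i)) * (S.submatrix K K').det := by
          rw [← Matrix.det_mul_column]
          congr 1
          ext i j
          simp only [Matrix.submatrix_apply, Matrix.of_apply]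
          rw [hGS]
          simp only [Matrix.of_apply]
        rw [hG]
        by_cases hKI : ∀ i, cutLo D₀ (K i) = cutLo D₀ (I i)
        · have : IsTopTuple D₀ K ↔ IsTopTuple D₀ I := by
            simp only [IsTopTuple, hKI]
          simp only [this, mul_ite, mul_zero]
        · push Not at hKI
          obtain ⟨i, hi⟩ := hKI
          have : w K I = 0 := Finset.prod_eq_zero (Finset.mem_univ i) (s.W_block _ _ hi)
          simp [this]
      simp only [hterm]
      unfold limitMinor
      split_ifs
      · rw [s.congruence, det_congruence_submatrix]
      · simp
    rw [h1, Finset.sum_div]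
    refine Finset.sum_congr rfl fun K _ => ?_
    rw [Finset.sum_div]
    exact Finset.sum_congr rfl fun K' _ => by rw [mul_div_assoc]
  have hRHS : limitMinor D β I J = ∑ K, ∑ K', ((if K = I then (1 : L) else 0) *
      (if K' = J then 1 else 0)) * limitMinor D β K K' := by
    rw [Finset.sum_eq_single I, Finset.sum_eq_single J]
    · simp
    · intro K' _ h
      rw [if_neg h, mul_zero, zero_mul]
    · simp
    · intro K _ h
      exact Finset.sum_eq_zero fun K' _ => by rw [if_neg h, zero_mul, zero_mul]
    · simp
  rw [hLHS, hRHS, ← Finset.sum_sub_distrib]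
  refine v.map_sum_lt one_ne_zero fun K _ => ?_
  rw [← Finset.sum_sub_distrib]
  refine v.map_sum_lt one_ne_zero fun K' _ => ?_
  have hδ : ∀ K I : Fin d → Fin n, v (if K = I then (1 : L) else 0) ≤ 1 := fun K I => by
    split_ifs <;> simp
  refine Valuation.mul_sub_mul_lt_one
    (Valuation.mul_sub_mul_lt_one (hw K I) (hw K' J) (hδ _ _) (hδ _ _)) (hx K K') ?_ (hmin K K')
  rw [map_mul]
  exact mul_le_one' (hδ _ _) (hδ _ _)

end Limit

end

noncomputable section

/-! ### Transcendence degree of hypersurfaces -/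

section Trdeg

universe w

variable {K : Type w} [Field K]

/-- A transcendence basis of `A ⧸ I` lifts to an independent family which, by the degree bound, is a
transcendence basis of `A`. A nonzero element of `I` would then yield a nonzero element of `I` in
the subalgebra it generates, that is, an algebraic relation in `A ⧸ I`. -/
theorem ideal_eq_bot_of_trdeg_le {A : Type w} [CommRing A] [IsDomain A] [Algebra K A]
    (hfin : Algebra.trdeg K A < Cardinal.aleph0) (I : Ideal A) [I.IsPrime]
    (h : Algebra.trdeg K A ≤ Algebra.trdeg K (A ⧸ I)) : I = ⊥ := by
  have : FaithfulSMul K (A ⧸ I) :=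
    (faithfulSMul_iff_algebraMap_injective _ _).mpr (algebraMap K (A ⧸ I)).injective
  obtain ⟨s, hs⟩ := exists_isTranscendenceBasis K (A ⧸ I)
  choose y hy using fun i : s => Ideal.Quotient.mk_surjective (I := I) i.1
  have hmk : (Ideal.Quotient.mkₐ K I) ∘ y = ((↑) : s → A ⧸ I) := by
    ext i
    exact hy i
  have hyind : AlgebraicIndependent K y :=
    AlgebraicIndependent.of_comp (Ideal.Quotient.mkₐ K I) (by rw [hmk]; exact hs.1)
  have hybasis : IsTranscendenceBasis K y :=
    hyind.isTranscendenceBasis_of_trdeg_le hfin (by rw [hs.cardinalMk_eq_trdeg]; exact h)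
  have halg := hybasis.isAlgebraic
  by_contra hI
  obtain ⟨f, hfI, hf0⟩ := Submodule.exists_mem_ne_zero_of_ne_bot hI
  have hcomap := Ideal.comap_ne_bot_of_algebraic_mem
    (R := Algebra.adjoin K (Set.range y)) hf0 hfI (halg.isAlgebraic f)
  obtain ⟨g, hgI, hg0⟩ := Submodule.exists_mem_ne_zero_of_ne_bot hcomap
  obtain ⟨q, hq⟩ := (SetLike.ext_iff.mp (Algebra.adjoin_range_eq_range_aeval K y) g.1).mp g.2
  have hq' : MvPolynomial.aeval y q = (g : A) := hq
  have h0 : MvPolynomial.aeval ((↑) : s → A ⧸ I) q = 0 := by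
    rw [← hmk]
    have : (MvPolynomial.aeval ((Ideal.Quotient.mkₐ K I) ∘ y)) q =
        Ideal.Quotient.mkₐ K I (MvPolynomial.aeval y q) := by
      rw [MvPolynomial.comp_aeval_apply]
      rfl
    rw [this, hq']
    exact Ideal.Quotient.eq_zero_iff_mem.mpr hgI
  have hq0 : q = 0 := (injective_iff_map_eq_zero _).mp hs.1 q h0
  rw [hq0, map_zero] at hq'
  exact hg0 (Subtype.ext hq'.symm)

/-- A variable that occurs in `f` occurs in every nonzero multiple of `f`, so the remaining
variables stay algebraically independent modulo `f`. -/
theorem trdeg_mvPolynomial_quotient_span {s : ℕ} {f : MvPolynomial (Fin s) K} (hf : Prime f) :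
    (s : Cardinal) ≤ Algebra.trdeg K (MvPolynomial (Fin s) K ⧸ Ideal.span {f}) + 1 := by
  classical
  have hvars : f.vars.Nonempty := by
    by_contra h
    rw [Finset.not_nonempty_iff_eq_empty] at h
    obtain ⟨c, hc⟩ : ∃ c, f = MvPolynomial.C c :=
      ⟨_, MvPolynomial.vars_eq_empty_iff_eq_C.mp h⟩
    refine hf.not_isUnit ?_
    rw [hc]
    refine (IsUnit.mk0 c ?_).map MvPolynomial.C
    rintro rfl
    exact hf.ne_zero (by rw [hc, map_zero])
  obtain ⟨i, hi⟩ := hvars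
  have hprime : (Ideal.span {f}).IsPrime := (Ideal.span_singleton_prime hf.ne_zero).mpr hf
  let x : {j : Fin s // j ≠ i} → MvPolynomial (Fin s) K ⧸ Ideal.span {f} :=
    fun j => Ideal.Quotient.mk _ (MvPolynomial.X j.1)
  have hx : AlgebraicIndependent K x := by
    rw [AlgebraicIndependent, injective_iff_map_eq_zero]
    intro p hp
    have h1 : MvPolynomial.aeval x p = Ideal.Quotient.mkₐ K (Ideal.span {f})
        (MvPolynomial.rename Subtype.val p) := by
      rw [MvPolynomial.rename_eq_aeval, MvPolynomial.comp_aeval_apply]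
      rfl
    rw [h1] at hp
    obtain ⟨g, hg⟩ := Ideal.mem_span_singleton.mp (Ideal.Quotient.eq_zero_iff_mem.mp hp)
    have h2 : MvPolynomial.degreeOf i (MvPolynomial.rename
        (Subtype.val : {j : Fin s // j ≠ i} → Fin s) p) = 0 := by
      by_contra h
      rw [← ne_eq, ← MvPolynomial.mem_vars_iff_degreeOf_ne_zero] at h
      obtain ⟨j, hj⟩ := MvPolynomial.mem_vars_rename _ _ h
      exact j.2 hj.2
    by_contra hp0
    have h3 : MvPolynomial.rename (Subtype.val : {j : Fin s // j ≠ i} → Fin s) p ≠ 0 := fun h =>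
      hp0 (MvPolynomial.rename_injective _ Subtype.val_injective (by rw [h, map_zero]))
    have hg0 : g ≠ 0 := by
      rintro rfl
      exact h3 (by rw [hg, mul_zero])
    rw [hg, MvPolynomial.degreeOf_mul_eq hf.ne_zero hg0] at h2
    have h4 : MvPolynomial.degreeOf i f = 0 := by omega
    exact MvPolynomial.mem_vars_iff_degreeOf_ne_zero.mp hi h4
  have h5 := hx.lift_cardinalMk_le_trdeg
  have h6 : Cardinal.mk {j : Fin s // j ≠ i} = ((s - 1 : ℕ) : Cardinal) := by
    rw [Cardinal.mk_fintype]
    simp [Fintype.card_subtype_compl]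
  rw [h6, Cardinal.lift_natCast, Cardinal.lift_uzero] at h5
  have h7 : (s : Cardinal) = ((s - 1 : ℕ) : Cardinal) + 1 := by
    have : 0 < s := i.pos
    exact_mod_cast (by omega : s = s - 1 + 1)
  rw [h7]
  gcongr

/-- By Noether normalization `A` is finite over a polynomial ring. Going down bounds the height of
the contraction of `p` by one, so by unique factorization the contraction is generated by a prime
`f`, and the polynomial ring modulo `f` embeds into `A ⧸ p`. -/
theorem trdeg_le_trdeg_quotient_add_one {A : Type w} [CommRing A] [IsDomain A] [Algebra K A]
    [Algebra.FiniteType K A] {p : Ideal A} [p.IsPrime] (hp : p ≠ ⊥) (hht : p.height ≤ 1) :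
    Algebra.trdeg K A ≤ Algebra.trdeg K (A ⧸ p) + 1 := by
  obtain ⟨s, g, hinj, hfin⟩ := exists_finite_inj_algHom_of_fg K A
  let _ : Algebra (MvPolynomial (Fin s) K) A := g.toRingHom.toAlgebra
  have : IsScalarTower K (MvPolynomial (Fin s) K) A :=
    IsScalarTower.of_algebraMap_eq fun c => (g.commutes c).symm
  have : FaithfulSMul (MvPolynomial (Fin s) K) A :=
    (faithfulSMul_iff_algebraMap_injective _ _).mpr hinj
  have : Module.Finite (MvPolynomial (Fin s) K) A := hfin
  have : IsNoetherianRing A := Algebra.FiniteType.isNoetherianRing K A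
  have hA : Algebra.trdeg K A = (s : Cardinal) := by
    rw [← trdeg_add_eq K (MvPolynomial (Fin s) K) (A := A),
      trdeg_eq_zero (R := MvPolynomial (Fin s) K) (A := A), add_zero, MvPolynomial.trdeg_of_isDomain]
    simp
  let q : Ideal (MvPolynomial (Fin s) K) := p.under (MvPolynomial (Fin s) K)
  have hq : q ≠ ⊥ := by
    obtain ⟨f, hfp, hf0⟩ := Submodule.exists_mem_ne_zero_of_ne_bot hp
    exact Ideal.comap_ne_bot_of_integral_mem hf0 hfp (Algebra.IsIntegral.isIntegral f)
  have hqht : q.height ≤ 1 := by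
    have h := Ideal.height_eq_height_add_of_liesOver_of_hasGoingDown q p
    exact (le_self_add.trans h.ge).trans hht
  obtain ⟨f, hfq, hf⟩ := Ideal.IsPrime.exists_mem_prime_of_ne_bot (inferInstance : q.IsPrime) hq
  have hprime : (Ideal.span {f}).IsPrime := (Ideal.span_singleton_prime hf.ne_zero).mpr hf
  have hle : Ideal.span {f} ≤ q := (Ideal.span_singleton_le_iff_mem _).mpr hfq
  have hqf : Ideal.span {f} = q := by
    by_contra hne
    have h1 := Ideal.height_add_one_le_of_lt_of_isPrime (lt_of_le_of_ne hle hne)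
    have h2 : (⊥ : Ideal (MvPolynomial (Fin s) K)) < Ideal.span {f} :=
      bot_lt_iff_ne_bot.mpr (by simpa using hf.ne_zero)
    have h3 := Ideal.height_add_one_le_of_lt_of_isPrime h2
    rw [Ideal.height_bot, zero_add] at h3
    have h4 : (1 : ℕ∞) + 1 ≤ 1 := (add_le_add_left h3 1).trans (h1.trans hqht)
    exact absurd h4 (by decide)
  rw [hA]
  refine (trdeg_mvPolynomial_quotient_span hf).trans ?_
  gcongr
  have hker : ∀ a ∈ Ideal.span {f}, ((Ideal.Quotient.mkₐ K p).comp g) a = 0 := fun a ha =>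
    Ideal.Quotient.eq_zero_iff_mem.mpr (hle ha)
  refine trdeg_le_of_injective (Ideal.Quotient.liftₐ (Ideal.span {f})
    ((Ideal.Quotient.mkₐ K p).comp g) hker) ?_
  refine (injective_iff_map_eq_zero _).mpr fun a ha => ?_
  obtain ⟨a, rfl⟩ := Ideal.Quotient.mk_surjective a
  rw [Ideal.Quotient.eq_zero_iff_mem, hqf]
  exact show g a ∈ p from
    Ideal.Quotient.eq_zero_iff_mem.mp (show Ideal.Quotient.mk p (g a) = 0 from ha)

end Trdeg

end

noncomputable section

/-! ### Parameters of a cell -/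

/-- The positions of the free parameters of a normal vector. -/
def evenSlots (D : Finset ℕ) (n : ℕ) : Finset ℕ :=
  (Finset.range n).filter fun j => cutLo D j < j ∧ Even (j - cutLo D j)

/-- The normal vector with given parameters. -/
def slotVector {R : Type*} [CommRing R] (D : Finset ℕ) (n : ℕ) (b : evenSlots D n → R) (j : ℕ) :
    R :=
  if cutLo D j = j then 1 else if h : j ∈ evenSlots D n then b ⟨j, h⟩ else 0

section Slots

variable {R : Type*} [CommRing R] {n : ℕ} {D : Finset ℕ}

theorem isNormalVector_slotVector (hD : IsCutSet D 0 n) (b : evenSlots D n → R) :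
    IsNormalVector D n (slotVector D n b) where
  lo i _ := if_pos (cutLo_eq_self (hD.cutLo_mem (Nat.zero_le _)))
  odd i hi h := by
    have h0 : cutLo D i ≠ i := fun he => by simp [he] at h
    rw [slotVector, if_neg h0, dif_neg]
    simp only [evenSlots, Finset.mem_filter, not_and, Nat.not_even_iff_odd]
    exact fun _ _ => h

theorem IsNormalVector.eq_slotVector {β : ℕ → R} (hβ : IsNormalVector D n β) {j : ℕ} (hj : j < n) :
    β j = slotVector D n (fun k => β k) j := by
  unfold slotVector
  split_ifs with h1 h2
  · have := hβ.lo j hj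
    rwa [h1] at this
  · rfl
  · refine hβ.odd j hj ?_
    simp only [evenSlots, Finset.mem_filter, Finset.mem_range, not_and, Nat.not_even_iff_odd] at h2
    exact h2 hj (lt_of_le_of_ne (cutLo_le D j) h1)

theorem slotVector_apply (b : evenSlots D n → R) (j : evenSlots D n) :
    slotVector D n b j = b j := by
  have h := (Finset.mem_filter.mp j.2).2.1
  rw [slotVector, if_neg h.ne, dif_pos j.2]

theorem map_slotVector {S : Type*} [CommRing S] (f : R →+* S) (b : evenSlots D n → R) (j : ℕ) :
    f (slotVector D n b j) = slotVector D n (fun k => f (b k)) j := by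
  unfold slotVector
  split_ifs <;> simp

theorem hankelForm_congr {β β' : ℕ → R} (h : ∀ i < n, β i = β' i) (hD : IsCutSet D 0 n) :
    hankelForm n D β = hankelForm n D β' := by
  ext i j
  simp only [hankelForm, Matrix.of_apply]
  split_ifs with hc
  · have h1 := hD.lt_cutHi i.2
    rw [h _ (by omega)]
  · rfl

theorem limitMinor_congr {d : ℕ} {β β' : ℕ → R} (h : ∀ i < n, β i = β' i) (hD : IsCutSet D 0 n)
    (I J : Fin d → Fin n) : limitMinor D β I J = limitMinor D β' I J := by
  rw [limitMinor, limitMinor, hankelForm_congr h hD]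

theorem cutLo_eq_self_iff (hD : IsCutSet D 0 n) {j : ℕ} : cutLo D j = j ↔ j ∈ D :=
  ⟨fun h => h ▸ hD.cutLo_mem (Nat.zero_le _), cutLo_eq_self⟩

/-- Since blocks have odd length, `j ↦ j - 1` matches the slots with the positions at odd offset.
The positions left over are the left ends of blocks, which together with `n` make up `D`. -/
theorem two_mul_card_evenSlots (hD : IsCutSet D 0 n) (ho : OddBlocks D n) :
    2 * (evenSlots D n).card + D.card = n + 1 := by
  let odds := (Finset.range n).filter fun j => Odd (j - cutLo D j)
  have h1 : (evenSlots D n).card = odds.card := by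
    refine Finset.card_nbij' (fun j => j - 1) (fun j => j + 1) ?_ ?_ ?_ ?_
    · intro j hj
      simp only [evenSlots, Finset.coe_filter, Finset.mem_range, Set.mem_ofPred_eq, odds] at hj ⊢
      obtain ⟨h1, h2, h3⟩ := hj
      refine ⟨by omega, ?_⟩
      rw [cutLo_sub_one h2, Nat.odd_iff]
      rw [Nat.even_iff] at h3
      omega
    · intro j hj
      simp only [evenSlots, Finset.coe_filter, Finset.mem_range, Set.mem_ofPred_eq, odds] at hj ⊢
      obtain ⟨h1, h2⟩ := hj
      have h3 := ho j h1
      have h4 := hD.lt_cutHi h1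
      have h5 := hD.cutHi_le_right h1
      have h6 := cutLo_le D j
      rw [Nat.odd_iff] at h2 h3
      have h7 : cutLo D (j + 1) = cutLo D j :=
        hD.cutLo_eq_of_mem (by omega) (by omega) (Nat.zero_le _)
      rw [h7, Nat.even_iff]
      omega
    · intro j hj
      simp only [evenSlots, Finset.coe_filter, Finset.mem_range, Set.mem_ofPred_eq] at hj
      simp only
      omega
    · intro j _
      simp
  have h2 : D = insert n ((Finset.range n).filter fun j => cutLo D j = j) := by
    ext c
    simp only [Finset.mem_insert, Finset.mem_filter, Finset.mem_range, cutLo_eq_self_iff hD]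
    constructor
    · intro hc
      have := hD.le_right c hc
      by_cases he : c = n
      · exact Or.inl he
      · exact Or.inr ⟨by omega, hc⟩
    · rintro (rfl | h)
      · exact hD.right_mem
      · exact h.2
  have h3 : D.card = ((Finset.range n).filter fun j => cutLo D j = j).card + 1 := by
    conv_lhs => rw [h2]
    exact Finset.card_insert_of_notMem (by simp)
  have h4 : (Finset.range n).card = ((Finset.range n).filter fun j => cutLo D j = j).card +
      ((evenSlots D n).card + odds.card) := by
    rw [← Finset.card_filter_add_card_filter_not (s := Finset.range n) fun j => cutLo D j = j]
    congr 1
    rw [← Finset.card_union_of_disjoint]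
    · congr 1
      ext j
      simp only [evenSlots, odds, Finset.mem_filter, Finset.mem_union, Finset.mem_range]
      have h5 := cutLo_le D j
      rw [Nat.even_iff, Nat.odd_iff]
      omega
    · refine Finset.disjoint_filter.mpr ?_
      intro j _ h1 h2
      exact absurd h1.2 (Nat.not_even_iff_odd.mpr h2)
  rw [Finset.card_range] at h4
  omega

end Slots

/-! ### Compositions and cut sets -/

theorem cutLo_eq_of_gap {D : Finset ℕ} {a b j : ℕ} (ha : a ∈ D) (h1 : a ≤ j) (h2 : j < b)
    (h : ∀ c ∈ D, c ≤ a ∨ b ≤ c) : cutLo D j = a := by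
  refine le_antisymm (Finset.sup_le fun c hc => ?_) (le_cutLo ha h1)
  rw [Finset.mem_filter] at hc
  have := h c hc.1
  simp only [id]
  omega

theorem cutHi_eq_of_gap {D : Finset ℕ} {a b j : ℕ} (hb : b ∈ D) (h1 : a ≤ j) (h2 : j < b)
    (h : ∀ c ∈ D, c ≤ a ∨ b ≤ c) : cutHi D j = b := by
  refine le_antisymm (cutHi_le hb h2) ?_
  have := Nat.sInf_mem (s := {c | c ∈ D ∧ j < c}) ⟨b, hb, h2⟩
  obtain ⟨h3, h4⟩ := this
  have := h _ h3
  simp only [cutHi]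
  omega

/-- The partial sums of a composition. -/
def compositionCuts {n : ℕ} (c : Composition n) : Finset ℕ := c.boundaries.map Fin.valEmbedding

section CompositionCuts

variable {n : ℕ}

theorem mem_compositionCuts {c : Composition n} {a : ℕ} :
    a ∈ compositionCuts c ↔ ∃ i ≤ c.length, c.sizeUpTo i = a := by
  simp only [compositionCuts, Composition.boundaries, Finset.mem_map, Finset.mem_univ, true_and]
  constructor
  · rintro ⟨_, ⟨i, rfl⟩, rfl⟩
    exact ⟨i, by omega, rfl⟩
  · rintro ⟨i, hi, rfl⟩
    exact ⟨_, ⟨⟨i, by omega⟩, rfl⟩, rfl⟩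

theorem isCutSet_compositionCuts (c : Composition n) : IsCutSet (compositionCuts c) 0 n where
  left_mem := mem_compositionCuts.mpr ⟨0, Nat.zero_le _, c.sizeUpTo_zero⟩
  right_mem := mem_compositionCuts.mpr ⟨c.length, le_rfl, c.sizeUpTo_length⟩
  left_le _ _ := Nat.zero_le _
  le_right a ha := by
    obtain ⟨i, -, rfl⟩ := mem_compositionCuts.mp ha
    exact c.sizeUpTo_le i

theorem compositionCuts_gap (c : Composition n) (i : ℕ) :
    ∀ a ∈ compositionCuts c, a ≤ c.sizeUpTo i ∨ c.sizeUpTo (i + 1) ≤ a := by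
  intro a ha
  obtain ⟨m, -, rfl⟩ := mem_compositionCuts.mp ha
  rcases le_or_gt m i with h | h
  · exact Or.inl (c.monotone_sizeUpTo h)
  · exact Or.inr (c.monotone_sizeUpTo h)

theorem cutLo_compositionCuts (c : Composition n) {i j : ℕ} (hi : i < c.length)
    (h1 : c.sizeUpTo i ≤ j) (h2 : j < c.sizeUpTo (i + 1)) :
    cutLo (compositionCuts c) j = c.sizeUpTo i :=
  cutLo_eq_of_gap (mem_compositionCuts.mpr ⟨i, hi.le, rfl⟩) h1 h2 (compositionCuts_gap c i)

theorem cutHi_compositionCuts (c : Composition n) {i j : ℕ} (hi : i < c.length)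
    (h1 : c.sizeUpTo i ≤ j) (h2 : j < c.sizeUpTo (i + 1)) :
    cutHi (compositionCuts c) j = c.sizeUpTo (i + 1) :=
  cutHi_eq_of_gap (mem_compositionCuts.mpr ⟨i + 1, hi, rfl⟩) h1 h2 (compositionCuts_gap c i)

theorem compositionCuts_injective : Function.Injective (compositionCuts (n := n)) := by
  intro c c' h
  apply (compositionEquiv n).injective
  apply CompositionAsSet.ext
  exact Finset.map_injective _ h

theorem card_compositionCuts (c : Composition n) : (compositionCuts c).card = c.length + 1 := by
  rw [compositionCuts, Finset.card_map, c.card_boundaries_eq_succ_length]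

theorem oddBlocks_compositionCuts (γ : OddComposition n) : OddBlocks (compositionCuts γ.1) n := by
  intro j hj
  have h1 := γ.1.sizeUpTo_index_le ⟨j, hj⟩
  have h2 := γ.1.lt_sizeUpTo_index_succ ⟨j, hj⟩
  have h3 := (γ.1.index ⟨j, hj⟩).2
  rw [cutLo_compositionCuts γ.1 h3 h1 h2, cutHi_compositionCuts γ.1 h3 h1 h2,
    γ.1.sizeUpTo_succ h3, Nat.add_sub_cancel_left]
  exact γ.2 _ (List.getElem_mem _)

theorem exists_compositionCuts_eq {D : Finset ℕ} (hD : IsCutSet D 0 n) (ho : OddBlocks D n) :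
    ∃ γ : OddComposition n, compositionCuts γ.1 = D := by
  let S : CompositionAsSet n :=
    { boundaries := Finset.univ.filter fun i : Fin (n + 1) => (i : ℕ) ∈ D
      zero_mem := by simp [hD.left_mem]
      getLast_mem := by simp [hD.right_mem] }
  have hS : compositionCuts S.toComposition = D := by
    ext a
    simp only [compositionCuts, CompositionAsSet.toComposition_boundaries, S, Finset.mem_map,
      Finset.mem_filter, Finset.mem_univ, true_and]
    constructor
    · rintro ⟨i, hi, rfl⟩
      exact hi
    · intro ha
      exact ⟨⟨a, Nat.lt_succ_of_le (hD.le_right a ha)⟩, ha, rfl⟩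
  refine ⟨⟨S.toComposition, fun b hb => ?_⟩, hS⟩
  obtain ⟨i, hi, rfl⟩ := List.getElem_of_mem hb
  have h1 := S.toComposition.sizeUpTo_strict_mono hi
  have h2 := ho (S.toComposition.sizeUpTo i) (h1.trans_le (S.toComposition.sizeUpTo_le _))
  rw [← hS, cutLo_compositionCuts _ hi le_rfl h1, cutHi_compositionCuts _ hi le_rfl h1,
    S.toComposition.sizeUpTo_succ hi, Nat.add_sub_cancel_left] at h2
  exact h2

theorem two_mul_card_evenSlots_add_numParts (γ : OddComposition n) :
    2 * (evenSlots (compositionCuts γ.1) n).card + γ.numParts = n := by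
  have := two_mul_card_evenSlots (isCutSet_compositionCuts γ.1) (oddBlocks_compositionCuts γ)
  rw [card_compositionCuts] at this
  unfold OddComposition.numParts
  omega

theorem card_evenSlots_eq (γ : OddComposition n) :
    (evenSlots (compositionCuts γ.1) n).card = (n - γ.numParts) / 2 := by
  have := two_mul_card_evenSlots_add_numParts γ
  omega

theorem card_evenSlots_lt {γ δ : OddComposition n}
    (h : compositionCuts γ.1 ⊂ compositionCuts δ.1) :
    (evenSlots (compositionCuts δ.1) n).card < (evenSlots (compositionCuts γ.1) n).card := by
  have h1 := two_mul_card_evenSlots (isCutSet_compositionCuts γ.1) (oddBlocks_compositionCuts γ)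
  have h2 := two_mul_card_evenSlots (isCutSet_compositionCuts δ.1) (oddBlocks_compositionCuts δ)
  have h3 := Finset.card_lt_card h
  omega

end CompositionCuts

end

noncomputable section

/-! ### Leading coefficients of minors of a one-parameter family -/

section ArcMinors

variable {R : Type*} [CommRing R] {n d : ℕ} {D : Finset ℕ}

/-- `A` is block triangular, so a nonzero term of the Leibniz expansion moves no index to a lower
block. As the block sum of `I` is already maximal, it stays in the same block, and only the diagonal
blocks contribute. -/
theorem det_submatrix_of_isTopTuple {A B : Matrix (Fin n) (Fin n) R} {c : ℕ → R}
    (h1 : ∀ i k : Fin n, cutLo D k < cutLo D i → A i k = 0)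
    (h2 : ∀ i k : Fin n, cutLo D i = cutLo D k → A i k = c (cutLo D i) * B i k)
    (h3 : ∀ i k : Fin n, cutLo D i ≠ cutLo D k → B i k = 0)
    {I : Fin d → Fin n} (hI : IsTopTuple D I) (J : Fin d → Fin n) :
    (A.submatrix I J).det = (∏ i, c (cutLo D (I i))) * (B.submatrix I J).det := by
  by_cases hJ : Function.Injective J
  · simp only [Matrix.det_apply', Finset.mul_sum, Matrix.submatrix_apply]
    refine Finset.sum_congr rfl fun σ _ => ?_
    by_cases he : ∀ i, cutLo D (I (σ i)) = cutLo D (J i)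
    · rw [Finset.prod_congr rfl fun i _ => h2 _ _ (he i), Finset.prod_mul_distrib,
        Equiv.prod_comp σ fun i => c (cutLo D (I i))]
      ring
    · have hB : ∏ i, B (I (σ i)) (J i) = 0 := by
        push Not at he
        obtain ⟨i, hi⟩ := he
        exact Finset.prod_eq_zero (Finset.mem_univ i) (h3 _ _ hi)
      have hA : ∏ i, A (I (σ i)) (J i) = 0 := by
        by_contra hne
        have hle : ∀ i ∈ Finset.univ, cutLo D (I (σ i)) ≤ cutLo D (J i) := fun i hi => by
          by_contra hlt
          exact hne (Finset.prod_eq_zero hi (h1 _ _ (not_le.mp hlt)))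
        have hsum := sum_cutLo_le D hJ
        rw [← hI, ← Equiv.sum_comp σ fun i => cutLo D (I i)] at hsum
        exact he fun i => (Finset.sum_eq_sum_iff_of_le hle).mp
          (le_antisymm (Finset.sum_le_sum hle) hsum) i (Finset.mem_univ i)
      rw [hA, hB]
      ring
  · simp only [Function.Injective, not_forall] at hJ
    obtain ⟨a, b, hab, hne⟩ := hJ
    rw [Matrix.det_zero_of_column_eq hne (by intro i; simp [hab]),
      Matrix.det_zero_of_column_eq hne (by intro i; simp [hab]), mul_zero]

theorem prod_cutLo_of_isTopTuple {I : Fin d → Fin n} (hinj : Function.Injective I)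
    (hI : IsTopTuple D I) (c : ℕ → R) :
    ∏ i, c (cutLo D (I i)) = ∏ i : Fin d, c (cutLo D (n - d + i)) := by
  obtain ⟨σ, hσ⟩ := hI.exists_perm hinj
  rw [← Equiv.prod_comp σ]
  exact Finset.prod_congr rfl fun i _ => by rw [(hσ i).2]

/-- Row `i` is divisible by `X ^ e i`, so a minor with rows `I` has order at least `∑ e (I i)`. This
sum attains its minimum exactly at the top tuples, and for them the leading coefficient is a minor
of the constant term of `A'`. -/
theorem coeff_minor_arc {A A' : Matrix (Fin n) (Fin n) R[X]} {e : ℕ → ℕ} {c β : ℕ → R}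
    (hA : ∀ i k : Fin n, A i k = Polynomial.X ^ e i * A' i k)
    (he : ∀ i k, i < n → k < n → cutLo D i = cutLo D k → e i = e k)
    (he' : ∀ i k, i < n → k < n → cutLo D i < cutLo D k → e k < e i)
    (h1 : ∀ i k : Fin n, cutLo D k < cutLo D i → (A' i k).coeff 0 = 0)
    (h2 : ∀ i k : Fin n, cutLo D i = cutLo D k →
      (A' i k).coeff 0 = c (cutLo D i) * hankelForm n D β i k) (I J : Fin d → Fin n) :
    (∀ m < ∑ i : Fin d, e (n - d + i), (A.submatrix I J).det.coeff m = 0) ∧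
    (A.submatrix I J).det.coeff (∑ i : Fin d, e (n - d + i)) =
      (∏ i : Fin d, c (cutLo D (n - d + i))) * limitMinor D β I J := by
  by_cases hI : Function.Injective I
  · have hdn : d ≤ n := by simpa using Fintype.card_le_of_injective I hI
    have hdet : (A.submatrix I J).det =
        (A'.submatrix I J).det * Polynomial.X ^ (∑ i, e (I i)) := by
      rw [← Finset.prod_pow_eq_pow_sum, mul_comm, ← Matrix.det_mul_column]
      congr 1
      ext1 i k
      exact hA _ _
    obtain ⟨σ, hσ⟩ := exists_perm_le_of_injective hI
    have hle : ∀ i ∈ Finset.univ, e (n - d + (i : Fin d)) ≤ e (I (σ i)) := fun i _ => by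
      have hi : n - d + (i : ℕ) < n := by omega
      rcases (cutLo_mono D (hσ i)).lt_or_eq with h | h
      · exact (he' _ _ (I (σ i)).2 hi h).le
      · exact (he _ _ (I (σ i)).2 hi h).ge
    have hsum : ∑ i : Fin d, e (n - d + i) ≤ ∑ i, e (I i) := by
      rw [← Equiv.sum_comp σ fun i => e (I i)]
      exact Finset.sum_le_sum hle
    rw [hdet]
    refine ⟨fun m hm => ?_, ?_⟩
    · rw [Polynomial.coeff_mul_X_pow', if_neg (by omega)]
    · by_cases htop : IsTopTuple D I
      · have heq : ∑ i : Fin d, e (n - d + i) = ∑ i, e (I i) := by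
          obtain ⟨τ, hτ⟩ := htop.exists_perm hI
          rw [← Equiv.sum_comp τ fun i => e (I i)]
          exact Finset.sum_congr rfl fun i _ => he _ _ (by omega) (I (τ i)).2 (hτ i).2.symm
        have h0 : (A'.submatrix I J).det.coeff 0 =
            ((A'.map (Polynomial.constantCoeff (R := R))).submatrix I J).det := by
          rw [← Polynomial.constantCoeff_apply, RingHom.map_det]
          rfl
        rw [heq, Polynomial.coeff_mul_X_pow', if_pos le_rfl, Nat.sub_self, h0,
          limitMinor, if_pos htop, ← prod_cutLo_of_isTopTuple hI htop c]
        exact det_submatrix_of_isTopTuple h1 h2 (fun i k h => hankelForm_apply_of_ne h) htop J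
      · have hlt : ∑ i : Fin d, e (n - d + i) < ∑ i, e (I i) := by
          refine lt_of_le_of_ne hsum fun heq => htop ?_
          refine isTopTuple_of_perm (σ := σ) fun i => ?_
          rw [← Equiv.sum_comp σ fun i => e (I i)] at heq
          have h3 := (Finset.sum_eq_sum_iff_of_le hle).mp heq i (Finset.mem_univ i)
          by_contra hne
          have := he' _ _ (I (σ i)).2 (by omega : n - d + (i : ℕ) < n)
            (lt_of_le_of_ne (cutLo_mono D (hσ i)) hne)
          omega
        rw [Polynomial.coeff_mul_X_pow', if_neg (by omega), limitMinor, if_neg htop, mul_zero]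
  · have h0 : (A.submatrix I J).det = 0 := by
      simp only [Function.Injective, not_forall] at hI
      obtain ⟨a, b, hab, hne⟩ := hI
      exact Matrix.det_zero_of_row_eq hne (by ext1 j; simp [hab])
    rw [h0, limitMinor_of_not_injective hI]
    simp

theorem isTopTuple_last (D : Finset ℕ) (hd : d ≤ n) :
    IsTopTuple D (fun i : Fin d => (⟨n - d + i, by omega⟩ : Fin n)) := rfl

theorem exists_limitMinor_ne_zero [Nontrivial R] {β : ℕ → R} (hD : IsCutSet D 0 n)
    (hβ : ∀ i < n, β (cutLo D i) = 1) (hd : d ≤ n) :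
    ∃ I J : Fin d → Fin n, limitMinor D β I J ≠ 0 := by
  obtain ⟨J, hJ⟩ := exists_det_submatrix_ne_zero (hankelForm n D β) (isUnit_det_hankelForm hD hβ)
    (I := fun i : Fin d => (⟨n - d + i, by omega⟩ : Fin n))
    (fun a b h => by simp only [Fin.mk.injEq] at h; exact Fin.ext (by omega))
  exact ⟨_, J, by rwa [limitMinor, if_pos (isTopTuple_last D hd)]⟩

end ArcMinors

/-! ### Change of coordinates -/

section ChangeCoord

variable {K : Type*} {n : ℕ}

/-- The effect of the linear substitution `P` on the minors of a family of matrices. -/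
def changeCoord [CommRing K] (P : Matrix (Fin n) (Fin n) K)
    (y : CompleteQuadric.CoordIndex n → K) (c : CompleteQuadric.CoordIndex n) : K :=
  ∑ L, ∑ L', (∏ i, P (L i) (c.2.1 i)) * (∏ i, P (L' i) (c.2.2 i)) * y ⟨c.1, (L, L')⟩

theorem sum_prod_mul_prod [CommRing K] {d : ℕ} (P Q : Matrix (Fin n) (Fin n) K)
    (I L : Fin d → Fin n) :
    ∑ M : Fin d → Fin n, (∏ i, Q (M i) (I i)) * ∏ i, P (L i) (M i) =
      ∏ i, (P * Q) (L i) (I i) := by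
  simp only [Matrix.mul_apply, Finset.prod_univ_sum, Fintype.piFinset_univ]
  refine Finset.sum_congr rfl fun M _ => ?_
  rw [← Finset.prod_mul_distrib]
  exact Finset.prod_congr rfl fun i _ => mul_comm _ _

theorem changeCoord_changeCoord [CommRing K] (P Q : Matrix (Fin n) (Fin n) K)
    (y : CompleteQuadric.CoordIndex n → K) :
    changeCoord Q (changeCoord P y) = changeCoord (P * Q) y := by
  ext c
  simp only [changeCoord, ← sum_prod_mul_prod P Q, Finset.mul_sum, Finset.sum_mul]
  have h1 : ∀ f : (Fin (c.1 + 1) → Fin n) → (Fin (c.1 + 1) → Fin n) → (Fin (c.1 + 1) → Fin n) →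
      (Fin (c.1 + 1) → Fin n) → K, ∑ a, ∑ b, ∑ a', ∑ b', f a b a' b' =
      ∑ a', ∑ b', ∑ b, ∑ a, f a b a' b' := by
    intro f
    have h2 : ∀ a, ∑ b, ∑ a', ∑ b', f a b a' b' = ∑ a', ∑ b', ∑ b, f a b a' b' := fun a => by
      rw [Finset.sum_comm]
      exact Finset.sum_congr rfl fun a' _ => Finset.sum_comm
    simp only [h2]
    rw [Finset.sum_comm]
    refine Finset.sum_congr rfl fun a' _ => ?_
    rw [Finset.sum_comm]
    exact Finset.sum_congr rfl fun b' _ => Finset.sum_comm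
  rw [h1]
  refine Finset.sum_congr rfl fun L _ => Finset.sum_congr rfl fun L' _ =>
    Finset.sum_congr rfl fun M _ => Finset.sum_congr rfl fun M' _ => ?_
  ring

theorem changeCoord_one [CommRing K] (y : CompleteQuadric.CoordIndex n → K) :
    changeCoord 1 y = y := by
  have h : ∀ {d : ℕ} (I L : Fin d → Fin n),
      ∏ i, (1 : Matrix (Fin n) (Fin n) K) (L i) (I i) = if L = I then 1 else 0 := by
    intro d I L
    split_ifs with h
    · subst h
      simp
    · obtain ⟨i, hi⟩ := Function.ne_iff.mp h
      exact Finset.prod_eq_zero (Finset.mem_univ i) (Matrix.one_apply_ne hi)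
  ext c
  simp [changeCoord, h]

theorem coeff_det_congruence [CommRing K] {d : ℕ} (P : Matrix (Fin n) (Fin n) K)
    (A : Matrix (Fin n) (Fin n) K[X]) (I J : Fin d → Fin n) (m : ℕ) :
    (((P.map Polynomial.C).transpose * A * P.map Polynomial.C).submatrix I J).det.coeff m =
      ∑ L : Fin d → Fin n, ∑ L' : Fin d → Fin n,
        (∏ i, P (L i) (I i)) * (∏ i, P (L' i) (J i)) * (A.submatrix L L').det.coeff m := by
  rw [det_congruence_submatrix, Polynomial.finsetSum_coeff]
  refine Finset.sum_congr rfl fun L _ => ?_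
  rw [Polynomial.finsetSum_coeff]
  refine Finset.sum_congr rfl fun L' _ => ?_
  simp only [Matrix.map_apply]
  rw [← map_prod, ← map_prod, ← map_mul, Polynomial.coeff_C_mul]

-- Coefficients of minors before and after the congruence are linear combinations of each other, by
-- `P` and by its inverse.
open CompleteQuadric in
theorem minorOrder_congruence [Field K] {P : Matrix (Fin n) (Fin n) K} (hP : IsUnit P.det)
    (A : Matrix (Fin n) (Fin n) K[X]) (d : ℕ) :
    minorOrder ((P.map Polynomial.C).transpose * A * P.map Polynomial.C) d = minorOrder A d := by
  have key : ∀ (Q : Matrix (Fin n) (Fin n) K) (B : Matrix (Fin n) (Fin n) K[X]),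
      {m | ∃ s t : Fin d → Fin n, (((Q.map Polynomial.C).transpose * B *
        Q.map Polynomial.C).submatrix s t).det.coeff m ≠ 0} ⊆
      {m | ∃ s t : Fin d → Fin n, (B.submatrix s t).det.coeff m ≠ 0} := by
    rintro Q B m ⟨s, t, h⟩
    by_contra hcon
    simp only [Set.mem_ofPred_eq, not_exists, not_not] at hcon
    rw [coeff_det_congruence] at h
    simp [hcon] at h
  unfold minorOrder
  congr 1
  refine Set.Subset.antisymm (key P A) ?_
  have h1 : P.map (Polynomial.C (R := K)) * P⁻¹.map Polynomial.C = 1 := by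
    rw [← Matrix.map_mul, Matrix.mul_nonsing_inv P hP]
    simp
  have h2 := key P⁻¹ ((P.map Polynomial.C).transpose * A * P.map Polynomial.C)
  have h3 : (P⁻¹.map (Polynomial.C (R := K))).transpose *
      ((P.map Polynomial.C).transpose * A * P.map Polynomial.C) * P⁻¹.map Polynomial.C = A := by
    have h4 : (P⁻¹.map (Polynomial.C (R := K))).transpose * (P.map Polynomial.C).transpose = 1 := by
      rw [← Matrix.transpose_mul, h1, Matrix.transpose_one]
    calc _ = ((P⁻¹.map (Polynomial.C (R := K))).transpose * (P.map Polynomial.C).transpose) * A *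
        (P.map (Polynomial.C (R := K)) * P⁻¹.map Polynomial.C) := by
          simp only [Matrix.mul_assoc]
      _ = A := by rw [h1, h4, Matrix.one_mul, Matrix.mul_one]
  rwa [h3] at h2

end ChangeCoord

end

noncomputable section

/-! ### The Cayley transform of a regular unipotent element -/

section RegularUnipotent

variable {K : Type*} [Field K] {n : ℕ}

/-- `T` is the Cayley transform of `U`, and it shifts the basis `e`. -/
structure IsCayleyBasis (U T : Module.End K (Fin n → K)) (e : Module.Basis (Fin n) K (Fin n → K)) :
    Prop where
  cayley : (1 - T) * U = 1 + T
  comm : Commute T U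
  shift : ∀ i : Fin n, T (e i) = if h : 0 < (i : ℕ) then e ⟨i - 1, by omega⟩ else 0

/-- Applying `T ^ i` to a relation kills the terms with smaller index; those with larger index are
already known to have coefficient zero. -/
theorem linearIndependent_pow_apply {V : Type*} [AddCommGroup V] [Module K V] {T : Module.End K V}
    {w : V} {m : ℕ} (h0 : T ^ (m + 1) = 0) (hw : (T ^ m) w ≠ 0) :
    LinearIndependent K fun i : Fin (m + 1) => (T ^ (m - i)) w := by
  rw [Fintype.linearIndependent_iff]
  intro g hg
  have key : ∀ r : ℕ, ∀ i : Fin (m + 1), m - i = r → g i = 0 := by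
    intro r
    induction r using Nat.strong_induction_on with
    | _ r ih =>
      intro i hi
      have h1 := congrArg (T ^ (i : ℕ)) hg
      rw [map_sum, map_zero, Finset.sum_eq_single i] at h1
      · rw [map_smul, ← Module.End.mul_apply, ← pow_add,
          show (i : ℕ) + (m - i) = m by omega] at h1
        exact (smul_eq_zero.mp h1).resolve_right hw
      · intro j _ hj
        rcases lt_or_gt_of_ne (fun h => hj (Fin.ext h) : (j : ℕ) ≠ i) with hlt | hgt
        · rw [map_smul, ← Module.End.mul_apply, ← pow_add,
            show (i : ℕ) + (m - j) = (m + 1) + (i - j - 1) by omega, pow_add, h0, zero_mul,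
            LinearMap.zero_apply, smul_zero]
        · rw [ih (m - j) (by omega) j rfl, zero_smul, map_zero]
      · simp
  exact fun i => key _ i rfl

/-- `U + 1` is `2` plus a nilpotent, hence invertible, and `T = (U - 1)(U + 1)⁻¹` has the same
nilpotency index as `U - 1`. A vector not killed by the last nonzero power of `T` generates the
basis. The Cayley transform is preferred to `U - 1` because it converts invariance of a form into
exact skewness. -/
theorem exists_isCayleyBasis [CharZero K] (u : Matrix.SpecialLinearGroup (Fin n) K)
    (hu : IsRegularUnipotent u) :
    ∃ T e, IsCayleyBasis (Matrix.SpecialLinearGroup.toLin' u).toLinearMap T e := by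
  set U : Module.End K (Fin n → K) := (Matrix.SpecialLinearGroup.toLin' u).toLinearMap
  have hpow : ∀ m, (U - 1) ^ m = Matrix.toLinAlgEquiv' (((u : Matrix (Fin n) (Fin n) K) - 1) ^ m) := by
    intro m
    rw [map_pow, map_sub, map_one]
    rfl
  have hnil : (U - 1) ^ n = 0 := by rw [hpow, hu.1, map_zero]
  have hS : IsUnit (U + 1) := by
    have h2 : IsUnit ((2 : K) • (1 : Module.End K (Fin n → K))) :=
      ⟨⟨(2 : K) • 1, (2 : K)⁻¹ • 1, by simp [smul_smul], by simp [smul_smul]⟩, rfl⟩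
    have h3 : U + 1 = (2 : K) • (1 : Module.End K (Fin n → K)) + (U - 1) := by
      rw [two_smul]
      abel
    rw [h3]
    exact IsNilpotent.isUnit_add_left_of_commute ⟨n, hnil⟩ h2
      ((Commute.one_right _).smul_right _)
  obtain ⟨S, hSU⟩ := hS
  have hUS : Commute U (↑S⁻¹ : Module.End K (Fin n → K)) := by
    refine Commute.units_inv_right ?_
    rw [hSU]
    exact (Commute.refl U).add_right (Commute.one_right U)
  have hNS : Commute (U - 1) (↑S⁻¹ : Module.End K (Fin n → K)) := hUS.sub_left (Commute.one_left _)
  set T : Module.End K (Fin n → K) := (U - 1) * ↑S⁻¹ with hT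
  have hTS : T * U + T = U - 1 := by
    have : T * (U + 1) = U - 1 := by rw [← hSU, hT, mul_assoc, S.inv_mul, mul_one]
    rwa [mul_add, mul_one] at this
  have hTpow : ∀ m, T ^ m = (U - 1) ^ m * ↑(S⁻¹ ^ m) := fun m => by
    rw [hT, hNS.mul_pow, Units.val_pow_eq_pow_val]
  have hcay : (1 - T) * U = 1 + T := by
    rw [sub_mul, one_mul, ← sub_eq_zero]
    rw [← sub_eq_zero] at hTS
    rw [← neg_eq_zero, ← hTS]
    abel
  have hcomm : Commute T U := by
    rw [hT]
    exact ((Commute.refl U).sub_left (Commute.one_left U)).mul_left hUS.symm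
  refine ⟨T, ?_⟩
  rcases n with _ | m
  · exact ⟨Pi.basisFun K (Fin 0), hcay, hcomm, fun i => i.elim0⟩
  · have h0 : T ^ (m + 1) = 0 := by rw [hTpow, hnil, zero_mul]
    have h1 : T ^ m ≠ 0 := by
      intro h
      rw [hTpow] at h
      have h2 : (U - 1) ^ m = 0 := (Units.mul_left_eq_zero _).mp h
      rw [hpow, map_eq_zero_iff _ (AlgEquiv.injective _)] at h2
      exact hu.2 m (Nat.lt_succ_self m) h2
    obtain ⟨w, hw⟩ : ∃ w, (T ^ m) w ≠ 0 := by
      by_contra hcon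
      push Not at hcon
      exact h1 (LinearMap.ext hcon)
    refine ⟨basisOfLinearIndependentOfCardEqFinrank (linearIndependent_pow_apply h0 hw) (by simp),
      hcay, hcomm, fun i => ?_⟩
    simp only [coe_basisOfLinearIndependentOfCardEqFinrank]
    rw [← Module.End.mul_apply, ← pow_succ']
    split_ifs with h
    · congr 2
      omega
    · rw [show m - (i : ℕ) + 1 = m + 1 by omega, h0, LinearMap.zero_apply]

/-- The span of the first `d` vectors of a basis. -/
def initialSubspace (e : Module.Basis (Fin n) K (Fin n → K)) (d : ℕ) : Submodule K (Fin n → K) where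
  carrier := {v | ∀ i : Fin n, d ≤ i → e.repr v i = 0}
  add_mem' hv hw i hi := by simp [hv i hi, hw i hi]
  zero_mem' i _ := by simp
  smul_mem' a v hv i hi := by simp [hv i hi]

theorem mem_initialSubspace {e : Module.Basis (Fin n) K (Fin n → K)} {d : ℕ} {v : Fin n → K} :
    v ∈ initialSubspace e d ↔ ∀ i : Fin n, d ≤ i → e.repr v i = 0 := Iff.rfl

theorem basis_mem_initialSubspace {e : Module.Basis (Fin n) K (Fin n → K)} {d : ℕ} {i : Fin n} :
    e i ∈ initialSubspace e d ↔ (i : ℕ) < d := by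
  rw [mem_initialSubspace]
  constructor
  · intro h
    by_contra hle
    simpa using h i (not_lt.mp hle)
  · intro h j hj
    rw [e.repr_self, Finsupp.single_apply, if_neg]
    rintro rfl
    omega

theorem finrank_initialSubspace (e : Module.Basis (Fin n) K (Fin n → K)) {d : ℕ} (hd : d ≤ n) :
    Module.finrank K (initialSubspace e d) = d := by
  let f : initialSubspace e d →ₗ[K] (Fin d → K) :=
    { toFun := fun v i => e.repr v.1 (Fin.castLE hd i)
      map_add' := fun v w => by ext; simp
      map_smul' := fun a v => by ext; simp }
  have hf : Function.Bijective f := by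
    constructor
    · rw [injective_iff_map_eq_zero]
      intro v hv
      refine Subtype.ext (e.ext_elem fun i => ?_)
      rcases lt_or_ge (i : ℕ) d with h | h
      · have h1 : e.repr v.1 i = 0 := congrFun hv ⟨i, h⟩
        simpa using h1
      · simpa using v.2 i h
    · intro g
      refine ⟨⟨e.equivFun.symm fun i => if h : (i : ℕ) < d then g ⟨i, h⟩ else 0, fun i hi => ?_⟩, ?_⟩
      · rw [← e.equivFun_apply, LinearEquiv.apply_symm_apply, dif_neg (not_lt.mpr hi)]
      · ext i
        simp only [f, LinearMap.coe_mk, AddHom.coe_mk]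
        rw [← e.equivFun_apply, LinearEquiv.apply_symm_apply]
        exact dif_pos i.2
  rw [(LinearEquiv.ofBijective f hf).finrank_eq, Module.finrank_fin_fun]

namespace IsCayleyBasis

variable {U T : Module.End K (Fin n → K)} {e : Module.Basis (Fin n) K (Fin n → K)}

theorem repr_apply (h : IsCayleyBasis U T e) (v : Fin n → K) (i : Fin n) :
    e.repr (T v) i = if hi : (i : ℕ) + 1 < n then e.repr v ⟨i + 1, hi⟩ else 0 := by
  have key : (e.coord i).comp T =
      if hi : (i : ℕ) + 1 < n then e.coord ⟨i + 1, hi⟩ else 0 := by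
    refine e.ext fun j => ?_
    rw [LinearMap.comp_apply, h.shift]
    split_ifs with h1 h2 h2
    · simp only [Module.Basis.coord_apply, e.repr_self, Finsupp.single_apply, Fin.ext_iff]
      congr 1
      simp only [eq_iff_iff]
      omega
    · simp only [Module.Basis.coord_apply, e.repr_self, Finsupp.single_apply, Fin.ext_iff,
        LinearMap.zero_apply]
      rw [if_neg]
      omega
    · simp only [Module.Basis.coord_apply, e.repr_self, Finsupp.single_apply, Fin.ext_iff, map_zero]
      rw [if_neg]
      omega
    · simp
  have := LinearMap.congr_fun key v
  rw [LinearMap.comp_apply, Module.Basis.coord_apply] at this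
  rw [this]
  split_ifs <;> rfl

/-- Initial subspaces are kernels of powers of `T`; hence everything commuting with `T` preserves
them. -/
theorem mem_initialSubspace_iff (h : IsCayleyBasis U T e) (d : ℕ) (v : Fin n → K) :
    v ∈ initialSubspace e d ↔ (T ^ d) v = 0 := by
  have key : ∀ d v (i : Fin n), e.repr ((T ^ d) v) i =
      if hi : (i : ℕ) + d < n then e.repr v ⟨i + d, hi⟩ else 0 := by
    intro d
    induction d with
    | zero => intro v i; simp
    | succ d ih =>
      intro v i
      rw [pow_succ, Module.End.mul_apply, ih]
      split_ifs with h1 h2 h2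
      · rw [h.repr_apply, dif_pos (by simp only; omega)]
        rfl
      · rw [h.repr_apply, dif_neg (by simp only; omega)]
      · omega
      · rfl
  constructor
  · intro hv
    refine e.ext_elem fun i => ?_
    rw [key]
    split_ifs with hi
    · rw [hv _ (by simp)]
      simp
    · simp
  · intro hv i hi
    have h1 := key d v ⟨i - d, by omega⟩
    rw [hv, dif_pos (by simp only; omega)] at h1
    simp only [map_zero, Finsupp.coe_zero, Pi.zero_apply] at h1
    rw [h1]
    congr 1
    ext
    simp only
    omega

theorem map_mem (h : IsCayleyBasis U T e) {S : Module.End K (Fin n → K)} (hS : Commute T S)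
    {d : ℕ} {v : Fin n → K} (hv : v ∈ initialSubspace e d) : S v ∈ initialSubspace e d := by
  rw [h.mem_initialSubspace_iff] at hv ⊢
  rw [← Module.End.mul_apply, (hS.pow_left d).eq, Module.End.mul_apply, hv, map_zero]

theorem shift_mem (h : IsCayleyBasis U T e) {d : ℕ} {v : Fin n → K}
    (hv : v ∈ initialSubspace e (d + 1)) : T v ∈ initialSubspace e d := by
  rw [h.mem_initialSubspace_iff] at hv ⊢
  rwa [← Module.End.mul_apply, ← pow_succ]

theorem sub_one_eq (h : IsCayleyBasis U T e) : U - 1 = T * (U + 1) := by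
  have := h.cayley
  rw [sub_mul, one_mul, sub_eq_iff_eq_add] at this
  rw [mul_add, mul_one, sub_eq_iff_eq_add]
  conv_lhs => rw [this]
  abel

theorem one_sub_mul (h : IsCayleyBasis U T e) : (1 - T) * (U + 1) = (2 : K) • 1 := by
  rw [mul_add, h.cayley, mul_one, two_smul]
  abel

/-- On `V` the operator `U - 1` is nilpotent, so its power of exponent `dim V` vanishes there by
Cayley–Hamilton. Since `2 • T = (1 - T) * (U - 1)`, the same power of `T` vanishes on `V`, which
puts `V` inside a kernel of the same dimension. -/
theorem eq_initialSubspace [CharZero K] (h : IsCayleyBasis U T e) {V : Submodule K (Fin n → K)}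
    (hV : ∀ v ∈ V, U v ∈ V) : V = initialSubspace e (Module.finrank K V) := by
  have hnilT : T ^ n = 0 := by
    refine LinearMap.ext fun v => ?_
    exact (h.mem_initialSubspace_iff n v).mp fun i hi => absurd i.2 (not_lt.mpr hi)
  have hcomm : Commute T (U + 1) := h.comm.add_right (Commute.one_right T)
  have hN : ∀ m, (U - 1) ^ m = (U + 1) ^ m * T ^ m := fun m => by
    rw [h.sub_one_eq, hcomm.mul_pow, (hcomm.pow_pow m m).eq]
  have hstab : ∀ v ∈ V, (U - 1) v ∈ V := fun v hv => V.sub_mem (hV v hv) hv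
  have hnil : IsNilpotent ((U - 1).restrict hstab) := by
    refine ⟨n, ?_⟩
    rw [Module.End.pow_restrict n]
    ext v
    simp [hN, hnilT]
  have hpow : ((U - 1).restrict hstab) ^ Module.finrank K V = 0 := by
    have h1 := LinearMap.aeval_self_charpoly ((U - 1).restrict hstab)
    rw [hnil.charpoly_eq_X_pow_finrank] at h1
    simpa using h1
  have hle : V ≤ initialSubspace e (Module.finrank K V) := by
    intro v hv
    rw [h.mem_initialSubspace_iff]
    have h1 : ((U - 1) ^ Module.finrank K V) v = 0 := by
      rw [Module.End.pow_restrict] at hpow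
      exact congrArg Subtype.val (LinearMap.congr_fun hpow ⟨v, hv⟩)
    have h2 : (2 : K) • T = (1 - T) * (U - 1) := by
      rw [h.sub_one_eq, ← mul_assoc, ((Commute.one_left T).sub_left (Commute.refl T)).eq,
        mul_assoc, h.one_sub_mul, mul_smul_comm, mul_one]
    have h3 : Commute (1 - T) (U - 1) :=
      (Commute.one_left _).sub_left (h.comm.sub_right (Commute.one_right T))
    have h4 := congrArg (fun S : Module.End K (Fin n → K) => (S ^ Module.finrank K V) v) h2
    simp only [h3.mul_pow, Module.End.mul_apply, h1, map_zero, smul_pow, LinearMap.smul_apply]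
      at h4
    exact (smul_eq_zero.mp h4).resolve_left (pow_ne_zero _ two_ne_zero)
  refine Submodule.eq_of_le_of_finrank_le hle ?_
  rw [finrank_initialSubspace]
  simpa using Submodule.finrank_le V

end IsCayleyBasis

end RegularUnipotent

end

noncomputable section

/-! ### Fixed complete quadrics -/

namespace CompleteQuadric

variable {K : Type*} [Field K] {n : ℕ}

/-- The polar form of the `j`-th quadric, extended to `Kⁿ` by a projection onto `V_{j+1}`. -/
def extForm (x : CompleteQuadric K n) (j : Fin x.k) : LinearMap.BilinForm K (Fin n → K) :=
  (x.Q j).rep.polarBilin.compl₁₂ (x.V j.succ).subtype.leftInverse (x.V j.succ).subtype.leftInverse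

theorem extForm_apply (x : CompleteQuadric K n) (j : Fin x.k) {v w : Fin n → K}
    (hv : v ∈ x.V j.succ) (hw : w ∈ x.V j.succ) :
    x.extForm j v w = QuadraticMap.polar (x.Q j).rep ⟨v, hv⟩ ⟨w, hw⟩ := by
  have h : ∀ z : x.V j.succ, (x.V j.succ).subtype.leftInverse (z : Fin n → K) = z :=
    fun z => LinearMap.leftInverse_apply_of_inj (Submodule.ker_subtype _) z
  change QuadraticMap.polar (x.Q j).rep ((x.V j.succ).subtype.leftInverse v)
    ((x.V j.succ).subtype.leftInverse w) = _
  rw [h ⟨v, hv⟩, h ⟨w, hw⟩]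

theorem extForm_comm (x : CompleteQuadric K n) (j : Fin x.k) (v w : Fin n → K) :
    x.extForm j v w = x.extForm j w v :=
  QuadraticMap.polar_comm _ _ _

theorem V_mono (x : CompleteQuadric K n) (j : Fin x.k) : x.V j.castSucc ≤ x.V j.succ :=
  (x.strictMono (Fin.castSucc_lt_succ)).le

theorem extForm_eq_zero (x : CompleteQuadric K n) (j : Fin x.k) {v : Fin n → K}
    (hv : v ∈ x.V j.castSucc) (w : Fin n → K) : x.extForm j v w = 0 := by
  have h : (x.V j.succ).subtype.leftInverse v = ⟨v, x.V_mono j hv⟩ :=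
    LinearMap.leftInverse_apply_of_inj (Submodule.ker_subtype _)
      (⟨v, x.V_mono j hv⟩ : x.V j.succ)
  change QuadraticMap.polar (x.Q j).rep ((x.V j.succ).subtype.leftInverse v)
    ((x.V j.succ).subtype.leftInverse w) = 0
  rw [h]
  exact (x.singular j _).mpr hv _

theorem mem_of_extForm_eq_zero (x : CompleteQuadric K n) (j : Fin x.k) {v : Fin n → K}
    (hv : v ∈ x.V j.succ) (h : ∀ w ∈ x.V j.succ, x.extForm j v w = 0) : v ∈ x.V j.castSucc := by
  refine (x.singular j ⟨v, hv⟩).mp fun w => ?_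
  rw [← h w w.2, x.extForm_apply j hv w.2]

theorem gram_eq_toMatrix (x : CompleteQuadric K n) (j : Fin x.k) :
    x.gram j = LinearMap.BilinForm.toMatrix (Pi.basisFun K (Fin n)) (x.extForm j) := by
  ext a b
  rw [LinearMap.BilinForm.toMatrix_apply, Pi.basisFun_apply, Pi.basisFun_apply]
  rfl

theorem transpose_mul_arc_mul_apply (x : CompleteQuadric K n)
    (e : Module.Basis (Fin n) K (Fin n → K)) (a b : Fin n) :
    ((((Pi.basisFun K (Fin n)).toMatrix e).map (Polynomial.C (R := K))).transpose * x.arc *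
      ((Pi.basisFun K (Fin n)).toMatrix e).map Polynomial.C) a b =
      ∑ j : Fin x.k, Polynomial.X ^ (j.rev : ℕ) * Polynomial.C (x.extForm j (e a) (e b)) := by
  have h : ∀ j, ((Pi.basisFun K (Fin n)).toMatrix e).transpose * x.gram j *
      (Pi.basisFun K (Fin n)).toMatrix e = LinearMap.BilinForm.toMatrix e (x.extForm j) := fun j => by
    rw [gram_eq_toMatrix, LinearMap.BilinForm.toMatrix_mul_basis_toMatrix]
  rw [arc, Matrix.mul_sum, Matrix.sum_mul, Matrix.sum_apply]
  refine Finset.sum_congr rfl fun j _ => ?_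
  rw [Matrix.mul_smul, Matrix.smul_mul, Matrix.smul_apply, ← Matrix.transpose_map,
    ← Matrix.map_mul, ← Matrix.map_mul, h, Matrix.map_apply, LinearMap.BilinForm.toMatrix_apply,
    smul_eq_mul]

theorem act_Q_rep (x : CompleteQuadric K n) (g : (Fin n → K) ≃ₗ[K] (Fin n → K)) (j : Fin x.k) :
    ∃ a : K, a ≠ 0 ∧ ((x.act g).Q j).rep = a • pullForm (g.ofSubmodule' (x.V j.succ)) (x.Q j).rep := by
  have h0 : pullForm (g.ofSubmodule' (x.V j.succ)) (x.Q j).rep ≠ 0 := fun h0 =>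
    (x.Q j).rep_nonzero (pullForm_injective _ (h0.trans (map_zero _).symm))
  obtain ⟨a, ha⟩ := Projectivization.exists_smul_eq_mk_rep K
      (pullForm (g.ofSubmodule' (x.V j.succ)) (x.Q j).rep) h0
  refine ⟨a, a.ne_zero, ?_⟩
  rw [← Units.smul_def, ha]
  have hmk : (x.Q j).map (pullForm (g.ofSubmodule' (x.V j.succ))) (pullForm_injective _) =
      Projectivization.mk K (pullForm (g.ofSubmodule' (x.V j.succ)) (x.Q j).rep) h0 := by
    conv_lhs => rw [← (x.Q j).mk_rep]
    rw [Projectivization.map_mk]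
  rw [← hmk]
  rfl

theorem congr_data {x y : CompleteQuadric K n} (h : y = x) : ∃ hk : y.k = x.k,
    (∀ j, y.V j = x.V (Fin.cast (by rw [hk]) j)) ∧
    ∀ j v hv hv', (y.Q j).rep ⟨v, hv⟩ = (x.Q (Fin.cast hk j)).rep ⟨v, hv'⟩ := by
  subst h
  exact ⟨rfl, fun _ => rfl, fun _ _ _ _ => rfl⟩

theorem heq_of_smul {m : ℕ} {V V' : Fin (m + 1) → Submodule K (Fin n → K)}
    {Q : ∀ j : Fin m, ℙ K (QuadraticForm K (V j.succ))}
    {Q' : ∀ j : Fin m, ℙ K (QuadraticForm K (V' j.succ))} (hV : V = V')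
    (h : ∀ j, ∃ a : K, a ≠ 0 ∧ ∀ (v : Fin n → K) (hv : v ∈ V j.succ) (hv' : v ∈ V' j.succ),
      (Q j).rep ⟨v, hv⟩ = a * (Q' j).rep ⟨v, hv'⟩) : Q ≍ Q' := by
  subst hV
  refine heq_of_eq (funext fun j => ?_)
  obtain ⟨a, ha, h⟩ := h j
  rw [← (Q j).mk_rep, ← (Q' j).mk_rep, Projectivization.mk_eq_mk_iff']
  exact ⟨a, QuadraticMap.ext fun v => (h v v.2 v.2).symm⟩

theorem mem_of_act_eq {x : CompleteQuadric K n} {g : (Fin n → K) ≃ₗ[K] (Fin n → K)}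
    (h : x.act g = x) (j : Fin (x.k + 1)) (v : Fin n → K) : g v ∈ x.V j ↔ v ∈ x.V j := by
  obtain ⟨hk, hV, -⟩ := congr_data h
  exact SetLike.ext_iff.mp (hV j) v

theorem extForm_of_act_eq {x : CompleteQuadric K n} {g : (Fin n → K) ≃ₗ[K] (Fin n → K)}
    (h : x.act g = x) (j : Fin x.k) :
    ∃ a : K, ∀ v ∈ x.V j.succ, ∀ w ∈ x.V j.succ, x.extForm j (g v) (g w) = a * x.extForm j v w := by
  obtain ⟨a, ha, hrep⟩ := x.act_Q_rep g j
  have hmem := mem_of_act_eq h j.succ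
  have hQ : ∀ v (hv : v ∈ x.V j.succ), (x.Q j).rep ⟨v, hv⟩ =
      a * (x.Q j).rep ⟨g v, (hmem v).mpr hv⟩ := by
    intro v hv
    have h5 : ((x.act g).Q j).rep ⟨v, (hmem v).mpr hv⟩ = (x.Q j).rep ⟨v, hv⟩ := by
      obtain ⟨hk, -, h6⟩ := congr_data h
      exact h6 j v ((hmem v).mpr hv) hv
    rw [← h5, hrep]
    rfl
  refine ⟨a⁻¹, fun v hv w hw => ?_⟩
  rw [x.extForm_apply j hv hw, x.extForm_apply j ((hmem v).mpr hv) ((hmem w).mpr hw)]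
  have h7 := hQ (v + w) (add_mem hv hw)
  simp only [QuadraticMap.polar, AddMemClass.mk_add_mk]
  rw [hQ v hv, hQ w hw, h7]
  simp only [map_add]
  field_simp

theorem mk_congr {k : ℕ} {V V' : Fin (k + 1) → Submodule K (Fin n → K)}
    {Q : ∀ j : Fin k, ℙ K (QuadraticForm K (V j.succ))}
    {Q' : ∀ j : Fin k, ℙ K (QuadraticForm K (V' j.succ))} (h1 h2 h3 h4 h1' h2' h3' h4')
    (hV : V = V') (hQ : Q ≍ Q') :
    CompleteQuadric.mk k V h1 h2 h3 Q h4 = CompleteQuadric.mk k V' h1' h2' h3' Q' h4' := by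
  subst hV
  obtain rfl := eq_of_heq hQ
  rfl

theorem act_eq_self {x : CompleteQuadric K n} {g : (Fin n → K) ≃ₗ[K] (Fin n → K)}
    (hV : ∀ j v, g v ∈ x.V j ↔ v ∈ x.V j)
    (hQ : ∀ j v (hv : v ∈ x.V j.succ) (hgv : g v ∈ x.V j.succ),
      (x.Q j).rep ⟨g v, hgv⟩ = (x.Q j).rep ⟨v, hv⟩) : x.act g = x := by
  have hV' : (fun j => (x.V j).comap g.toLinearMap) = x.V :=
    funext fun j => Submodule.ext fun v => hV j v
  refine mk_congr (x.act g).strictMono (x.act g).V_zero (x.act g).V_last (x.act g).singular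
    x.strictMono x.V_zero x.V_last x.singular hV' (heq_of_smul hV' fun j => ?_)
  obtain ⟨a, ha, hrep⟩ := x.act_Q_rep g j
  refine ⟨a, ha, fun v hv hv' => ?_⟩
  refine Eq.trans (congrArg (fun q => q ⟨v, hv⟩) hrep) ?_
  change a * (x.Q j).rep ⟨g v, hv⟩ = _
  congr 1
  exact hQ j v hv' hv

theorem HasFlagType.finrank_eq {x : CompleteQuadric K n} {c : Composition n}
    (h : x.HasFlagType c) : x.k = c.length ∧
      ∀ j : Fin (x.k + 1), Module.finrank K (x.V j) = c.sizeUpTo j := by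
  have hk : x.k = c.length := by
    have := congrArg List.length h
    rw [List.length_ofFn] at this
    exact this.symm
  refine ⟨hk, fun j => ?_⟩
  induction j using Fin.induction with
  | zero => rw [x.V_zero]; simp
  | succ j ih =>
    have hj : (j : ℕ) < c.length := hk ▸ j.2
    have h1 : c.blocks[(j : ℕ)] =
        Module.finrank K (x.V j.succ) - Module.finrank K (x.V j.castSucc) := by
      have h3 : c.blocks = List.ofFn fun j : Fin x.k =>
        Module.finrank K (x.V j.succ) - Module.finrank K (x.V j.castSucc) := h
      simp [h3]
    have h2 : Module.finrank K (x.V j.castSucc) ≤ Module.finrank K (x.V j.succ) :=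
      Submodule.finrank_mono (x.V_mono j)
    have h3 := c.sizeUpTo_succ hj
    rw [Fin.val_castSucc] at ih
    rw [Fin.val_succ, h3, h1, ← ih]
    omega

end CompleteQuadric

end

/-! ### Normal forms of complete quadrics and their homogeneous coordinates -/

noncomputable section

namespace CompleteQuadric

variable {K : Type*} [Field K] {n : ℕ}

/-- The flag of `x` is spanned by initial segments of the basis `e` as prescribed by `D`, and the
quadrics are given, up to scalars, by the diagonal blocks of `hankelForm n D β`. -/
structure HasNormalForm (e : Module.Basis (Fin n) K (Fin n → K)) (x : CompleteQuadric K n)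
    (D : Finset ℕ) (β : ℕ → K) : Prop where
  flag : ∀ j, x.V j = initialSubspace e (Module.finrank K (x.V j))
  cut : ∀ (j : Fin x.k) (i : ℕ), Module.finrank K (x.V j.castSucc) ≤ i →
    i < Module.finrank K (x.V j.succ) → cutLo D i = Module.finrank K (x.V j.castSucc) ∧
      cutHi D i = Module.finrank K (x.V j.succ)
  form : ∀ j : Fin x.k, ∃ c : K, c ≠ 0 ∧ ∀ i k : Fin n,
    Module.finrank K (x.V j.castSucc) ≤ i → (i : ℕ) < Module.finrank K (x.V j.succ) →
    Module.finrank K (x.V j.castSucc) ≤ k → (k : ℕ) < Module.finrank K (x.V j.succ) →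
    x.extForm j (e i) (e k) = c * hankelForm n D β i k

theorem finrank_V_mono (x : CompleteQuadric K n) {i j : Fin (x.k + 1)} (h : i ≤ j) :
    Module.finrank K (x.V i) ≤ Module.finrank K (x.V j) :=
  Submodule.finrank_mono (x.strictMono.monotone h)

theorem exists_block (x : CompleteQuadric K n) {i : ℕ} (hi : i < n) :
    ∃ j : Fin x.k, Module.finrank K (x.V j.castSucc) ≤ i ∧ i < Module.finrank K (x.V j.succ) := by
  by_contra hcon
  push Not at hcon
  have key : ∀ j : Fin (x.k + 1), Module.finrank K (x.V j) ≤ i := by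
    intro j
    induction j using Fin.induction with
    | zero => rw [x.V_zero]; simp
    | succ j ih => exact hcon j ih
  have h := key (Fin.last _)
  rw [x.V_last, finrank_top, Module.finrank_fin_fun] at h
  omega

theorem finrank_succ_le_castSucc (x : CompleteQuadric K n) {j j' : Fin x.k} (h : j < j') :
    Module.finrank K (x.V j.succ) ≤ Module.finrank K (x.V j'.castSucc) :=
  x.finrank_V_mono (by rw [Fin.le_def, Fin.val_succ, Fin.val_castSucc]; exact h)

theorem block_unique (x : CompleteQuadric K n) {i : ℕ} {j j' : Fin x.k}
    (h1 : Module.finrank K (x.V j.castSucc) ≤ i) (h2 : i < Module.finrank K (x.V j.succ))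
    (h1' : Module.finrank K (x.V j'.castSucc) ≤ i) (h2' : i < Module.finrank K (x.V j'.succ)) :
    j = j' := by
  rcases lt_trichotomy j j' with h | h | h
  · have := x.finrank_succ_le_castSucc h
    omega
  · exact h
  · have := x.finrank_succ_le_castSucc h
    omega

theorem HasNormalForm.basis_mem {e : Module.Basis (Fin n) K (Fin n → K)} {x : CompleteQuadric K n}
    {D : Finset ℕ} {β : ℕ → K} (h : x.HasNormalForm e D β) {j : Fin (x.k + 1)} {i : Fin n} :
    e i ∈ x.V j ↔ (i : ℕ) < Module.finrank K (x.V j) := by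
  conv_lhs => rw [h.flag j]
  exact basis_mem_initialSubspace

/-- The vector `e i` lies in the radical of all forms belonging to later steps of the flag, and the
exponents of `arc` decrease along the flag. So the lowest power of `t` in row `i` is the one of its
own step, with the form of that step as coefficient. -/
theorem HasNormalForm.exists_arc_factor {e : Module.Basis (Fin n) K (Fin n → K)}
    {x : CompleteQuadric K n} {D : Finset ℕ} {β : ℕ → K} (h : x.HasNormalForm e D β)
    (hD : IsCutSet D 0 n) :
    ∃ (A' : Matrix (Fin n) (Fin n) K[X]) (ex : ℕ → ℕ) (cc : ℕ → K),
      (∀ i k : Fin n, ((((Pi.basisFun K (Fin n)).toMatrix e).map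
        (Polynomial.C (R := K))).transpose * x.arc *
          ((Pi.basisFun K (Fin n)).toMatrix e).map Polynomial.C) i k =
        Polynomial.X ^ ex i * A' i k) ∧
      (∀ i k, i < n → k < n → cutLo D i = cutLo D k → ex i = ex k) ∧
      (∀ i k, i < n → k < n → cutLo D i < cutLo D k → ex k < ex i) ∧
      (∀ i k : Fin n, cutLo D k < cutLo D i → (A' i k).coeff 0 = 0) ∧
      (∀ i k : Fin n, cutLo D i = cutLo D k →
        (A' i k).coeff 0 = cc (cutLo D i) * hankelForm n D β i k) ∧
      ∀ i < n, cc i ≠ 0 := by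
  classical
  choose blk hb1 hb2 using fun (i : ℕ) (hi : i < n) => x.exists_block hi
  choose cf hcf hform using h.form
  have hlo : ∀ i (hi : i < n), cutLo D i = Module.finrank K (x.V (blk i hi).castSucc) :=
    fun i hi => (h.cut _ i (hb1 i hi) (hb2 i hi)).1
  have hblk : ∀ i k (hi : i < n) (hk : k < n), cutLo D i = cutLo D k → blk i hi = blk k hk := by
    intro i k hi hk he
    have h1 := h.cut _ i (hb1 i hi) (hb2 i hi)
    have h2 := h.cut _ k (hb1 k hk) (hb2 k hk)
    refine x.block_unique (i := i) (hb1 i hi) (hb2 i hi) ?_ ?_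
    · rw [← hlo k hk, ← he]
      exact cutLo_le D i
    · rw [← h2.2]
      exact hD.lt_cutHi_of_cutLo_eq hk he.symm
  have hblt : ∀ i k (hi : i < n) (hk : k < n), cutLo D i < cutLo D k → blk i hi < blk k hk := by
    intro i k hi hk he
    by_contra hle
    rw [not_lt] at hle
    have := x.finrank_V_mono (show (blk k hk).castSucc ≤ (blk i hi).castSucc from hle)
    rw [← hlo i hi, ← hlo k hk] at this
    omega
  let ex : ℕ → ℕ := fun i => if hi : i < n then ((blk i hi).rev : ℕ) else 0
  have hex : ∀ i (hi : i < n), ex i = ((blk i hi).rev : ℕ) := fun i hi => dif_pos hi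
  let cc : ℕ → K := fun i => if hi : i < n then cf (blk i hi) else 1
  have hzero : ∀ (i : Fin n) (j : Fin x.k) (w : Fin n → K), blk i i.2 < j →
      x.extForm j (e i) w = 0 := by
    intro i j w hj
    exact x.extForm_eq_zero j (h.basis_mem.mpr ((hb2 i i.2).trans_le (x.finrank_succ_le_castSucc hj))) w
  let A' : Matrix (Fin n) (Fin n) K[X] := Matrix.of fun i k => ∑ j : Fin x.k,
    Polynomial.X ^ ((j.rev : ℕ) - ex i) * Polynomial.C (x.extForm j (e i) (e k))
  have hrev : ∀ (i : Fin n) (j : Fin x.k), j ≤ blk i i.2 → ex i ≤ (j.rev : ℕ) := by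
    intro i j hj
    rw [hex i i.2, Fin.val_rev, Fin.val_rev]
    have : (j : ℕ) ≤ (blk i i.2 : ℕ) := hj
    omega
  have hA : ∀ i k : Fin n, ((((Pi.basisFun K (Fin n)).toMatrix e).map
      (Polynomial.C (R := K))).transpose * x.arc *
        ((Pi.basisFun K (Fin n)).toMatrix e).map Polynomial.C) i k =
      Polynomial.X ^ ex i * A' i k := by
    intro i k
    simp only [A', Matrix.of_apply, transpose_mul_arc_mul_apply, Finset.mul_sum]
    refine Finset.sum_congr rfl fun j _ => ?_
    rcases le_or_gt j (blk i i.2) with hj | hj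
    · rw [← mul_assoc, ← pow_add, Nat.add_sub_cancel' (hrev i j hj)]
    · rw [hzero i j _ hj]
      simp
  have hcoeff : ∀ i k : Fin n, (A' i k).coeff 0 = x.extForm (blk i i.2) (e i) (e k) := by
    intro i k
    simp only [A', Matrix.of_apply, Polynomial.finsetSum_coeff, Polynomial.coeff_mul_C,
      Polynomial.coeff_X_pow]
    rw [Finset.sum_eq_single (blk i i.2)]
    · rw [if_pos, one_mul]
      rw [hex i i.2, Nat.sub_self]
    · intro j _ hj
      rcases lt_or_gt_of_ne hj with hlt | hgt
      · rw [if_neg, zero_mul]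
        rw [hex i i.2, Fin.val_rev, Fin.val_rev]
        have h1 : (j : ℕ) < (blk i i.2 : ℕ) := hlt
        have h2 := (blk i i.2).2
        omega
      · rw [hzero i j _ hgt, mul_zero]
    · simp
  refine ⟨A', ex, cc, hA, fun i k hi hk he => by rw [hex i hi, hex k hk, hblk i k hi hk he],
    fun i k hi hk he => ?_, fun i k he => ?_, fun i k he => ?_, fun i hi => ?_⟩
  · have h1 : ((blk i hi : Fin x.k) : ℕ) < (blk k hk : ℕ) := hblt i k hi hk he
    have h2 := (blk k hk).2
    rw [hex i hi, hex k hk, Fin.val_rev, Fin.val_rev]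
    omega
  · rw [hcoeff, extForm_comm]
    exact x.extForm_eq_zero _ (h.basis_mem.mpr ((hb2 k k.2).trans_le
      (x.finrank_succ_le_castSucc (hblt _ _ k.2 i.2 he)))) _
  · have hcl := (cutLo_le D i).trans_lt i.2
    have h1 : cc (cutLo D i) = cf (blk i i.2) := by
      have h2 : blk (cutLo D i) hcl = blk i i.2 :=
        hblk _ _ _ _ (cutLo_eq_self (hD.cutLo_mem (Nat.zero_le _)))
      simp only [cc]
      rw [dif_pos hcl, h2]
    rw [hcoeff, h1]
    have h2 := hblk i k i.2 k.2 he
    refine hform _ i k (hb1 i i.2) (hb2 i i.2) ?_ ?_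
    · rw [h2]
      exact hb1 k k.2
    · rw [h2]
      exact hb2 k k.2
  · simp only [cc, dif_pos hi]
    exact hcf _

/-- Some limit minor of each size is nonzero, so `minorOrder` is exactly the bound from
`coeff_minor_arc`. The scalars of the individual quadrics then combine into one factor depending
only on the size of the minor. -/
theorem HasNormalForm.changeCoord_coord {e : Module.Basis (Fin n) K (Fin n → K)}
    {x : CompleteQuadric K n} {D : Finset ℕ} {β : ℕ → K} (h : x.HasNormalForm e D β)
    (hD : IsCutSet D 0 n) (hβ : ∀ i < n, β (cutLo D i) = 1) :
    ∃ s : Fin (n - 1) → K, (∀ i, s i ≠ 0) ∧ ∀ c : CoordIndex n,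
      changeCoord ((Pi.basisFun K (Fin n)).toMatrix e) x.coord c =
        s c.1 * limitMinor D β c.2.1 c.2.2 := by
  classical
  set P := (Pi.basisFun K (Fin n)).toMatrix e with hPdef
  have hP : IsUnit P.det := by
    rw [hPdef, ← Module.Basis.det_apply]
    exact (Pi.basisFun K (Fin n)).isUnit_det e
  obtain ⟨A', ex, cc, hA, he, he', h1, h2, hcc⟩ := h.exists_arc_factor hD
  have hmin := fun (d : ℕ) (I J : Fin d → Fin n) => coeff_minor_arc hA he he' h1 h2 I J
  have hsne : ∀ d ≤ n, ∏ i : Fin d, cc (cutLo D (n - d + i)) ≠ 0 := fun d hd =>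
    Finset.prod_ne_zero_iff.mpr fun i _ => hcc _ ((cutLo_le D _).trans_lt (by omega))
  have horder : ∀ d ≤ n, minorOrder x.arc d = ∑ i : Fin d, ex (n - d + i) := by
    intro d hd
    rw [← minorOrder_congruence hP]
    have hmem : ∑ i : Fin d, ex (n - d + i) ∈
        {m | ∃ s t : Fin d → Fin n, (((P.map (Polynomial.C (R := K))).transpose * x.arc *
          P.map Polynomial.C).submatrix s t).det.coeff m ≠ 0} := by
      obtain ⟨I, J, hIJ⟩ := exists_limitMinor_ne_zero hD hβ hd
      refine ⟨I, J, ?_⟩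
      rw [(hmin d I J).2]
      exact mul_ne_zero (hsne d hd) hIJ
    refine le_antisymm (Nat.sInf_le hmem) (le_csInf ⟨_, hmem⟩ ?_)
    rintro m ⟨I, J, hm⟩
    by_contra hlt
    exact hm ((hmin d I J).1 m (not_le.mp hlt))
  refine ⟨fun i => ∏ t : Fin (i + 1), cc (cutLo D (n - (i + 1) + t)), fun i => hsne _ (by omega),
    fun c => ?_⟩
  have hd : (c.1 : ℕ) + 1 ≤ n := by omega
  have h3 := (hmin _ c.2.1 c.2.2).2
  rw [← horder _ hd, coeff_det_congruence] at h3
  exact h3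

end CompleteQuadric

/-! ### Fixed points have a normal form -/

section FixedCell

variable {K : Type*} [Field K] [CharZero K] {n : ℕ} {u : Matrix.SpecialLinearGroup (Fin n) K}
  {T : Module.End K (Fin n → K)} {e : Module.Basis (Fin n) K (Fin n → K)}

open CompleteQuadric

/-- An invariant form is invariant under the Lie algebra. -/
theorem extForm_skew (h : IsCayleyBasis (Matrix.SpecialLinearGroup.toLin' u).toLinearMap T e)
    {x : CompleteQuadric K n} (hx : x.act (Matrix.SpecialLinearGroup.toLin' u) = x)
    (j : Fin x.k) {v w : Fin n → K} (hv : v ∈ x.V j.succ) (hw : w ∈ x.V j.succ) :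
    x.extForm j (T v) w + x.extForm j v (T w) = 0 := by
  set U : Module.End K (Fin n → K) := (Matrix.SpecialLinearGroup.toLin' u).toLinearMap with hU
  have hV : ∀ j, x.V j = initialSubspace e (Module.finrank K (x.V j)) := fun j =>
    h.eq_initialSubspace fun v hv => (mem_of_act_eq hx j v).mpr hv
  set lo := Module.finrank K (x.V j.castSucc) with hlo
  set hi := Module.finrank K (x.V j.succ) with hhi
  have hlt : lo < hi := Submodule.finrank_lt_finrank_of_lt (x.strictMono Fin.castSucc_lt_succ)
  have hhin : hi ≤ n := by simpa using Submodule.finrank_le (x.V j.succ)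
  obtain ⟨a, ha⟩ := extForm_of_act_eq hx j
  have hUa : ∀ v ∈ x.V j.succ, ∀ w ∈ x.V j.succ,
      x.extForm j (U v) (U w) = a * x.extForm j v w := ha
  have hUmem : ∀ v ∈ x.V j.succ, U v ∈ x.V j.succ := fun v hv => (mem_of_act_eq hx j.succ v).mpr hv
  -- the multiplier is trivial
  have ha1 : a = 1 := by
    set f : Fin n → K := e ⟨lo, by omega⟩ with hf
    have hfmem : f ∈ x.V j.succ := by
      rw [hV]
      exact basis_mem_initialSubspace.mpr hlt
    have hfnot : f ∉ x.V j.castSucc := by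
      rw [hV]
      intro hmem
      exact absurd (basis_mem_initialSubspace.mp hmem) (lt_irrefl _)
    have hUf : (U - 1) f ∈ x.V j.castSucc := by
      rw [hV, h.sub_one_eq, Module.End.mul_apply]
      refine h.shift_mem (h.map_mem (h.comm.add_right (Commute.one_right T)) ?_)
      exact basis_mem_initialSubspace.mpr (Nat.lt_succ_self _)
    -- As `(U - 1) f` is in the radical, the functional `x.extForm j f` is multiplied by `a` under
    -- `U`. Since `U - 1` is nilpotent, a power of `a - 1` annihilates the functional, which is
    -- nonzero on `V_{j+1}` because `f` is not in the radical.
    have hφ : ∀ w ∈ x.V j.succ, x.extForm j f (U w) = a * x.extForm j f w := by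
      intro w hw
      rw [← hUa f hfmem w hw]
      have h1 : U f = f + (U - 1) f := by simp
      rw [h1, map_add, LinearMap.add_apply, x.extForm_eq_zero j hUf, add_zero]
    have hN : ∀ m, ∀ w ∈ x.V j.succ, ((U - 1) ^ m) w ∈ x.V j.succ ∧
        x.extForm j f (((U - 1) ^ m) w) = (a - 1) ^ m * x.extForm j f w := by
      intro m
      induction m with
      | zero => intro w hw; simpa using hw
      | succ m ih =>
        intro w hw
        have h1 : (U - 1) w ∈ x.V j.succ := by
          have : (U - 1) w = U w - w := by simp
          rw [this]
          exact sub_mem (hUmem w hw) hw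
        rw [pow_succ, Module.End.mul_apply]
        refine ⟨(ih _ h1).1, ?_⟩
        rw [(ih _ h1).2]
        have h2 : (U - 1) w = U w - w := by simp
        rw [h2, map_sub, hφ w hw]
        ring
    by_contra hne
    refine hfnot (x.mem_of_extForm_eq_zero j hfmem fun w hw => ?_)
    have h1 := (hN n w hw).2
    have h2 : ((U - 1) ^ n) w = 0 := by
      have hc : Commute T (U + 1) := h.comm.add_right (Commute.one_right T)
      rw [h.sub_one_eq, hc.mul_pow, Module.End.mul_apply]
      refine (h.mem_initialSubspace_iff n _).mp fun i hi => absurd i.2 (not_lt.mpr hi)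
    rw [h2, map_zero] at h1
    exact (mul_eq_zero.mp h1.symm).resolve_left (pow_ne_zero _ (sub_ne_zero.mpr hne))
  -- write `v`, `w` as images under `U + 1`
  have hhalf : ∀ v ∈ x.V j.succ, ∃ v' ∈ x.V j.succ, U v' + v' = v ∧ U v' - v' = T v := by
    intro v hv
    refine ⟨(2 : K)⁻¹ • (1 - T) v, ?_, ?_⟩
    · refine Submodule.smul_mem _ _ ?_
      rw [hV] at hv ⊢
      exact h.map_mem ((Commute.one_right T).sub_right (Commute.refl T)) hv
    · have hc : Commute (1 - T) (U + 1) := (Commute.one_left _).sub_left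
        (h.comm.add_right (Commute.one_right T))
      have h1 : (U + 1) ((1 - T) v) = (2 : K) • v := by
        rw [← Module.End.mul_apply, ← hc.eq, h.one_sub_mul]
        simp
      have h2 : (U - 1) ((1 - T) v) = (2 : K) • T v := by
        rw [h.sub_one_eq, Module.End.mul_apply, h1, map_smul]
      have h3 : U ((1 - T) v) + (1 - T) v = (2 : K) • v := h1
      have h4 : U ((1 - T) v) - (1 - T) v = (2 : K) • T v := h2
      rw [map_smul, ← smul_add, ← smul_sub, h3, h4, smul_smul, smul_smul,
        inv_mul_cancel₀ two_ne_zero, one_smul, one_smul]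
      exact ⟨rfl, rfl⟩
  obtain ⟨v', hv', hv1, hv2⟩ := hhalf v hv
  obtain ⟨w', hw', hw1, hw2⟩ := hhalf w hw
  have h1 := hUa v' hv' w' hw'
  rw [ha1, one_mul] at h1
  -- Expanding, the mixed terms cancel and twice the difference of the form at `(U v', U w')` and
  -- `(v', w')` remains.
  rw [← hv2, ← hw2, ← hv1, ← hw1]
  simp only [map_add, map_sub, LinearMap.add_apply, LinearMap.sub_apply, h1]
  ring

end FixedCell

end

noncomputable section

section FixedCell

variable {K : Type*} [Field K] [CharZero K] {n : ℕ} {u : Matrix.SpecialLinearGroup (Fin n) K}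
  {T : Module.End K (Fin n → K)} {e : Module.Basis (Fin n) K (Fin n → K)}

open CompleteQuadric

/-- `skew_recursion` with `N = ⊥` applies to the Gram matrix, since `T` sends the first vector of
the step into the radical. If the corner entry `(hi - 1, lo)` vanished, so would the row of `e lo`,
against nondegeneracy. Entries of the last row at odd offset equal their own negatives. -/
theorem extForm_block (h : IsCayleyBasis (Matrix.SpecialLinearGroup.toLin' u).toLinearMap T e)
    {x : CompleteQuadric K n} (hx : x.act (Matrix.SpecialLinearGroup.toLin' u) = x)
    (hV : ∀ j, x.V j = initialSubspace e (Module.finrank K (x.V j)))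
    (j : Fin x.k) {lo hi : ℕ} (hlo : Module.finrank K (x.V j.castSucc) = lo)
    (hhi : Module.finrank K (x.V j.succ) = hi) (hodd : Odd (hi - lo)) :
    ∃ (c : K) (b : ℕ → K), c ≠ 0 ∧ b lo = 1 ∧
      (∀ t, lo ≤ t → t < hi → Odd (t - lo) → b t = 0) ∧
      ∀ i k : Fin n, lo ≤ i → (i : ℕ) < hi → lo ≤ k → (k : ℕ) < hi →
        x.extForm j (e i) (e k) =
          c * if hi + lo ≤ (i : ℕ) + k + 1 then (-1) ^ (hi - 1 - i) * b (i + k + 1 - hi) else 0 := by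
  have hlt : lo < hi := by
    rw [← hlo, ← hhi]
    exact Submodule.finrank_lt_finrank_of_lt (x.strictMono Fin.castSucc_lt_succ)
  have hhin : hi ≤ n := by
    rw [← hhi]
    simpa using Submodule.finrank_le (x.V j.succ)
  have hmem : ∀ i : Fin n, (i : ℕ) < hi → e i ∈ x.V j.succ := fun i hi' => by
    rw [hV, hhi]
    exact basis_mem_initialSubspace.mpr hi'
  have hmem0 : ∀ i : Fin n, (i : ℕ) < lo → e i ∈ x.V j.castSucc := fun i hi' => by
    rw [hV, hlo]
    exact basis_mem_initialSubspace.mpr hi'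
  have hT : ∀ (i : ℕ) (hi' : i < n), 0 < i → T (e ⟨i, hi'⟩) = e ⟨i - 1, by omega⟩ :=
    fun i hi' h0 => by rw [h.shift, dif_pos h0]
  let g : ℕ → ℕ → K := fun i k =>
    if hik : i < n ∧ k < n then x.extForm j (e ⟨i, hik.1⟩) (e ⟨k, hik.2⟩) else 0
  have hg : ∀ i k (hi' : i < n) (hk : k < n), g i k = x.extForm j (e ⟨i, hi'⟩) (e ⟨k, hk⟩) :=
    fun i k hi' hk => dif_pos ⟨hi', hk⟩
  have hrec := skew_recursion (⊥ : AddSubgroup K) (lo := lo) (r := hi) g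
    (fun i k h1 h2 h3 h4 => by
      rw [AddSubgroup.mem_bot, hg _ _ (by omega) (by omega), hg _ _ (by omega) (by omega)]
      have := extForm_skew h hx j (hmem ⟨i, by omega⟩ h2) (hmem ⟨k, by omega⟩ h4)
      rwa [hT i (by omega) (by omega), hT k (by omega) (by omega)] at this)
    (fun i h1 h2 => by
      rw [AddSubgroup.mem_bot, hg _ _ (by omega) (by omega)]
      have := extForm_skew h hx j (hmem ⟨i, by omega⟩ h2) (hmem ⟨lo, by omega⟩ hlt)
      rw [hT i (by omega) (by omega)] at this
      have h0 : T (e ⟨lo, by omega⟩) ∈ x.V j.castSucc := by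
        rw [hV, hlo]
        exact h.shift_mem (basis_mem_initialSubspace.mpr (Nat.lt_succ_self _))
      rwa [x.extForm_comm j _ (T _), x.extForm_eq_zero j h0, add_zero] at this)
  simp only [AddSubgroup.mem_bot, sub_eq_zero] at hrec
  have hsymm : ∀ i k, i < n → k < n → g i k = g k i := fun i k hi' hk => by
    rw [hg _ _ hi' hk, hg _ _ hk hi', x.extForm_comm]
  have hc : g (hi - 1) lo ≠ 0 := by
    intro h0
    have hnot : e ⟨lo, by omega⟩ ∉ x.V j.castSucc := by
      rw [hV, hlo, basis_mem_initialSubspace]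
      exact lt_irrefl _
    refine hnot (x.mem_of_extForm_eq_zero j (hmem ⟨lo, by omega⟩ hlt) fun w hw => ?_)
    rw [← e.sum_repr w, map_sum]
    refine Finset.sum_eq_zero fun k _ => ?_
    rw [map_smul]
    have h1 : x.extForm j (e ⟨lo, by omega⟩) (e k) = 0 ∨ e.repr w k = 0 := by
      rcases lt_or_ge (k : ℕ) lo with hk | hk
      · left
        rw [x.extForm_comm]
        exact x.extForm_eq_zero j (hmem0 k hk) _
      · rcases lt_or_ge (k : ℕ) hi with hk' | hk'
        · left
          have h2 := hg lo k (by omega) k.2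
          rw [← h2]
          rcases lt_or_ge ((k : ℕ) + 1) hi with h3 | h3
          · exact (hrec lo k le_rfl hlt hk hk').2 (by omega)
          · have h4 : (k : ℕ) = hi - 1 := by omega
            rw [h4, hsymm _ _ (by omega) (by omega), h0]
        · right
          rw [hV, hhi] at hw
          exact hw k hk'
    rcases h1 with h1 | h1 <;> rw [h1] <;> simp
  refine ⟨g (hi - 1) lo, fun t => g (hi - 1) t / g (hi - 1) lo, hc, div_self hc, ?_, ?_⟩
  · intro t h1 h2 h3
    have h4 := (hrec t (hi - 1) h1 h2 (by omega) (by omega)).1 (by omega)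
    rw [show t + (hi - 1) + 1 - hi = t by omega, hsymm _ _ (by omega) (by omega),
      Odd.neg_one_pow (by rw [Nat.odd_iff] at *; omega), neg_one_smul] at h4
    simp only [self_eq_neg.mp h4, zero_div]
  · intro i k h1 h2 h3 h4
    rw [← hg i k i.2 k.2]
    split_ifs with hle
    · rw [(hrec i k h1 h2 h3 h4).1 hle, zsmul_eq_mul]
      push_cast
      field_simp
    · rw [(hrec i k h1 h2 h3 h4).2 (by omega), mul_zero]

theorem exists_hasNormalForm
    (h : IsCayleyBasis (Matrix.SpecialLinearGroup.toLin' u).toLinearMap T e)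
    {γ : OddComposition n} {x : CompleteQuadric K n} (hx : x ∈ fixedCell u γ) :
    ∃ β, IsNormalVector (compositionCuts γ.1) n β ∧
      x.HasNormalForm e (compositionCuts γ.1) β := by
  obtain ⟨hflag, hact⟩ := hx
  obtain ⟨hk, hfin⟩ := hflag.finrank_eq
  have hD := isCutSet_compositionCuts γ.1
  have hV : ∀ j, x.V j = initialSubspace e (Module.finrank K (x.V j)) := fun j =>
    h.eq_initialSubspace fun v hv => (mem_of_act_eq hact j v).mpr hv
  have hcut : ∀ (j : Fin x.k) (i : ℕ), Module.finrank K (x.V j.castSucc) ≤ i →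
    i < Module.finrank K (x.V j.succ) →
      cutLo (compositionCuts γ.1) i = Module.finrank K (x.V j.castSucc) ∧
      cutHi (compositionCuts γ.1) i = Module.finrank K (x.V j.succ) := by
    intro j i h1 h2
    have hj : (j : ℕ) < γ.1.length := hk ▸ j.2
    rw [hfin] at h1 h2 ⊢
    rw [hfin]
    exact ⟨cutLo_compositionCuts _ hj h1 h2, cutHi_compositionCuts _ hj h1 h2⟩
  have hodd : ∀ j : Fin x.k,
      Odd (Module.finrank K (x.V j.succ) - Module.finrank K (x.V j.castSucc)) := by
    intro j
    have h1 : Module.finrank K (x.V j.castSucc) < Module.finrank K (x.V j.succ) :=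
      Submodule.finrank_lt_finrank_of_lt (x.strictMono Fin.castSucc_lt_succ)
    have h2 : Module.finrank K (x.V j.succ) ≤ n := by
      simpa using Submodule.finrank_le (x.V j.succ)
    have h3 := hcut j _ le_rfl h1
    rw [← h3.1, ← h3.2]
    exact oddBlocks_compositionCuts γ _ (by omega)
  choose c b hc hb1 hb2 hb3 using fun j => extForm_block h hact hV j rfl rfl (hodd j)
  choose blk hk1 hk2 using fun (i : ℕ) (hi : i < n) => x.exists_block hi
  let β : ℕ → K := fun i => if hi : i < n then b (blk i hi) i else 0
  have hβ : ∀ (j : Fin x.k) (i : ℕ), Module.finrank K (x.V j.castSucc) ≤ i →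
      i < Module.finrank K (x.V j.succ) → β i = b j i := by
    intro j i h1 h2
    have h3 : Module.finrank K (x.V j.succ) ≤ n := by
      simpa using Submodule.finrank_le (x.V j.succ)
    have hi : i < n := by omega
    simp only [β]
    rw [dif_pos hi, x.block_unique (hk1 i hi) (hk2 i hi) h1 h2]
  refine ⟨β, ⟨fun i hi => ?_, fun i hi ho => ?_⟩, hV, hcut, fun j => ⟨c j, hc j, ?_⟩⟩
  · have h1 := hcut _ i (hk1 i hi) (hk2 i hi)
    rw [h1.1, hβ (blk i hi) _ le_rfl ((hk1 i hi).trans_lt (hk2 i hi)), hb1]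
  · rw [(hcut _ i (hk1 i hi) (hk2 i hi)).1] at ho
    rw [hβ _ i (hk1 i hi) (hk2 i hi)]
    exact hb2 _ i (hk1 i hi) (hk2 i hi) ho
  · intro i k h1 h2 h3 h4
    have h5 := hcut j i h1 h2
    have h6 := hcut j k h3 h4
    rw [hb3 j i k h1 h2 h3 h4, hankelForm, Matrix.of_apply, h5.1, h5.2, h6.1]
    simp only [true_and]
    split_ifs with hle
    · rw [hβ j _ (by omega) (by omega)]
    · rfl

end FixedCell

end

noncomputable section

/-! ### Construction of fixed points -/

section Construction

variable {K : Type*} [Field K] {n : ℕ}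

/-- The coordinates of a vector in the block of `D` that starts at `a`. -/
def blockPart (e : Module.Basis (Fin n) K (Fin n → K)) (D : Finset ℕ) (a : ℕ) :
    (Fin n → K) →ₗ[K] (Fin n → K) where
  toFun v i := if cutLo D i = a then e.repr v i else 0
  map_add' v w := by
    ext i
    simp only [map_add, Finsupp.coe_add, Pi.add_apply]
    split_ifs <;> simp
  map_smul' r v := by
    ext i
    simp

theorem blockPart_apply (e : Module.Basis (Fin n) K (Fin n → K)) (D : Finset ℕ) (a : ℕ)
    (v : Fin n → K) (i : Fin n) :
    blockPart e D a v i = if cutLo D i = a then e.repr v i else 0 := rfl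

/-- The form given by the block of `hankelForm n D β` that starts at `a`. -/
def blockForm (e : Module.Basis (Fin n) K (Fin n → K)) (D : Finset ℕ) (β : ℕ → K) (a : ℕ) :
    LinearMap.BilinForm K (Fin n → K) :=
  (Matrix.toBilin' (hankelForm n D β)).compl₁₂ (blockPart e D a) (blockPart e D a)

variable {e : Module.Basis (Fin n) K (Fin n → K)} {D : Finset ℕ} {β : ℕ → K}

theorem blockForm_apply (a : ℕ) (v w : Fin n → K) : blockForm e D β a v w =
    blockPart e D a v ⬝ᵥ (hankelForm n D β).mulVec (blockPart e D a w) := by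
  rw [blockForm, LinearMap.compl₁₂_apply, Matrix.toBilin'_apply']

theorem blockPart_basis (a : ℕ) (k : Fin n) :
    blockPart e D a (e k) = if cutLo D k = a then Pi.single k 1 else 0 := by
  ext i
  rw [blockPart_apply, e.repr_self, Finsupp.single_apply]
  by_cases hik : k = i
  · subst hik
    rw [if_pos rfl]
    split_ifs <;> simp
  · rw [if_neg hik]
    split_ifs <;> simp [Ne.symm hik]

theorem blockForm_basis {a : ℕ} {i k : Fin n} (hi : cutLo D i = a) (hk : cutLo D k = a) :
    blockForm e D β a (e i) (e k) = hankelForm n D β i k := by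
  rw [blockForm_apply, blockPart_basis, blockPart_basis, if_pos hi, if_pos hk]
  simp

theorem blockForm_comm (hs : ∀ i j, hankelForm n D β i j = hankelForm n D β j i) (a : ℕ)
    (v w : Fin n → K) : blockForm e D β a v w = blockForm e D β a w v := by
  have ht : (hankelForm n D β).transpose = hankelForm n D β := by
    ext i j
    exact hs j i
  rw [blockForm_apply, blockForm_apply, Matrix.dotProduct_mulVec, ← Matrix.mulVec_transpose, ht,
    dotProduct_comm]

theorem blockForm_eq_zero {a : ℕ} {v : Fin n → K} (hv : v ∈ initialSubspace e a) (w : Fin n → K) :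
    blockForm e D β a v w = 0 := by
  have h : blockPart e D a v = 0 := by
    ext i
    rw [blockPart_apply]
    split_ifs with hi
    · exact hv i (hi ▸ cutLo_le D i)
    · rfl
  rw [blockForm_apply, h, zero_dotProduct]

/-- Distinct blocks are orthogonal, so the block part of `v` is annihilated by the whole matrix
`hankelForm n D β`, which is invertible. -/
theorem mem_initialSubspace_of_blockForm {a b : ℕ} (hdet : IsUnit (hankelForm n D β).det)
    (hab : ∀ i : Fin n, cutLo D i = a ↔ a ≤ i ∧ (i : ℕ) < b) {v : Fin n → K}
    (hv : v ∈ initialSubspace e b)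
    (h : ∀ w ∈ initialSubspace e b, blockForm e D β a v w = 0) : v ∈ initialSubspace e a := by
  have h1 : Matrix.vecMul (blockPart e D a v) (hankelForm n D β) = 0 := by
    ext k
    by_cases hk : cutLo D k = a
    · have h2 := h (e k) (basis_mem_initialSubspace.mpr ((hab k).mp hk).2)
      rw [blockForm_apply, blockPart_basis, if_pos hk, Matrix.dotProduct_mulVec,
        dotProduct_single_one] at h2
      exact h2
    · rw [Matrix.vecMul, dotProduct, Pi.zero_apply]
      refine Finset.sum_eq_zero fun i _ => ?_
      change blockPart e D a v i * hankelForm n D β i k = 0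
      rw [blockPart_apply]
      split_ifs with hi
      · rw [hankelForm_apply_of_ne (by rw [hi]; exact Ne.symm hk), mul_zero]
      · rw [zero_mul]
  have h2 := Matrix.eq_zero_of_vecMul_eq_zero hdet.ne_zero h1
  intro i hi
  rcases lt_or_ge (i : ℕ) b with hb | hb
  · have h3 := congrFun h2 i
    rwa [blockPart_apply, if_pos ((hab i).mpr ⟨hi, hb⟩)] at h3
  · exact hv i hb

/-- On vectors supported below `b`, taking the block part intertwines `T` with `blockNilpotent`: the
only coordinate that could enter from outside is the one at `b`, and it is zero. -/
theorem blockForm_skew {U T : Module.End K (Fin n → K)} (h : IsCayleyBasis U T e)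
    (hD : IsCutSet D 0 n) {a b : ℕ}
    (hab : ∀ i : Fin n, cutLo D i = a ↔ a ≤ i ∧ (i : ℕ) < b) {v w : Fin n → K}
    (hv : v ∈ initialSubspace e b) (hw : w ∈ initialSubspace e b) :
    blockForm e D β a (T v) w + blockForm e D β a v (T w) = 0 := by
  have key : ∀ v ∈ initialSubspace e b,
      blockPart e D a (T v) = (blockNilpotent K n D).mulVec (blockPart e D a v) := by
    intro v hv
    ext i
    rw [blockPart_apply, h.repr_apply, Matrix.mulVec, dotProduct]
    by_cases hi : (i : ℕ) + 1 < n
    · rw [dif_pos hi, Finset.sum_eq_single ⟨i + 1, hi⟩]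
      · simp only [blockNilpotent, Matrix.of_apply, blockPart_apply, true_and]
        have h1 := hab i
        have h2 := hab ⟨i + 1, hi⟩
        simp only at h2
        by_cases h3 : cutLo D i = a
        · rw [if_pos h3]
          have h4 := h1.mp h3
          rcases lt_or_ge ((i : ℕ) + 1) b with h5 | h5
          · have h6 := h2.mpr ⟨by omega, h5⟩
            rw [if_pos (by rw [h3, h6]), if_pos h6, one_mul]
          · rw [hv ⟨i + 1, hi⟩ h5]
            simp
        · rw [if_neg h3]
          split_ifs with h4 h5
          · exact absurd (h4.trans h5) h3
          · simp
          · simp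
          · simp
      · intro k _ hk
        rw [blockNilpotent, Matrix.of_apply, if_neg, zero_mul]
        rintro ⟨h1, -⟩
        exact hk (Fin.ext h1.symm)
      · simp
    · rw [dif_neg hi, ite_self]
      symm
      refine Finset.sum_eq_zero fun k _ => ?_
      rw [blockNilpotent, Matrix.of_apply, if_neg, zero_mul]
      rintro ⟨h1, -⟩
      omega
  have hs := hankelForm_skew (R := K) (β := β) hD
  rw [blockForm_apply, blockForm_apply, key v hv, key w hw, ← Matrix.vecMul_transpose,
    ← Matrix.dotProduct_mulVec, Matrix.mulVec_mulVec, Matrix.mulVec_mulVec, ← dotProduct_add,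
    ← Matrix.add_mulVec, hs, Matrix.zero_mulVec, dotProduct_zero]

/-- With `z = (U + 1) v / 2` one has `v = z - T z` and `U v = z + T z`, so the two values differ by
a multiple of the skew relation for `(z, z)`. -/
theorem blockForm_cayley [CharZero K] {U T : Module.End K (Fin n → K)} (h : IsCayleyBasis U T e)
    (hD : IsCutSet D 0 n) {a b : ℕ}
    (hab : ∀ i : Fin n, cutLo D i = a ↔ a ≤ i ∧ (i : ℕ) < b) {v : Fin n → K}
    (hv : v ∈ initialSubspace e b) :
    blockForm e D β a (U v) (U v) = blockForm e D β a v v := by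
  set z : Fin n → K := (2 : K)⁻¹ • (U + 1) v with hz
  have hzmem : z ∈ initialSubspace e b :=
    Submodule.smul_mem _ _ (h.map_mem (h.comm.add_right (Commute.one_right T)) hv)
  have h1 : z - T z = v := by
    have h2 : z - T z = (2 : K)⁻¹ • ((1 - T) * (U + 1)) v := by
      rw [hz, map_smul, ← smul_sub]
      rfl
    rw [h2, h.one_sub_mul]
    simp
  have h3 : z + z = U v + v := by
    rw [← two_smul K, hz, smul_smul, mul_inv_cancel₀ two_ne_zero, one_smul]
    rfl
  have h4 : z + T z = U v := by
    have : z + T z = (z + z) - (z - T z) := by abel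
    rw [this, h3, h1]
    abel
  have h5 := blockForm_skew (β := β) h hD hab hzmem hzmem
  rw [← h4, ← h1]
  simp only [map_add, map_sub, LinearMap.add_apply, LinearMap.sub_apply]
  linear_combination 2 * h5

open CompleteQuadric in
theorem exists_fixedCell_hasNormalForm [CharZero K] {u : Matrix.SpecialLinearGroup (Fin n) K}
    {T : Module.End K (Fin n → K)}
    (h : IsCayleyBasis (Matrix.SpecialLinearGroup.toLin' u).toLinearMap T e)
    (γ : OddComposition n) (hβ : IsNormalVector (compositionCuts γ.1) n β) :
    ∃ x ∈ fixedCell u γ, x.HasNormalForm e (compositionCuts γ.1) β := by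
  have hD := isCutSet_compositionCuts γ.1
  have ho := oddBlocks_compositionCuts γ
  set D := compositionCuts γ.1 with hDdef
  set c := γ.1 with hc
  have hdet := isUnit_det_hankelForm hD hβ.lo
  have hs := hankelForm_symm hD ho hβ
  have hlt : ∀ j : Fin c.length, c.sizeUpTo j < c.sizeUpTo (j + 1) := fun j =>
    c.sizeUpTo_strict_mono j.2
  have hab : ∀ (j : Fin c.length) (i : Fin n), cutLo D i = c.sizeUpTo j ↔
      c.sizeUpTo j ≤ i ∧ (i : ℕ) < c.sizeUpTo (j + 1) := by
    intro j i
    constructor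
    · intro he
      have h1 : c.sizeUpTo j ≤ i := he ▸ cutLo_le D i
      refine ⟨h1, ?_⟩
      have h2 := hD.lt_cutHi_of_cutLo_eq (i := c.sizeUpTo j) (j := i)
        ((hlt j).trans_le (c.sizeUpTo_le _))
        (by rw [cutLo_compositionCuts c j.2 le_rfl (hlt j), he])
      rwa [cutHi_compositionCuts c j.2 le_rfl (hlt j)] at h2
    · rintro ⟨h1, h2⟩
      exact cutLo_compositionCuts c j.2 h1 h2
  let V : Fin (c.length + 1) → Submodule K (Fin n → K) := fun j => initialSubspace e (c.sizeUpTo j)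
  have hVfin : ∀ j, Module.finrank K (V j) = c.sizeUpTo j := fun j =>
    finrank_initialSubspace e (c.sizeUpTo_le _)
  let q : ∀ j : Fin c.length, QuadraticForm K (V j.succ) := fun j =>
    (blockForm e D β (c.sizeUpTo j)).toQuadraticMap.comp (V j.succ).subtype
  have hq : ∀ j (v : V j.succ), q j v = blockForm e D β (c.sizeUpTo j) v v := fun _ _ => rfl
  have hpolar : ∀ j (v w : V j.succ),
      QuadraticMap.polar (q j) v w = 2 * blockForm e D β (c.sizeUpTo j) v w := by
    intro j v w
    simp only [QuadraticMap.polar, hq, Submodule.coe_add, map_add, LinearMap.add_apply]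
    rw [blockForm_comm hs _ (w : Fin n → K) v]
    ring
  have hmemV : ∀ (j : Fin c.length) (i : Fin n), (i : ℕ) < c.sizeUpTo (j + 1) → e i ∈ V j.succ :=
    fun j i hi => basis_mem_initialSubspace.mpr hi
  -- The entry of the Gram matrix at the last and the first index of the block is `β` at the left
  -- end, that is `1`.
  have hq0 : ∀ j, q j ≠ 0 := by
    intro j h0
    have h1 := hlt j
    have h2 := c.sizeUpTo_le ((j : ℕ) + 1)
    set i : Fin n := ⟨c.sizeUpTo (j + 1) - 1, by omega⟩ with hi
    set k : Fin n := ⟨c.sizeUpTo j, by omega⟩ with hk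
    have h3 := hpolar j ⟨e i, hmemV j i (by simp only [hi]; omega)⟩ ⟨e k, hmemV j k h1⟩
    have hci := (hab j i).mpr ⟨by simp only [hi]; omega, by simp only [hi]; omega⟩
    have hck := (hab j k).mpr ⟨le_rfl, h1⟩
    have h4 : cutHi D i = c.sizeUpTo (j + 1) :=
      cutHi_compositionCuts c j.2 (by simp only [hi]; omega) (by simp only [hi]; omega)
    rw [h0, blockForm_basis hci hck, hankelForm, Matrix.of_apply, hci, hck, h4, if_pos] at h3
    · have h5 : (i : ℕ) + k + 1 - c.sizeUpTo (j + 1) = c.sizeUpTo j := by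
        simp only [hi, hk]
        omega
      have h6 := hβ.lo k k.2
      rw [hck] at h6
      rw [h5, h6] at h3
      simp [QuadraticMap.polar] at h3
    · refine ⟨rfl, ?_⟩
      simp only [hi, hk]
      omega
  let Q : ∀ j : Fin c.length, ℙ K (QuadraticForm K (V j.succ)) := fun j =>
    Projectivization.mk K (q j) (hq0 j)
  have hrep : ∀ j, ∃ a : K, a ≠ 0 ∧ (Q j).rep = a • q j := by
    intro j
    obtain ⟨a, ha⟩ := Projectivization.exists_smul_eq_mk_rep K (q j) (hq0 j)
    exact ⟨a, a.ne_zero, ha.symm⟩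
  choose a ha hrep using hrep
  have hpol : ∀ j (v w : V j.succ),
      QuadraticMap.polar (Q j).rep v w = a j * 2 * blockForm e D β (c.sizeUpTo j) v w := by
    intro j v w
    have h1 : QuadraticMap.polar (Q j).rep v w = a j * QuadraticMap.polar (q j) v w := by
      rw [hrep]
      simp only [QuadraticMap.polar, smul_apply, smul_eq_mul]
      ring
    rw [h1, hpolar]
    ring
  let x : CompleteQuadric K n :=
    { k := c.length
      V := V
      strictMono := by
        rw [Fin.strictMono_iff_lt_succ]
        intro j
        refine lt_of_le_of_ne (fun v hv i hi => hv i ((hlt j).le.trans hi)) fun he => ?_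
        have h1 := congrArg (fun W : Submodule K (Fin n → K) => Module.finrank K W) he
        simp only [hVfin] at h1
        exact absurd h1 (hlt j).ne
      V_zero := by
        rw [eq_bot_iff]
        intro v hv
        rw [Submodule.mem_bot]
        refine e.ext_elem fun i => ?_
        rw [hv i (by simp), map_zero]
        rfl
      V_last := by
        rw [eq_top_iff]
        intro v _ i hi
        rw [Fin.val_last, c.sizeUpTo_length] at hi
        omega
      Q := Q
      singular := by
        intro j v
        simp only [hpol, mul_eq_zero, ha j, two_ne_zero, false_or]
        constructor
        · intro hw
          exact mem_initialSubspace_of_blockForm hdet (hab j) v.2 fun w hw' => hw ⟨w, hw'⟩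
        · intro hv w
          exact blockForm_eq_zero hv _ }
  refine ⟨x, ⟨?_, ?_⟩, ⟨?_, ?_, ?_⟩⟩
  · refine List.ext_getElem (by rw [List.length_ofFn]) fun i h1 h2 => ?_
    rw [List.getElem_ofFn]
    change c.blocks[i] = Module.finrank K (V _) - Module.finrank K (V _)
    rw [hVfin, hVfin]
    have := c.sizeUpTo_succ h1
    simp only [Fin.val_succ, Fin.val_castSucc]
    omega
  · refine act_eq_self (fun j v => ?_) fun j v hv hgv => ?_
    · change _ ∈ initialSubspace e (c.sizeUpTo j) ↔ _ ∈ initialSubspace e (c.sizeUpTo j)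
      refine ⟨fun hv => ?_, fun hv => h.map_mem h.comm hv⟩
      rw [h.mem_initialSubspace_iff] at hv ⊢
      have h1 : (Matrix.SpecialLinearGroup.toLin' u) ((T ^ c.sizeUpTo j) v) = 0 := by
        rw [← hv]
        exact (LinearMap.congr_fun (h.comm.pow_left (c.sizeUpTo j)).eq v).symm
      exact (LinearEquiv.map_eq_zero_iff _).mp h1
    · change (Q j).rep _ = (Q j).rep _
      rw [hrep]
      simp only [smul_apply]
      congr 1
      rw [hq, hq]
      exact blockForm_cayley h hD (hab j) hv
  · intro j
    change V j = initialSubspace e (Module.finrank K (V j))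
    rw [hVfin]
  · intro j i h1 h2
    change Module.finrank K (V j.castSucc) ≤ i at h1
    change i < Module.finrank K (V j.succ) at h2
    change cutLo D i = Module.finrank K (V j.castSucc) ∧ cutHi D i = Module.finrank K (V j.succ)
    rw [hVfin] at h1 h2 ⊢
    rw [hVfin]
    exact ⟨cutLo_compositionCuts c j.2 h1 h2, cutHi_compositionCuts c j.2 h1 h2⟩
  · intro j
    -- `a j` comes from the chosen representative of the projective class, `2` from passing to the
    -- polar form.
    refine ⟨a j * 2, mul_ne_zero (ha j) two_ne_zero, fun i k h1 h2 h3 h4 => ?_⟩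
    change Module.finrank K (V j.castSucc) ≤ i at h1
    change i < Module.finrank K (V j.succ) at h2
    change Module.finrank K (V j.castSucc) ≤ k at h3
    change k < Module.finrank K (V j.succ) at h4
    rw [hVfin] at h1 h2 h3 h4
    rw [x.extForm_apply j (hmemV j i h2) (hmemV j k h4)]
    refine (hpol j _ _).trans ?_
    simp only
    rw [blockForm_basis ((hab j i).mpr ⟨h1, h2⟩) ((hab j k).mpr ⟨h3, h4⟩)]

end Construction

end

noncomputable section

/-! ### Weighted homogeneous substitutions -/

namespace MvPolynomial

section Weighted

variable {R M σ τ : Type*} [CommRing R] [AddCommMonoid M] {w : σ → M} {w' : τ → M}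

theorem IsWeightedHomogeneous.aeval_of_forall {φ : σ → MvPolynomial τ R}
    (hφ : ∀ i, IsWeightedHomogeneous w' (φ i) (w i)) {f : MvPolynomial σ R} {m : M}
    (hf : IsWeightedHomogeneous w f m) : IsWeightedHomogeneous w' (aeval φ f) m := by
  induction hf using IsWeightedHomogeneous.induction_on with
  | zero => rw [map_zero]; exact isWeightedHomogeneous_zero R w' m
  | add p q _ _ hp hq => rw [map_add]; exact hp.add hq
  | monomial d r hr =>
    rw [aeval_monomial, ← hr, Finsupp.weight_apply]
    refine IsWeightedHomogeneous.C_mul ?_ r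
    exact IsWeightedHomogeneous.prod d.support _ (fun i => d i • w i) fun i _ => (hφ i).pow (d i)

theorem weightedHomogeneousComponent_aeval {φ : σ → MvPolynomial τ R}
    (hφ : ∀ i, IsWeightedHomogeneous w' (φ i) (w i)) (m : M) (f : MvPolynomial σ R) :
    weightedHomogeneousComponent w' m (aeval φ f) =
      aeval φ (weightedHomogeneousComponent w m f) := by
  induction f using MvPolynomial.induction_on' with
  | monomial d r =>
    have h1 := isWeightedHomogeneous_monomial w d r rfl
    have h2 := h1.aeval_of_forall hφ
    by_cases hm : m = Finsupp.weight w d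
    · subst hm
      rw [h1.weightedHomogeneousComponent_same, h2.weightedHomogeneousComponent_same]
    · rw [h1.weightedHomogeneousComponent_ne m hm, h2.weightedHomogeneousComponent_ne m hm,
        map_zero]
  | add p q hp hq => rw [map_add, map_add, map_add, map_add, hp, hq]

end Weighted

end MvPolynomial

open CompleteQuadric

/-! ### Closures of cells and their prime ideals -/

section Closure

variable {K : Type*} [Field K] {n : ℕ}

/-- Zero scaling factors are allowed, at the price that `a` may vanish; the kernel of `cellHom` has
to be tested at all values of the scaling variables. -/
theorem IsMultihomogeneous_eval_smul {f : MvPolynomial (CoordIndex n) K}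
    (hf : IsMultihomogeneous f) (s : Fin (n - 1) → K) :
    ∃ a : K, ((∀ i, s i ≠ 0) → a ≠ 0) ∧ ∀ y : CoordIndex n → K,
      MvPolynomial.eval (fun c => s c.1 * y c) f = a * MvPolynomial.eval y f := by
  obtain ⟨e, he⟩ := hf
  refine ⟨∏ i, s i ^ e i, fun hs => Finset.prod_ne_zero_iff.mpr fun i _ => pow_ne_zero _ (hs i),
    fun y => ?_⟩
  induction he using MvPolynomial.IsWeightedHomogeneous.induction_on with
  | zero => simp
  | add p q _ _ hp hq => rw [map_add, map_add, hp, hq, mul_add]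
  | monomial d r hr =>
    rw [MvPolynomial.eval_monomial, MvPolynomial.eval_monomial]
    have h1 : (d.prod fun c k => (s c.1 * y c) ^ k) =
        (∏ i, s i ^ e i) * d.prod fun c k => y c ^ k := by
      simp only [Finsupp.prod, mul_pow, Finset.prod_mul_distrib]
      congr 1
      rw [← hr, Finsupp.weight_apply, Finsupp.sum]
      simp only [Finset.sum_apply, Pi.smul_apply, smul_eq_mul, ← Finset.prod_pow_eq_pow_sum]
      rw [Finset.prod_comm]
      refine Finset.prod_congr rfl fun c _ => ?_
      rw [Finset.prod_eq_single c.1]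
      · simp
      · intro i _ hi
        rw [Pi.single_eq_of_ne hi]
        simp
      · simp
    rw [h1]
    ring

theorem isClosed_iff_zeroSet {Z : Set (CompleteQuadric K n)} : IsClosed Z ↔
    ∃ I : Set (MvPolynomial (CoordIndex n) K), (∀ f ∈ I, IsMultihomogeneous f) ∧
      Z = zeroSet I := by
  rw [← isOpen_compl_iff]
  change Zᶜᶜ ∈ _ ↔ _
  rw [compl_compl]
  rfl

theorem mem_closure_iff_eval {T : Set (CompleteQuadric K n)} {x : CompleteQuadric K n} :
    x ∈ closure T ↔ ∀ f : MvPolynomial (CoordIndex n) K, IsMultihomogeneous f →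
      (∀ y ∈ T, MvPolynomial.eval y.coord f = 0) → MvPolynomial.eval x.coord f = 0 := by
  constructor
  · intro hx f hf hT
    have h1 : IsClosed (zeroSet ({f} : Set (MvPolynomial (CoordIndex n) K))) :=
      isClosed_iff_zeroSet.mpr ⟨{f}, by rintro _ rfl; exact hf, rfl⟩
    exact closure_minimal (fun y hy => by rintro _ rfl; exact hT y hy) h1 hx f rfl
  · intro h
    rw [closure, Set.mem_sInter]
    rintro Z ⟨hZ, hTZ⟩
    obtain ⟨I, hI, rfl⟩ := isClosed_iff_zeroSet.mp hZ
    exact fun f hf => h f (hI f hf) fun y hy => hTZ hy f hf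

theorem map_changeCoord {A B : Type*} [CommRing A] [CommRing B] (φ : A →+* B)
    (P : Matrix (Fin n) (Fin n) A) (y : CoordIndex n → A) (c : CoordIndex n) :
    φ (changeCoord P y c) = changeCoord (P.map φ) (fun c => φ (y c)) c := by
  simp [changeCoord, map_sum, map_prod]

/-- The substitution of `changeCoord P` into a polynomial. -/
def changePoly (P : Matrix (Fin n) (Fin n) K) :
    MvPolynomial (CoordIndex n) K →ₐ[K] MvPolynomial (CoordIndex n) K :=
  MvPolynomial.aeval (changeCoord (P.map MvPolynomial.C) MvPolynomial.X)

theorem eval_changePoly (P : Matrix (Fin n) (Fin n) K) (y : CoordIndex n → K)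
    (f : MvPolynomial (CoordIndex n) K) :
    MvPolynomial.eval y (changePoly P f) = MvPolynomial.eval (changeCoord P y) f := by
  have h := MvPolynomial.comp_aeval_apply (changeCoord (P.map MvPolynomial.C) MvPolynomial.X)
    (MvPolynomial.aeval y : MvPolynomial (CoordIndex n) K →ₐ[K] K) f
  refine h.trans ?_
  rw [← MvPolynomial.aeval_eq_eval]
  congr 2
  ext c
  rw [← AlgHom.coe_toRingHom, map_changeCoord, Matrix.map_map]
  congr 1
  · ext i j
    simp
  · ext c
    simp

theorem isMultihomogeneous_changePoly (P : Matrix (Fin n) (Fin n) K)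
    {f : MvPolynomial (CoordIndex n) K} (hf : IsMultihomogeneous f) :
    IsMultihomogeneous (changePoly P f) := by
  obtain ⟨e, he⟩ := hf
  refine ⟨e, he.aeval_of_forall fun c => ?_⟩
  refine MvPolynomial.IsWeightedHomogeneous.sum _ _ _ fun L _ =>
    MvPolynomial.IsWeightedHomogeneous.sum _ _ _ fun L' _ => ?_
  simp only [Matrix.map_apply, ← map_prod, ← map_mul]
  exact (MvPolynomial.isWeightedHomogeneous_X K _ _).C_mul _

/-- The parametrization of a cell by normal vectors and scaling factors. -/
def cellHom (K : Type*) [Field K] (n : ℕ) (D : Finset ℕ) :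
    MvPolynomial (CoordIndex n) K →ₐ[K] MvPolynomial (evenSlots D n ⊕ Fin (n - 1)) K :=
  MvPolynomial.aeval fun c => MvPolynomial.X (Sum.inr c.1) *
    limitMinor D (slotVector D n fun j => MvPolynomial.X (Sum.inl j)) c.2.1 c.2.2

/-- The ideal of a cell. -/
def cellIdeal (K : Type*) [Field K] (n : ℕ) (D : Finset ℕ) :
    Ideal (MvPolynomial (CoordIndex n) K) := RingHom.ker (cellHom K n D)

instance (D : Finset ℕ) : (cellIdeal K n D).IsPrime := RingHom.ker_isPrime _

theorem aeval_cellHom {A : Type*} [CommRing A] [Algebra K A] (D : Finset ℕ)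
    (b : evenSlots D n → A) (s : Fin (n - 1) → A) (f : MvPolynomial (CoordIndex n) K) :
    MvPolynomial.aeval (Sum.elim b s) (cellHom K n D f) =
      MvPolynomial.aeval (fun c : CoordIndex n =>
        s c.1 * limitMinor D (slotVector D n b) c.2.1 c.2.2) f := by
  rw [cellHom, MvPolynomial.comp_aeval_apply]
  congr 2
  ext c
  rw [map_mul, MvPolynomial.aeval_X, Sum.elim_inr]
  congr 1
  rw [← AlgHom.coe_toRingHom, map_limitMinor]
  congr 1
  ext j
  rw [map_slotVector]
  congr 1
  ext k
  simp

/-- In the coordinates given by `P`, the set `T` is parametrized by normal vectors for `D`. -/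
structure IsCellChart (P : Matrix (Fin n) (Fin n) K) (T : Set (CompleteQuadric K n))
    (D : Finset ℕ) : Prop where
  coord_eq : ∀ x ∈ T, ∃ (b : evenSlots D n → K) (s : Fin (n - 1) → K), (∀ i, s i ≠ 0) ∧
    ∀ c : CoordIndex n, changeCoord P x.coord c =
      s c.1 * limitMinor D (slotVector D n b) c.2.1 c.2.2
  exists_mem : ∀ b : evenSlots D n → K, ∃ x ∈ T, ∃ s : Fin (n - 1) → K, (∀ i, s i ≠ 0) ∧
    ∀ c : CoordIndex n, changeCoord P x.coord c =
      s c.1 * limitMinor D (slotVector D n b) c.2.1 c.2.2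

theorem exists_isCellChart [CharZero K] (u : Matrix.SpecialLinearGroup (Fin n) K)
    (hu : IsRegularUnipotent u) :
    ∃ P : Matrix (Fin n) (Fin n) K, IsUnit P.det ∧
      ∀ γ : OddComposition n, IsCellChart P (fixedCell u γ) (compositionCuts γ.1) := by
  obtain ⟨T, e, h⟩ := exists_isCayleyBasis u hu
  refine ⟨(Pi.basisFun K (Fin n)).toMatrix e, ?_, fun γ => ⟨fun x hx => ?_, fun b => ?_⟩⟩
  · rw [← Module.Basis.det_apply]
    exact (Pi.basisFun K (Fin n)).isUnit_det e
  · have hD := isCutSet_compositionCuts γ.1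
    obtain ⟨β, hβ, hx⟩ := exists_hasNormalForm h hx
    obtain ⟨s, hs, hc⟩ := hx.changeCoord_coord hD hβ.lo
    refine ⟨fun j => β j, s, hs, fun c => ?_⟩
    rw [hc, limitMinor_congr (fun i hi => hβ.eq_slotVector hi) hD]
  · have hD := isCutSet_compositionCuts γ.1
    have hβ := isNormalVector_slotVector hD b
    obtain ⟨x, hx, hnf⟩ := exists_fixedCell_hasNormalForm h γ hβ
    exact ⟨x, hx, hnf.changeCoord_coord hD hβ.lo⟩

/-- Over an infinite field, an element is in the kernel iff its image vanishes for all parameters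
and scalings. The points of the cell realize all parameters, and multihomogeneity passes from their
scalings to arbitrary ones. -/
theorem IsCellChart.mem_cellIdeal_iff [Infinite K] {P : Matrix (Fin n) (Fin n) K}
    {T : Set (CompleteQuadric K n)} {D : Finset ℕ} (h : IsCellChart P T D)
    {f : MvPolynomial (CoordIndex n) K} (hf : IsMultihomogeneous f) :
    f ∈ cellIdeal K n D ↔ ∀ x ∈ T, MvPolynomial.eval (changeCoord P x.coord) f = 0 := by
  have key : ∀ (b : evenSlots D n → K) (s : Fin (n - 1) → K),
      MvPolynomial.eval (Sum.elim b s) (cellHom K n D f) = MvPolynomial.eval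
        (fun c : CoordIndex n => s c.1 * limitMinor D (slotVector D n b) c.2.1 c.2.2) f :=
    fun b s => aeval_cellHom D b s f
  constructor
  · intro hmem x hx
    obtain ⟨b, s, -, hc⟩ := h.coord_eq x hx
    have h1 := key b s
    rw [(RingHom.mem_ker).mp hmem, map_zero] at h1
    rw [show changeCoord P x.coord = _ from funext hc, ← h1]
  · intro hT
    rw [cellIdeal, RingHom.mem_ker]
    refine MvPolynomial.funext fun z => ?_
    rw [map_zero, ← Sum.elim_comp_inl_inr z, key]
    obtain ⟨x, hx, s, hs, hc⟩ := h.exists_mem (z ∘ Sum.inl)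
    have h1 := hT x hx
    rw [show changeCoord P x.coord = _ from funext hc] at h1
    obtain ⟨a, ha, h2⟩ := IsMultihomogeneous_eval_smul hf s
    obtain ⟨a', -, h3⟩ := IsMultihomogeneous_eval_smul hf (z ∘ Sum.inr)
    rw [h2] at h1
    rw [h3, (mul_eq_zero.mp h1).resolve_left (ha hs), mul_zero]

/-- The parametrization is graded if slot variables get weight zero and the scaling variables the
unit weights, so its kernel contains the homogeneous components of its elements. -/
theorem cellIdeal_le_iff {D : Finset ℕ} {I : Ideal (MvPolynomial (CoordIndex n) K)} :
    cellIdeal K n D ≤ I ↔ ∀ f ∈ cellIdeal K n D, IsMultihomogeneous f → f ∈ I := by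
  constructor
  · exact fun h f hf _ => h hf
  · intro h f hf
    rw [← MvPolynomial.sum_weightedHomogeneousComponent
      (fun c : CoordIndex n => (Pi.single c.1 1 : Fin (n - 1) → ℕ)) f]
    refine finsum_induction (· ∈ I) I.zero_mem (fun _ _ => I.add_mem) fun m => h _ ?_
      ⟨m, MvPolynomial.weightedHomogeneousComponent_isWeightedHomogeneous _ _⟩
    have hφ : ∀ c : CoordIndex n, MvPolynomial.IsWeightedHomogeneous
        (Sum.elim (fun _ => 0) (fun i => Pi.single i 1) :
          evenSlots D n ⊕ Fin (n - 1) → Fin (n - 1) → ℕ)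
        ((MvPolynomial.X (Sum.inr c.1) : MvPolynomial (evenSlots D n ⊕ Fin (n - 1)) K) *
          limitMinor D (slotVector D n fun j => MvPolynomial.X (Sum.inl j)) c.2.1 c.2.2)
        (Pi.single c.1 1) := by
      intro c
      have h1 := MvPolynomial.isWeightedHomogeneous_X K
        (Sum.elim (fun _ => 0) (fun i => Pi.single i 1) :
          evenSlots D n ⊕ Fin (n - 1) → Fin (n - 1) → ℕ) (Sum.inr c.1)
      rw [Sum.elim_inr] at h1
      rw [← add_zero (Pi.single c.1 1)]
      refine h1.mul ?_
      have h2 : limitMinor D (slotVector D n fun j => (MvPolynomial.X (Sum.inl j) :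
          MvPolynomial (evenSlots D n ⊕ Fin (n - 1)) K)) c.2.1 c.2.2 =
          MvPolynomial.aeval (fun j => MvPolynomial.X (Sum.inl j))
            (limitMinor D (slotVector D n fun j =>
              (MvPolynomial.X j : MvPolynomial (evenSlots D n) K)) c.2.1 c.2.2) := by
        rw [← AlgHom.coe_toRingHom, map_limitMinor]
        congr 1
        ext1 j
        rw [map_slotVector]
        congr 1
        ext1 k
        simp
      rw [h2]
      refine MvPolynomial.IsWeightedHomogeneous.aeval_of_forall
        (w := fun _ : evenSlots D n => (0 : Fin (n - 1) → ℕ)) (fun j => ?_) ?_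
      · exact MvPolynomial.isWeightedHomogeneous_X K _ (Sum.inl j)
      · intro d _
        rw [Finsupp.weight_apply]
        simp
    rw [cellIdeal, RingHom.mem_ker] at hf ⊢
    have h3 := MvPolynomial.weightedHomogeneousComponent_aeval hφ m f
    change MvPolynomial.aeval _ _ = 0 at hf
    change MvPolynomial.aeval _ _ = 0
    rw [← h3, hf, map_zero]

theorem IsCellChart.subset_closure_iff [Infinite K] {P : Matrix (Fin n) (Fin n) K}
    (hP : IsUnit P.det) {T T' : Set (CompleteQuadric K n)} {D D' : Finset ℕ}
    (h : IsCellChart P T D) (h' : IsCellChart P T' D') :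
    T' ⊆ closure T ↔ cellIdeal K n D ≤ cellIdeal K n D' := by
  have hinv : ∀ y : CoordIndex n → K, changeCoord P⁻¹ (changeCoord P y) = y := fun y => by
    rw [changeCoord_changeCoord, Matrix.mul_nonsing_inv P hP, changeCoord_one]
  rw [cellIdeal_le_iff]
  constructor
  · intro hsub f hf hfh
    rw [h'.mem_cellIdeal_iff hfh]
    intro x hx
    rw [← eval_changePoly]
    refine mem_closure_iff_eval.mp (hsub hx) _ (isMultihomogeneous_changePoly P hfh) fun y hy => ?_
    rw [eval_changePoly]
    exact (h.mem_cellIdeal_iff hfh).mp hf y hy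
  · intro hle x hx
    refine mem_closure_iff_eval.mpr fun f hf hT => ?_
    have hf' := isMultihomogeneous_changePoly P⁻¹ hf
    have h1 := hle (changePoly P⁻¹ f) ((h.mem_cellIdeal_iff hf').mpr fun y hy => by
      rw [eval_changePoly, hinv, hT y hy]) hf'
    have h2 := (h'.mem_cellIdeal_iff hf').mp h1 x hx
    rwa [eval_changePoly, hinv] at h2

end Closure

end

noncomputable section

open CompleteQuadric

/-! ### Special coordinates -/

section SpecialMinors

variable {R : Type*} [CommRing R] {n : ℕ} {D : Finset ℕ} {β : ℕ → R}

/-- The tuple `(a, c, c + 1, …, n - 1)`. -/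
def consTail (c : ℕ) (a : Fin n) : Fin (n - c + 1) → Fin n :=
  Fin.cons a fun t : Fin (n - c) => ⟨c + t, by omega⟩

theorem injective_tail (c : ℕ) :
    Function.Injective fun t : Fin (n - c) => (⟨c + t, by omega⟩ : Fin n) := by
  intro s t h
  simp only [Fin.mk.injEq] at h
  exact Fin.ext (by omega)

/-- By invertibility some minor with rows `c, …, n - 1` is nonzero. As `c` is a cut, its columns are
also `≥ c`, so they are a permutation of the rows. -/
theorem det_tail_ne_zero [Nontrivial R] (hD : IsCutSet D 0 n) (hβ : ∀ i < n, β (cutLo D i) = 1)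
    {c : ℕ} (hc : c ∈ D) :
    ((hankelForm n D β).submatrix (fun t : Fin (n - c) => (⟨c + t, by omega⟩ : Fin n))
      fun t : Fin (n - c) => ⟨c + t, by omega⟩).det ≠ 0 := by
  set I : Fin (n - c) → Fin n := fun t => ⟨c + t, by omega⟩ with hI
  obtain ⟨J, hJ⟩ := exists_det_submatrix_ne_zero (hankelForm n D β) (isUnit_det_hankelForm hD hβ)
    (injective_tail (n := n) c)
  have hJinj : Function.Injective J := by
    intro a b hab
    by_contra hne
    exact hJ (Matrix.det_zero_of_column_eq hne (by intro i; simp [hab]))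
  have hJc : ∀ t, c ≤ (J t : ℕ) := by
    intro t
    by_contra hlt
    refine hJ (Matrix.det_eq_zero_of_column_eq_zero t fun s => ?_)
    refine hankelForm_apply_of_ne fun he => ?_
    have h1 := le_cutLo hc (show c ≤ (c + s : ℕ) by omega)
    have h2 := cutLo_le D (J t)
    rw [← he] at h2
    exact hlt (h1.trans h2)
  let σ : Fin (n - c) → Fin (n - c) := fun t => ⟨J t - c, by have := (J t).2; have := hJc t; omega⟩
  have hσ : Function.Injective σ := by
    intro a b hab
    simp only [σ, Fin.mk.injEq] at hab
    exact hJinj (Fin.ext (by have := hJc a; have := hJc b; omega))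
  let τ : Equiv.Perm (Fin (n - c)) := Equiv.ofBijective σ (Finite.injective_iff_bijective.mp hσ)
  have hJτ : J = I ∘ τ := by
    ext t
    have := hJc t
    simp only [I, τ, σ, Function.comp_apply, Equiv.ofBijective_apply]
    omega
  intro h0
  refine hJ ?_
  have h1 := Matrix.det_permute' τ ((hankelForm n D β).submatrix I I)
  rw [h0, mul_zero] at h1
  rw [hJτ]
  exact h1

/-- The block of `i` ends at `c`, so row `i` vanishes in the tail columns and the Laplace expansion
along it has one term. -/
theorem det_submatrix_consTail (hD : IsCutSet D 0 n) {i : Fin n} (a : Fin n) {c : ℕ}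
    (hc : cutHi D i = c) :
    ((hankelForm n D β).submatrix (consTail c i) (consTail c a)).det =
      hankelForm n D β i a *
        ((hankelForm n D β).submatrix (fun t : Fin (n - c) =>
          (⟨c + t, by omega⟩ : Fin n)) fun t : Fin (n - c) =>
            ⟨c + t, by omega⟩).det := by
  rw [Matrix.det_succ_row_zero, Finset.sum_eq_single 0]
  · simp only [consTail, Matrix.submatrix_apply, Fin.cons_zero, Fin.val_zero, pow_zero, one_mul]
    rfl
  · intro t _ ht
    obtain ⟨s, rfl⟩ := Fin.exists_succ_eq.mpr ht
    have h0 : hankelForm n D β i (⟨c + s, by omega⟩ : Fin n) = 0 := by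
      refine hankelForm_apply_of_ne fun he => ?_
      have h1 := hD.lt_cutHi_of_cutLo_eq i.2 he
      simp only at h1
      omega
    simp only [consTail, Matrix.submatrix_apply, Fin.cons_zero, Fin.cons_succ]
    rw [h0]
    ring
  · simp

theorem isTopTuple_consTail {i : Fin n} : IsTopTuple D (consTail ((i : ℕ) + 1) i) := by
  unfold IsTopTuple
  refine Finset.sum_congr rfl fun t _ => ?_
  congr 1
  refine Fin.cases ?_ (fun s => ?_) t
  · simp only [consTail, Fin.cons_zero, Fin.val_zero]
    omega
  · simp only [consTail, Fin.cons_succ, Fin.val_succ]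
    omega

theorem limitMinor_consTail (hD : IsCutSet D 0 n) {i : Fin n} (a : Fin n) {c : ℕ}
    (hc : cutHi D i = c) (hi : (i : ℕ) + 1 = c) :
    limitMinor D β (consTail c i) (consTail c a) =
      hankelForm n D β i a *
        ((hankelForm n D β).submatrix (fun t : Fin (n - c) =>
          (⟨c + t, by omega⟩ : Fin n)) fun t : Fin (n - c) => ⟨c + t, by omega⟩).det := by
  rw [← det_submatrix_consTail hD a hc, limitMinor, if_pos]
  subst hi
  exact isTopTuple_consTail

theorem hankelForm_last {i a : Fin n} (hi : (i : ℕ) + 1 = cutHi D i)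
    (ha : cutLo D i = cutLo D a) : hankelForm n D β i a = β a := by
  have h1 := cutLo_le D a
  rw [hankelForm, Matrix.of_apply, if_pos ⟨ha, by omega⟩, ← hi]
  have h2 : (i : ℕ) + 1 - 1 - i = 0 := by omega
  have h3 : (i : ℕ) + a + 1 - (i + 1) = a := by omega
  rw [h2, h3, pow_zero, one_mul]

end SpecialMinors

/-! ### Coordinates that detect cuts and parameters -/

section CellIdeal

variable {K : Type*} [Field K] {n : ℕ} {D D' : Finset ℕ}

/-- The generic normal vector. -/
def genericVector (K : Type*) [Field K] (D : Finset ℕ) (n : ℕ) :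
    ℕ → MvPolynomial (evenSlots D n ⊕ Fin (n - 1)) K :=
  slotVector D n fun j => MvPolynomial.X (Sum.inl j)

theorem X_mem_cellIdeal_iff (c : CoordIndex n) : MvPolynomial.X c ∈ cellIdeal K n D ↔
    limitMinor D (genericVector K D n) c.2.1 c.2.2 = 0 := by
  rw [cellIdeal, RingHom.mem_ker]
  change MvPolynomial.aeval _ _ = 0 ↔ _
  rw [MvPolynomial.aeval_X, mul_eq_zero, or_iff_right (MvPolynomial.X_ne_zero _)]
  rfl

/-- For a cut `c` of `D` that is missing in `D'`, replace `c` by `c - 1` in the tuple `c, …, n - 1`.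
The result is top for `D'` but not for `D`: all coordinates with these rows vanish on the cell of
`D`, whereas one of them does not vanish for `D'`. -/
theorem subset_of_cellIdeal_le (hD : IsCutSet D 0 n) (hD' : IsCutSet D' 0 n)
    (h : cellIdeal K n D ≤ cellIdeal K n D') : D ⊆ D' := by
  intro c hc
  by_contra hc'
  have h0 : c ≠ 0 := fun h0 => hc' (h0 ▸ hD'.left_mem)
  have hn : c ≠ n := fun h0 => hc' (h0 ▸ hD'.right_mem)
  have hcn := hD.le_right c hc
  obtain ⟨m, hm⟩ : ∃ m, n = c + m + 1 := ⟨n - c - 1, by omega⟩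
  subst hm
  let I : Fin (m + 1) → Fin (c + m + 1) :=
    Fin.cons ⟨c - 1, by omega⟩ fun t : Fin m => ⟨c + 1 + t, by omega⟩
  have hinj : Function.Injective I := by
    intro s t hst
    induction s using Fin.cases with
    | zero =>
      induction t using Fin.cases with
      | zero => rfl
      | succ t => simp only [I, Fin.cons_zero, Fin.cons_succ, Fin.mk.injEq] at hst; omega
    | succ s =>
      induction t using Fin.cases with
      | zero => simp only [I, Fin.cons_zero, Fin.cons_succ, Fin.mk.injEq] at hst; omega
      | succ t =>
        simp only [I, Fin.cons_succ, Fin.mk.injEq] at hst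
        congr 1
        exact Fin.ext (by omega)
  have hsum : ∀ E : Finset ℕ, (IsTopTuple E I ↔ cutLo E (c - 1) = cutLo E c) := by
    intro E
    rw [IsTopTuple, Fin.sum_univ_succ, Fin.sum_univ_succ]
    have h1 : ∀ t : Fin m, c + m + 1 - (m + 1) + ((t.succ : Fin (m + 1)) : ℕ) = c + 1 + t :=
      fun t => by rw [Fin.val_succ]; omega
    have h2 : c + m + 1 - (m + 1) + ((0 : Fin (m + 1)) : ℕ) = c := by rw [Fin.val_zero]; omega
    simp only [I, Fin.cons_zero, Fin.cons_succ, h1, h2]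
    exact Nat.add_right_cancel_iff
  have htop' : IsTopTuple D' I := by
    rw [hsum]
    refine cutLo_sub_one (lt_of_le_of_ne (cutLo_le D' c) fun he => hc' ?_)
    rw [← he]
    exact hD'.cutLo_mem (Nat.zero_le _)
  have htop : ¬ IsTopTuple D I := by
    rw [hsum, cutLo_eq_self hc]
    have := cutLo_le D (c - 1)
    omega
  obtain ⟨J, hJ⟩ := exists_det_submatrix_ne_zero
    (hankelForm (c + m + 1) D' (genericVector K D' (c + m + 1)))
    (isUnit_det_hankelForm hD' (isNormalVector_slotVector hD' _).lo) hinj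
  have hmem : MvPolynomial.X (⟨⟨m, by omega⟩, I, J⟩ : CoordIndex (c + m + 1)) ∈
      cellIdeal K (c + m + 1) D := by
    rw [X_mem_cellIdeal_iff, limitMinor, if_neg htop]
  have h2 := (X_mem_cellIdeal_iff _).mp (h hmem)
  rw [limitMinor, if_pos htop'] at h2
  exact hJ h2

/-- The coordinate whose value on a cell is, up to a factor depending only on the block that ends
at `c`, the parameter at the position `a`. -/
def tailCoord {c : ℕ} (h2 : 2 ≤ c) (hn : c ≤ n) (a : Fin n) : CoordIndex n :=
  ⟨⟨n - c, by omega⟩, consTail c ⟨c - 1, by omega⟩, consTail c a⟩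

theorem two_le_cutHi (hD : IsCutSet D 0 n) (j : evenSlots D n) : 2 ≤ cutHi D j := by
  have h := Finset.mem_filter.mp j.2
  have h1 := hD.lt_cutHi (Finset.mem_range.mp h.1)
  omega

theorem slot_lt (j : evenSlots D n) : (j : ℕ) < n :=
  Finset.mem_range.mp (Finset.mem_filter.mp j.2).1

theorem slot_cutHi_le (hD : IsCutSet D 0 n) (j : evenSlots D n) : cutHi D j ≤ n :=
  hD.cutHi_le_right (slot_lt j)

/-- The factor that relates `tailCoord` and the parameters. -/
def tailMinor {R : Type*} [CommRing R] (n : ℕ) (D : Finset ℕ) (β : ℕ → R) (c : ℕ) : R :=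
  ((hankelForm n D β).submatrix (fun t : Fin (n - c) => (⟨c + t, by omega⟩ : Fin n))
    fun t : Fin (n - c) => ⟨c + t, by omega⟩).det

theorem limitMinor_tailCoord {R : Type*} [CommRing R] {β : ℕ → R} (hD : IsCutSet D 0 n)
    (j : evenSlots D n) {a : Fin n} (ha : cutLo D a = cutLo D j) :
    limitMinor D β (tailCoord (two_le_cutHi hD j) (slot_cutHi_le hD j) a).2.1
      (tailCoord (two_le_cutHi hD j) (slot_cutHi_le hD j) a).2.2 =
      β a * tailMinor n D β (cutHi D j) := by
  have h1 := two_le_cutHi hD j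
  have h2 := slot_cutHi_le hD j
  have h3 := hD.lt_cutHi (slot_lt j)
  have h4 := cutLo_le D j
  set i : Fin n := ⟨cutHi D j - 1, by omega⟩ with hi
  have hlo : cutLo D i = cutLo D j :=
    hD.cutLo_eq_of_mem (by simp only [hi]; omega) (by simp only [hi]; omega) (Nat.zero_le _)
  have hhi : cutHi D i = cutHi D j := hD.cutHi_eq_of_cutLo_eq i.2 (slot_lt j) hlo
  have hi1 : (i : ℕ) + 1 = cutHi D i := by
    rw [hhi]
    simp only [hi]
    omega
  have h5 := limitMinor_consTail (β := β) hD a hhi (hi1.trans hhi)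
  rw [hankelForm_last hi1 (hlo.trans ha.symm)] at h5
  exact h5

theorem slot_cutLo_lt (j : evenSlots D n) : cutLo D j < n :=
  (cutLo_le D j).trans_lt (slot_lt j)

/-- The coordinate given by `tailCoord` at the left end of the block of `j`. -/
def loCoord (hD : IsCutSet D 0 n) (j : evenSlots D n) : CoordIndex n :=
  tailCoord (two_le_cutHi hD j) (slot_cutHi_le hD j) ⟨cutLo D j, slot_cutLo_lt j⟩

/-- The coordinate given by `tailCoord` at the slot `j`. -/
def slotCoord (hD : IsCutSet D 0 n) (j : evenSlots D n) : CoordIndex n :=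
  tailCoord (two_le_cutHi hD j) (slot_cutHi_le hD j) ⟨j, slot_lt j⟩

theorem limitMinor_loCoord {R : Type*} [CommRing R] {β : ℕ → R} (hD : IsCutSet D 0 n)
    (hβ : ∀ i < n, β (cutLo D i) = 1) (j : evenSlots D n) :
    limitMinor D β (loCoord hD j).2.1 (loCoord hD j).2.2 = tailMinor n D β (cutHi D j) := by
  have h := limitMinor_tailCoord (β := β) hD j (a := ⟨cutLo D j, slot_cutLo_lt j⟩)
    (cutLo_eq_self (hD.cutLo_mem (Nat.zero_le _)))
  refine h.trans ?_
  rw [hβ j (slot_lt j), one_mul]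

theorem limitMinor_slotCoord {R : Type*} [CommRing R] {β : ℕ → R} (hD : IsCutSet D 0 n)
    (j : evenSlots D n) :
    limitMinor D β (slotCoord hD j).2.1 (slotCoord hD j).2.2 =
      β j * tailMinor n D β (cutHi D j) :=
  limitMinor_tailCoord hD j rfl

theorem tailMinor_ne_zero {R : Type*} [CommRing R] [Nontrivial R] {β : ℕ → R}
    (hD : IsCutSet D 0 n) (hβ : ∀ i < n, β (cutLo D i) = 1) (j : evenSlots D n) :
    tailMinor n D β (cutHi D j) ≠ 0 :=
  det_tail_ne_zero hD hβ (hD.cutHi_mem (slot_lt j))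

/-- The equation of the boundary of a cell. -/
def boundaryPoly (K : Type*) [Field K] (hD : IsCutSet D 0 n) : MvPolynomial (CoordIndex n) K :=
  ∏ j : evenSlots D n, MvPolynomial.X (loCoord hD j)

theorem boundaryPoly_notMem (hD : IsCutSet D 0 n) : boundaryPoly K hD ∉ cellIdeal K n D := by
  intro h
  rw [boundaryPoly, Ideal.IsPrime.prod_mem_iff] at h
  obtain ⟨j, -, hj⟩ := h
  have hlo := (isNormalVector_slotVector hD fun j =>
    (MvPolynomial.X (Sum.inl j) : MvPolynomial (evenSlots D n ⊕ Fin (n - 1)) K)).lo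
  rw [X_mem_cellIdeal_iff, genericVector, limitMinor_loCoord hD hlo] at hj
  exact tailMinor_ne_zero hD hlo j hj

/-- A new cut `c` inside a block of `D` separates the last index of that block both from the left
end of the block and from everything after it. The corresponding minor then has a zero row. -/
theorem boundaryPoly_mem (hD : IsCutSet D 0 n) (ho : OddBlocks D n) (hD' : IsCutSet D' 0 n)
    (h : D ⊂ D') : boundaryPoly K hD ∈ cellIdeal K n D' := by
  obtain ⟨hs, hne⟩ := Finset.ssubset_iff_subset_ne.mp h
  obtain ⟨c, hc, hcD⟩ := Finset.exists_of_ssubset h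
  have hcn : c < n := lt_of_le_of_ne (hD'.le_right c hc) fun he => hcD (he ▸ hD.right_mem)
  have hlo : cutLo D c < c := lt_of_le_of_ne (cutLo_le D c) fun he =>
    hcD (he ▸ hD.cutLo_mem (Nat.zero_le _))
  have hhi := hD.lt_cutHi hcn
  have hhin := hD.cutHi_le_right hcn
  have hodd := ho c hcn
  rw [Nat.odd_iff] at hodd
  have hcl : cutLo D (cutLo D c + 2) = cutLo D c :=
    hD.cutLo_eq_of_mem (by omega) (by omega) (Nat.zero_le _)
  -- The first slot of the block of `c`; it exists because a block of odd length with an interior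
  -- cut has length at least `3`.
  let j : evenSlots D n := ⟨cutLo D c + 2, by
    rw [evenSlots, Finset.mem_filter, Finset.mem_range, hcl]
    exact ⟨by omega, by omega, by simp⟩⟩
  have hjlo : cutLo D j = cutLo D c := hcl
  have hjhi : cutHi D j = cutHi D c := hD.cutHi_eq_of_cutLo_eq (slot_lt j) hcn hjlo
  refine (cellIdeal K n D').mem_of_dvd (Finset.dvd_prod_of_mem _ (Finset.mem_univ j)) ?_
  rw [X_mem_cellIdeal_iff, limitMinor]
  split_ifs with htop
  · refine Matrix.det_eq_zero_of_row_eq_zero (0 : Fin (n - cutHi D j + 1)) fun t => ?_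
    refine hankelForm_apply_of_ne ?_
    have hI : (((loCoord hD j).2.1 (0 : Fin (n - cutHi D j + 1)) : Fin n) : ℕ) =
      cutHi D c - 1 := by rw [← hjhi]; rfl
    rw [hI]
    have h1 : c ≤ cutLo D' (cutHi D c - 1) := le_cutLo hc (by omega)
    have h2 := cutLo_le D' (cutHi D c - 1)
    induction t using Fin.cases with
    | zero =>
      have hJ : (((loCoord hD j).2.2 (0 : Fin (n - cutHi D j + 1)) : Fin n) : ℕ) = cutLo D c := by
        rw [← hjlo]; rfl
      change _ ≠ cutLo D' ((loCoord hD j).2.2 (0 : Fin (n - cutHi D j + 1)) : Fin n)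
      rw [hJ]
      have := cutLo_le D' (cutLo D c)
      omega
    | succ t =>
      have hJ : (((loCoord hD j).2.2 (t.succ : Fin (n - cutHi D j + 1)) : Fin n) : ℕ) =
        cutHi D c + t := by rw [← hjhi]; rfl
      change _ ≠ cutLo D' ((loCoord hD j).2.2 (t.succ : Fin (n - cutHi D j + 1)) : Fin n)
      rw [hJ]
      have h3 : cutHi D c ≤ cutLo D' (cutHi D c + t) :=
        le_cutLo (hs (hD.cutHi_mem hcn)) (by omega)
      omega
  · rfl

end CellIdeal

end

noncomputable section

open CompleteQuadric

/-! ### Dimension -/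

section Nullstellensatz

variable {K σ X : Type*} [Field K] [IsAlgClosed K] [Finite σ] {b : X → σ → K}

theorem mem_of_forall_eval_eq_zero (hb : Function.Surjective b) {I : Ideal (MvPolynomial σ K)}
    [hI : I.IsPrime] {f : MvPolynomial σ K}
    (h : ∀ x, (∀ g ∈ I, MvPolynomial.eval (b x) g = 0) → MvPolynomial.eval (b x) f = 0) :
    f ∈ I := by
  rw [← hI.isRadical.radical, ← MvPolynomial.vanishingIdeal_zeroLocus_eq_radical (K := K) I]
  rw [MvPolynomial.mem_vanishingIdeal_iff]
  intro y hy
  obtain ⟨x, rfl⟩ := hb y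
  refine h x fun g hg => ?_
  exact hy g hg

/-- A space whose closed sets are the zero sets of polynomials in `σ` variables has the dimension
of affine space. -/
theorem topologicalKrullDim_eq_of_isClosed_iff [TopologicalSpace X] (hb : Function.Surjective b)
    (hX : ∀ C : Set X, IsClosed C ↔ ∃ I : Set (MvPolynomial σ K),
      C = {x | ∀ g ∈ I, MvPolynomial.eval (b x) g = 0}) :
    topologicalKrullDim X = Nat.card σ := by
  have hJ : ∀ Z : TopologicalSpace.IrreducibleCloseds X, ∃ J : PrimeSpectrum (MvPolynomial σ K),
      ∀ g, g ∈ J.asIdeal ↔ ∀ x ∈ Z, MvPolynomial.eval (b x) g = 0 := by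
    intro Z
    refine ⟨⟨⟨⟨⟨{g | ∀ x ∈ Z, MvPolynomial.eval (b x) g = 0}, fun hf hg x hx => ?_⟩,
      fun x _ => map_zero _⟩, fun c f hf x hx => ?_⟩, ?_⟩, fun g => Iff.rfl⟩
    · rw [map_add, hf x hx, hg x hx, add_zero]
    · change MvPolynomial.eval (b x) (c * f) = 0
      rw [map_mul, hf x hx, mul_zero]
    · refine ⟨fun h => ?_, fun {f g} hfg => ?_⟩
      · obtain ⟨x, hx⟩ := Z.isIrreducible.nonempty
        have h1 := (Ideal.eq_top_iff_one _).mp h x hx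
        rw [map_one] at h1
        exact one_ne_zero h1
      · have hcl : ∀ g : MvPolynomial σ K, IsClosed {x | MvPolynomial.eval (b x) g = 0} :=
          fun g => (hX _).mpr ⟨{g}, by simp⟩
        refine (isPreirreducible_iff_isClosed_union_isClosed.mp Z.isIrreducible.isPreirreducible
          _ _ (hcl f) (hcl g) fun x hx => ?_).imp (fun h x hx => h hx) fun h x hx => h hx
        have h1 := hfg x hx
        rw [map_mul] at h1
        exact mul_eq_zero.mp h1
  have hZ : ∀ J : PrimeSpectrum (MvPolynomial σ K), ∃ Z : TopologicalSpace.IrreducibleCloseds X,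
      ∀ x, x ∈ Z ↔ ∀ g ∈ J.asIdeal, MvPolynomial.eval (b x) g = 0 := by
    intro J
    refine ⟨⟨{x | ∀ g ∈ J.asIdeal, MvPolynomial.eval (b x) g = 0}, ⟨?_, ?_⟩,
      (hX _).mpr ⟨J.asIdeal, rfl⟩⟩, fun x => Iff.rfl⟩
    · by_contra hne
      rw [Set.not_nonempty_iff_eq_empty] at hne
      refine J.2.ne_top ((Ideal.eq_top_iff_one _).mpr
        (mem_of_forall_eval_eq_zero hb fun x hx => ?_))
      have : x ∈ (∅ : Set X) := hne ▸ hx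
      exact this.elim
    · rw [isPreirreducible_iff_isClosed_union_isClosed]
      intro C C' hC hC' hsub
      obtain ⟨I, rfl⟩ := (hX C).mp hC
      obtain ⟨I', rfl⟩ := (hX C').mp hC'
      by_contra hcon
      obtain ⟨h1, h2⟩ := not_or.mp hcon
      obtain ⟨x, hx, hxC⟩ := Set.not_subset.mp h1
      obtain ⟨y, hy, hyC⟩ := Set.not_subset.mp h2
      simp only [Set.mem_ofPred_eq, not_forall] at hxC hyC
      obtain ⟨f, hf, hfx⟩ := hxC
      obtain ⟨g, hg, hgy⟩ := hyC
      have hmem : f * g ∈ J.asIdeal := mem_of_forall_eval_eq_zero hb fun z hz => by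
        rw [map_mul]
        rcases hsub hz with h | h
        · rw [h f hf, zero_mul]
        · rw [h g hg, mul_zero]
      rcases J.2.mem_or_mem hmem with h | h
      · exact hfx (hx f h)
      · exact hgy (hy g h)
  -- `φ` assigns to a closed irreducible set its vanishing ideal and `ψ` to a prime its zero set;
  -- the Nullstellensatz makes `φ` surjective.
  choose φ hφ using hJ
  choose ψ hψ using hZ
  have hle : ∀ Z Z', φ Z ≤ φ Z' ↔ Z' ≤ Z := by
    intro Z Z'
    constructor
    · intro h x hx
      obtain ⟨I, hI⟩ := (hX Z).mp Z.isClosed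
      have hxZ : x ∈ (Z : Set X) := by
        rw [hI]
        intro g hg
        refine (hφ Z' g).mp (h ((hφ Z g).mpr fun y hy => ?_)) x hx
        have hy' : y ∈ (Z : Set X) := hy
        rw [hI] at hy'
        exact hy' g hg
      exact hxZ
    · intro h g hg
      exact (hφ Z' g).mpr fun x hx => (hφ Z g).mp hg x (h hx)
  have hsurj : Function.Surjective φ := by
    intro J
    refine ⟨ψ J, PrimeSpectrum.ext (Ideal.ext fun g => ?_)⟩
    rw [hφ]
    exact ⟨fun h => mem_of_forall_eval_eq_zero hb fun x hx => h x ((hψ J x).mpr hx),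
      fun h x hx => (hψ J x).mp hx g h⟩
  have hinj : Function.Injective φ := fun Z Z' h =>
    le_antisymm ((hle Z' Z).mp h.ge) ((hle Z Z').mp h.le)
  let e : (TopologicalSpace.IrreducibleCloseds X)ᵒᵈ ≃o PrimeSpectrum (MvPolynomial σ K) :=
    { toEquiv := OrderDual.ofDual.trans (Equiv.ofBijective φ ⟨hinj, hsurj⟩)
      map_rel_iff' := fun {Z Z'} => hle _ _ }
  rw [topologicalKrullDim, ← Order.krullDim_orderDual, Order.krullDim_eq_of_orderIso e]
  have h := MvPolynomial.ringKrullDim_of_isNoetherianRing (R := K) (ι := σ)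
  rw [ringKrullDim_eq_zero_of_field, zero_add] at h
  exact h

end Nullstellensatz

/-! ### Krull dimension of a cell -/

section Dimension

variable {K : Type*} [Field K] {n : ℕ} {D : Finset ℕ}

/-- On the cell, the parameter `b j` is the quotient of the coordinates `slotCoord` and `loCoord`,
which belong to the same factor. Substituting these quotients and multiplying by `loCoord ^ N` for
every slot clears denominators and makes all terms of equal multidegree. -/
theorem exists_isMultihomogeneous_eval_eq (hD : IsCutSet D 0 n)
    (g : MvPolynomial (evenSlots D n) K) :
    ∃ G : MvPolynomial (CoordIndex n) K, IsMultihomogeneous G ∧ ∀ b : evenSlots D n → K,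
      ∃ a : K, a ≠ 0 ∧ MvPolynomial.eval
        (fun c : CoordIndex n => limitMinor D (slotVector D n b) c.2.1 c.2.2) G =
          a * MvPolynomial.eval b g := by
  set N := g.totalDegree
  refine ⟨∑ d ∈ g.support, MvPolynomial.C (g.coeff d) * ∏ j : evenSlots D n,
    (MvPolynomial.X (slotCoord hD j) ^ d j * MvPolynomial.X (loCoord hD j) ^ (N - d j)),
    ⟨∑ j : evenSlots D n, N • Pi.single (loCoord hD j).1 1, ?_⟩, fun b =>
    ⟨∏ j : evenSlots D n, tailMinor n D (slotVector D n b) (cutHi D j) ^ N,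
      Finset.prod_ne_zero_iff.mpr fun j _ => pow_ne_zero _
        (tailMinor_ne_zero hD (isNormalVector_slotVector hD b).lo j), ?_⟩⟩
  · refine MvPolynomial.IsWeightedHomogeneous.sum _ _ _ fun d hd => ?_
    refine MvPolynomial.IsWeightedHomogeneous.C_mul ?_ _
    refine MvPolynomial.IsWeightedHomogeneous.prod _ _ _ fun j _ => ?_
    have hdN : d j ≤ N := (MvPolynomial.monomial_le_degreeOf j hd).trans
      (MvPolynomial.degreeOf_le_totalDegree g j)
    have h1 := ((MvPolynomial.isWeightedHomogeneous_X K
      (fun c : CoordIndex n => (Pi.single c.1 1 : Fin (n - 1) → ℕ)) (slotCoord hD j)).pow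
        (d j)).mul ((MvPolynomial.isWeightedHomogeneous_X K
      (fun c : CoordIndex n => (Pi.single c.1 1 : Fin (n - 1) → ℕ)) (loCoord hD j)).pow (N - d j))
    have h2 : (slotCoord hD j).1 = (loCoord hD j).1 := rfl
    rw [h2, ← add_smul, Nat.add_sub_cancel' hdN] at h1
    exact h1
  · rw [map_sum]
    conv_rhs => rw [MvPolynomial.eval_eq' b g, Finset.mul_sum]
    refine Finset.sum_congr rfl fun d hd => ?_
    rw [map_mul, MvPolynomial.eval_C, map_prod, mul_left_comm, ← Finset.prod_mul_distrib]
    congr 1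
    refine Finset.prod_congr rfl fun j _ => ?_
    have hdN : d j ≤ N := (MvPolynomial.monomial_le_degreeOf j hd).trans
      (MvPolynomial.degreeOf_le_totalDegree g j)
    rw [map_mul, map_pow, map_pow, MvPolynomial.eval_X, MvPolynomial.eval_X,
      limitMinor_slotCoord hD, limitMinor_loCoord hD (isNormalVector_slotVector hD b).lo,
      slotVector_apply, mul_pow, mul_assoc, ← pow_add, Nat.add_sub_cancel' hdN, mul_comm]

/-- The parameters identify the closed sets of the cell with those of affine space: one direction
sets the scaling factors to `1` in the parametrization, the other homogenizes a polynomial in the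
parameters. -/
theorem IsCellChart.topologicalKrullDim_eq [IsAlgClosed K] {P : Matrix (Fin n) (Fin n) K}
    (hP : IsUnit P.det) {T : Set (CompleteQuadric K n)} (hD : IsCutSet D 0 n)
    (h : IsCellChart P T D) : topologicalKrullDim T = (evenSlots D n).card := by
  have hinv : ∀ y : CoordIndex n → K, changeCoord P⁻¹ (changeCoord P y) = y := fun y => by
    rw [changeCoord_changeCoord, Matrix.mul_nonsing_inv P hP, changeCoord_one]
  choose b s hs hc using fun x : T => h.coord_eq x x.2
  have hc' : ∀ x : T, changeCoord P x.1.coord = fun c : CoordIndex n =>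
      s x c.1 * limitMinor D (slotVector D n (b x)) c.2.1 c.2.2 := fun x => funext (hc x)
  -- The ratio of two coordinates does not see the scaling, so the parameters chosen for a point
  -- agree with the prescribed ones.
  have hb : Function.Surjective b := by
    intro b₀
    obtain ⟨x, hx, t, ht, hxt⟩ := h.exists_mem b₀
    refine ⟨⟨x, hx⟩, funext fun j => ?_⟩
    have h1 := hc ⟨x, hx⟩ (loCoord hD j)
    have h2 := hc ⟨x, hx⟩ (slotCoord hD j)
    rw [hxt, limitMinor_loCoord hD (isNormalVector_slotVector hD _).lo,
      limitMinor_loCoord hD (isNormalVector_slotVector hD _).lo] at h1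
    rw [hxt, limitMinor_slotCoord hD, limitMinor_slotCoord hD, slotVector_apply,
      slotVector_apply] at h2
    have h3 : (slotCoord hD j).1 = (loCoord hD j).1 := rfl
    rw [h3] at h2
    have h4 := tailMinor_ne_zero hD (isNormalVector_slotVector hD b₀).lo j
    refine mul_right_cancel₀ (mul_ne_zero (ht (loCoord hD j).1) h4) ?_
    linear_combination (-1 : K) * h2 + b ⟨x, hx⟩ j * h1
  have hfwd : ∀ f : MvPolynomial (CoordIndex n) K, IsMultihomogeneous f →
      ∃ g : MvPolynomial (evenSlots D n) K, ∀ x : T,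
        MvPolynomial.eval x.1.coord f = 0 ↔ MvPolynomial.eval (b x) g = 0 := by
    intro f hf
    refine ⟨MvPolynomial.aeval (Sum.elim MvPolynomial.X 1) (cellHom K n D (changePoly P⁻¹ f)),
      fun x => ?_⟩
    obtain ⟨a, ha, h1⟩ := IsMultihomogeneous_eval_smul (isMultihomogeneous_changePoly P⁻¹ hf) (s x)
    have h2 : MvPolynomial.eval x.1.coord f =
        MvPolynomial.eval (changeCoord P x.1.coord) (changePoly P⁻¹ f) := by
      rw [eval_changePoly, hinv]
    rw [h2, hc', h1, mul_eq_zero, or_iff_right (ha (hs x))]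
    have h3 := MvPolynomial.comp_aeval_apply
      (Sum.elim MvPolynomial.X 1 : evenSlots D n ⊕ Fin (n - 1) → MvPolynomial (evenSlots D n) K)
      (MvPolynomial.aeval (b x) : MvPolynomial (evenSlots D n) K →ₐ[K] K)
      (cellHom K n D (changePoly P⁻¹ f))
    have h4 : (fun i => MvPolynomial.aeval (b x) ((Sum.elim MvPolynomial.X 1 :
        evenSlots D n ⊕ Fin (n - 1) → MvPolynomial (evenSlots D n) K) i)) =
        (Sum.elim (b x) 1 : evenSlots D n ⊕ Fin (n - 1) → K) := by
      ext i
      rcases i with i | i <;> simp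
    have h5 := aeval_cellHom D (b x) 1 (changePoly P⁻¹ f)
    simp only [Pi.one_apply, one_mul] at h5
    rw [h4, h5] at h3
    rw [← MvPolynomial.aeval_eq_eval, ← MvPolynomial.aeval_eq_eval]
    exact (Eq.congr_left h3).symm
  have hbwd : ∀ g : MvPolynomial (evenSlots D n) K, ∃ f : MvPolynomial (CoordIndex n) K,
      IsMultihomogeneous f ∧ ∀ x : T,
        MvPolynomial.eval x.1.coord f = 0 ↔ MvPolynomial.eval (b x) g = 0 := by
    intro g
    obtain ⟨G, hG, hGg⟩ := exists_isMultihomogeneous_eval_eq hD g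
    refine ⟨changePoly P G, isMultihomogeneous_changePoly P hG, fun x => ?_⟩
    obtain ⟨a, ha, h1⟩ := IsMultihomogeneous_eval_smul hG (s x)
    obtain ⟨a', ha', h2⟩ := hGg (b x)
    rw [eval_changePoly, hc', h1, h2, mul_eq_zero, or_iff_right (ha (hs x)), mul_eq_zero,
      or_iff_right ha']
  choose F hF using hfwd
  choose G hG hG' using hbwd
  have hcard : (evenSlots D n).card = Nat.card (evenSlots D n) := by simp
  rw [hcard]
  refine topologicalKrullDim_eq_of_isClosed_iff hb fun C => ?_
  rw [isClosed_induced_iff]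
  constructor
  · rintro ⟨Z, hZ, rfl⟩
    obtain ⟨I, hI, rfl⟩ := isClosed_iff_zeroSet.mp hZ
    refine ⟨{g | ∃ (f : _) (hf : f ∈ I), F f (hI f hf) = g}, Set.ext fun x => ?_⟩
    constructor
    · rintro hx _ ⟨f, hf, rfl⟩
      exact (hF f (hI f hf) x).mp (hx f hf)
    · exact fun hx f hf => (hF f (hI f hf) x).mpr (hx _ ⟨f, hf, rfl⟩)
  · rintro ⟨I, rfl⟩
    refine ⟨zeroSet (G '' I), isClosed_iff_zeroSet.mpr ⟨_, ?_, rfl⟩, Set.ext fun x => ?_⟩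
    · rintro _ ⟨g, -, rfl⟩
      exact hG g
    · constructor
      · exact fun hx g hg => (hG' g x).mp (hx _ ⟨g, hg, rfl⟩)
      · rintro hx _ ⟨g, hg, rfl⟩
        exact (hG' g x).mpr (hx g hg)

end Dimension

end

noncomputable section

open CompleteQuadric

/-! ### Gradedness -/

section Dominate

/-- Localize the image of `φ` at the image of `p` and dominate this local ring by a valuation ring.
Domination preserves nonunits, so the maximal ideal of `V` pulls back to `p`. -/
theorem exists_valuationSubring_dominating {A L : Type*} [CommRing A] [Field L] (φ : A →+* L)
    (p : Ideal A) [hp : p.IsPrime] (hker : RingHom.ker φ ≤ p) :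
    ∃ V : ValuationSubring L, (∀ a, V.valuation (φ a) ≤ 1) ∧
      ∀ a, V.valuation (φ a) < 1 ↔ a ∈ p := by
  have hsurj := φ.rangeRestrict_surjective
  have hker' : RingHom.ker φ.rangeRestrict ≤ p := fun a ha =>
    hker (congrArg Subtype.val (show φ.rangeRestrict a = 0 from ha))
  let M := p.map φ.rangeRestrict
  have hM : M.IsPrime := Ideal.map_isPrime_of_surjective hsurj hker'
  have hmem : ∀ a, φ.rangeRestrict a ∈ M ↔ a ∈ p := by
    intro a
    have h := Ideal.comap_map_of_surjective' φ.rangeRestrict hsurj p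
    rw [sup_eq_left.mpr hker'] at h
    rw [← Ideal.mem_comap, h]
  obtain ⟨V, hV, hloc⟩ := (LocalSubring.ofPrime φ.range M).exists_le_valuationSubring
  have hle : ∀ a : φ.range, (a : L) ∈ V := fun a => hV (LocalSubring.le_ofPrime _ _ a.2)
  refine ⟨V, fun a => (V.valuation_le_one_iff _).mpr (hle (φ.rangeRestrict a)), fun a => ?_⟩
  rw [← hmem a]
  have h1 := V.valuation_lt_one_iff ⟨φ a, hle (φ.rangeRestrict a)⟩
  rw [IsLocalRing.mem_maximalIdeal, mem_nonunits_iff] at h1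
  refine h1.symm.trans ?_
  have h2 := IsLocalization.AtPrime.isUnit_to_map_iff
    (LocalSubring.ofPrime φ.range M).toSubring M (φ.rangeRestrict a)
  have h3 : IsUnit (⟨φ a, hle (φ.rangeRestrict a)⟩ : V) ↔
      IsUnit (algebraMap φ.range (LocalSubring.ofPrime φ.range M).toSubring
        (φ.rangeRestrict a)) :=
    ⟨fun h => hloc.map_nonunit _ h, fun h => h.map (Subring.inclusion hV)⟩
  rw [h3, h2]
  exact not_not

end Dominate

/-! ### Specialization to primes in the boundary of a cell -/

section Limit

variable {K : Type*} [Field K] {n : ℕ} {D : Finset ℕ}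

theorem exists_residue_limitMinor {L : Type*} [Field L] (V : ValuationSubring L)
    (hv2 : V.valuation 2 = 1) (hD : IsCutSet D 0 n) (ho : OddBlocks D n) {β₀ : ℕ → L}
    (hβ₀ : IsNormalVector D n β₀) (a₀ : Fin (n - 1) → L) (y : CoordIndex n → V)
    (hy : ∀ c, (y c : L) = a₀ c.1 * limitMinor D β₀ c.2.1 c.2.2) :
    ∃ D', IsCutSet D' 0 n ∧ OddBlocks D' n ∧ D ⊆ D' ∧
      ∃ b : ℕ → IsLocalRing.ResidueField V, IsNormalVector D' n b ∧
        ∃ α : Fin (n - 1) → IsLocalRing.ResidueField V, ∀ c,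
          IsLocalRing.residue V (y c) = α c.1 * limitMinor D' b c.2.1 c.2.2 := by
  obtain ⟨D', β, hD', hsub, ho', hβ, hβ1, hlim⟩ := exists_limit hv2 hD ho hβ₀
  choose σ hσ0 hσ using hlim
  let a : Fin (n - 1) → L := fun i => a₀ i * σ (i + 1)
  have hya : ∀ c : CoordIndex n, (y c : L) =
      a c.1 * (limitMinor D β₀ c.2.1 c.2.2 / σ (c.1 + 1)) := by
    intro c
    rw [hy]
    simp only [a]
    rw [mul_assoc, mul_div_cancel₀ _ (hσ0 _)]
  have hres : ∀ x : V, IsLocalRing.residue V x = 0 ↔ V.valuation x < 1 := fun x => by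
    rw [IsLocalRing.residue_eq_zero_iff, V.valuation_lt_one_iff]
  let βV : ℕ → V := fun i =>
    if h : V.valuation (β i) ≤ 1 then ⟨β i, V.mem_of_valuation_le_one _ h⟩ else 0
  have hβV : ∀ i < n, (βV i : L) = β i := fun i hi => by simp only [βV, dif_pos (hβ1 i hi)]
  let b : ℕ → IsLocalRing.ResidueField V := fun i => IsLocalRing.residue V (βV i)
  have hlt : ∀ i < n, cutLo D' i < n := fun i hi => (cutLo_le D' i).trans_lt hi
  have hb : IsNormalVector D' n b := by
    refine ⟨fun i hi => ?_, fun i hi h => ?_⟩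
    · have h3 : βV (cutLo D' i) = 1 := Subtype.ext ((hβV _ (hlt i hi)).trans (hβ.lo i hi))
      simp only [b, h3, map_one]
    · have h3 : βV i = 0 := Subtype.ext ((hβV _ hi).trans (hβ.odd i hi h))
      simp only [b, h3, map_zero]
  have hminor : ∀ c : CoordIndex n, limitMinor D' β c.2.1 c.2.2 =
      (limitMinor D' βV c.2.1 c.2.2 : V) := fun c => by
    rw [limitMinor_congr (fun i hi => (hβV i hi).symm) hD']
    exact (map_limitMinor V.subtype _ _).symm
  have hminor' : ∀ c : CoordIndex n, IsLocalRing.residue V (limitMinor D' βV c.2.1 c.2.2) =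
      limitMinor D' b c.2.1 c.2.2 := fun c => map_limitMinor _ _ _
  -- A limit minor that is nonzero in the residue field has valuation `1`, and so does the rescaled
  -- minor congruent to it. Integrality of that coordinate then gives integrality of the factor `a
  -- i`.
  have ha1 : ∀ i, V.valuation (a i) ≤ 1 := by
    intro i
    obtain ⟨I, J, hIJ⟩ := exists_limitMinor_ne_zero hD' hb.lo (d := i + 1) (by omega)
    let c : CoordIndex n := ⟨i, I, J⟩
    have h3 : V.valuation (limitMinor D' β c.2.1 c.2.2) = 1 := by
      rw [hminor]
      refine le_antisymm (V.valuation_le_one _) (not_lt.mp fun h => hIJ ?_)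
      have h6 := (hres _).mpr h
      rwa [hminor'] at h6
    have h4 : V.valuation (limitMinor D β₀ c.2.1 c.2.2 / σ (c.1 + 1)) = 1 := by
      rw [← h3]
      exact Valuation.map_eq_of_sub_lt _ (by rw [h3]; exact hσ _ _ _)
    have h5 := V.valuation_le_one (y c)
    rw [hya, map_mul, h4, mul_one] at h5
    exact h5
  let aV : Fin (n - 1) → V := fun i => ⟨a i, V.mem_of_valuation_le_one _ (ha1 i)⟩
  refine ⟨D', hD', ho', hsub, b, hb, fun i => IsLocalRing.residue V (aV i), fun c => ?_⟩
  rw [← hminor', ← map_mul, ← sub_eq_zero, ← map_sub, hres]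
  have h3 : ((y c - aV c.1 * limitMinor D' βV c.2.1 c.2.2 : V) : L) =
      a c.1 * (limitMinor D β₀ c.2.1 c.2.2 / σ (c.1 + 1) - limitMinor D' β c.2.1 c.2.2) := by
    rw [mul_sub, ← hya, hminor]
    rfl
  rw [h3, map_mul]
  exact (mul_le_of_le_one_left' (ha1 _)).trans_lt (hσ _ _ _)

/-- A valuation ring dominating at `p` exhibits the generic point of `p` as a limit of the generic
form of the cell, hence as a specialization of a finer cell. `hirr` keeps the limiting scaling
factors nonzero; then `hbd` excludes `D' = D`, since for that cell no factor of `boundaryPoly` could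
vanish in the residue field. -/
theorem exists_cellIdeal_le {L : Type*} [Field L]
    (ι : MvPolynomial (evenSlots D n ⊕ Fin (n - 1)) K →+* L) (hι : Function.Injective ι)
    (h2 : (2 : K) ≠ 0) (hD : IsCutSet D 0 n) (ho : OddBlocks D n)
    (p : Ideal (MvPolynomial (CoordIndex n) K)) [hp : p.IsPrime] (hDp : cellIdeal K n D ≤ p)
    (hirr : ∀ i : Fin (n - 1), ∃ c : CoordIndex n, c.1 = i ∧ MvPolynomial.X c ∉ p)
    (hbd : boundaryPoly K hD ∈ p) :
    ∃ D', IsCutSet D' 0 n ∧ OddBlocks D' n ∧ D ⊂ D' ∧ cellIdeal K n D' ≤ p := by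
  let φ : MvPolynomial (CoordIndex n) K →+* L := ι.comp (cellHom K n D).toRingHom
  have hφker : RingHom.ker φ ≤ p := by
    intro f hf
    refine hDp ?_
    rw [cellIdeal, RingHom.mem_ker]
    exact hι ((show ι (cellHom K n D f) = 0 from hf).trans (map_zero _).symm)
  obtain ⟨V, hV1, hVp⟩ := exists_valuationSubring_dominating φ p hφker
  -- `2` is a unit constant, so it cannot lie in the prime `p`.
  have hv2 : V.valuation 2 = 1 := by
    have h3 : φ (MvPolynomial.C 2) = 2 := by rw [map_ofNat, map_ofNat]
    rw [← h3]
    refine le_antisymm (hV1 _) (not_lt.mp fun hlt => ?_)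
    exact hp.ne_top (Ideal.eq_top_of_isUnit_mem _ ((hVp _).mp hlt)
      ((isUnit_iff_ne_zero.mpr h2).map MvPolynomial.C))
  let β₀ : ℕ → L := fun j => ι (genericVector K D n j)
  have hβ₀ : IsNormalVector D n β₀ := by
    have h3 : β₀ = slotVector D n fun j => ι (MvPolynomial.X (Sum.inl j)) :=
      funext fun j => map_slotVector _ _ _
    rw [h3]
    exact isNormalVector_slotVector hD _
  let φV : MvPolynomial (CoordIndex n) K →+* V :=
    φ.codRestrict V fun f => (V.valuation_le_one_iff _).mp (hV1 f)
  have hφV : ∀ c : CoordIndex n, (φV (MvPolynomial.X c) : L) =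
      ι (MvPolynomial.X (Sum.inr c.1)) * limitMinor D β₀ c.2.1 c.2.2 := by
    intro c
    have h3 : (φV (MvPolynomial.X c) : L) = ι (MvPolynomial.X (Sum.inr c.1) *
        limitMinor D (genericVector K D n) c.2.1 c.2.2) :=
      congrArg ι (MvPolynomial.aeval_X _ c)
    rw [h3, map_mul, map_limitMinor]
  obtain ⟨D', hD', ho', hsub, b, hb, α, hα⟩ := exists_residue_limitMinor V hv2 hD ho hβ₀
    (fun i => ι (MvPolynomial.X (Sum.inr i))) (fun c => φV (MvPolynomial.X c)) hφV
  let π : MvPolynomial (CoordIndex n) K →+* IsLocalRing.ResidueField V :=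
    (IsLocalRing.residue V).comp φV
  have hπ : ∀ f, π f = 0 ↔ f ∈ p := fun f => by
    rw [← hVp]
    change IsLocalRing.residue V (φV f) = 0 ↔ V.valuation (φV f) < 1
    rw [IsLocalRing.residue_eq_zero_iff, V.valuation_lt_one_iff]
  have hπX : ∀ c : CoordIndex n, π (MvPolynomial.X c) =
      α c.1 * limitMinor D' b c.2.1 c.2.2 := hα
  have hα0 : ∀ i, α i ≠ 0 := by
    intro i h0
    obtain ⟨c, rfl, hc⟩ := hirr i
    exact hc ((hπ _).mp (by rw [hπX, h0, zero_mul]))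
  refine ⟨D', hD', ho', Finset.ssubset_iff_subset_ne.mpr ⟨hsub, ?_⟩, fun f hf => (hπ f).mp ?_⟩
  · rintro rfl
    rw [boundaryPoly, Ideal.IsPrime.prod_mem_iff] at hbd
    obtain ⟨j, -, hj⟩ := hbd
    rw [← hπ, hπX, limitMinor_loCoord hD hb.lo] at hj
    exact mul_ne_zero (hα0 _) (tailMinor_ne_zero hD hb.lo j) hj
  · let _ : Algebra K (IsLocalRing.ResidueField V) := (π.comp MvPolynomial.C).toAlgebra
    have h3 : ∀ g, π g = MvPolynomial.aeval (fun c => π (MvPolynomial.X c)) g := by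
      intro g
      induction g using MvPolynomial.induction_on with
      | C r => rw [MvPolynomial.aeval_C]; rfl
      | add g g' hg hg' => rw [map_add, map_add, hg, hg']
      | mul_X g c hg => rw [map_mul, map_mul, hg, MvPolynomial.aeval_X]
    have h4 := aeval_cellHom D' (fun j : evenSlots D' n => b j) α f
    rw [h3]
    have h5 : (fun c => π (MvPolynomial.X c)) = fun c : CoordIndex n => α c.1 *
        limitMinor D' (slotVector D' n fun j => b j) c.2.1 c.2.2 := funext fun c => by
      rw [hπX, limitMinor_congr (fun i hi => hb.eq_slotVector hi) hD']
    rw [h5, ← h4, RingHom.mem_ker.mp hf, map_zero]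

end Limit

/-! ### Dimension count between two cells -/

section Trdeg

universe w

variable {K : Type w} [Field K] {n : ℕ} {D : Finset ℕ}

/-- The quotient embeds into the polynomial ring of parameters and scalings, and that ring is
algebraic over it: each slot variable is a ratio of two coordinates, and each scaling variable is
the ratio of a coordinate and a nonzero limit minor. -/
theorem trdeg_quotient_cellIdeal (hD : IsCutSet D 0 n) :
    Algebra.trdeg K (MvPolynomial (CoordIndex n) K ⧸ cellIdeal K n D) =
      ((evenSlots D n).card + (n - 1) : ℕ) := by
  let S := MvPolynomial (evenSlots D n ⊕ Fin (n - 1)) K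
  have hS : Algebra.trdeg K S = ((evenSlots D n).card + (n - 1) : ℕ) := by
    rw [MvPolynomial.trdeg_of_isDomain]
    simp
  let A := MvPolynomial (CoordIndex n) K ⧸ cellIdeal K n D
  let ψ : A →ₐ[K] S := Ideal.Quotient.liftₐ _ (cellHom K n D) fun a ha => ha
  have hψ : Function.Injective ψ := RingHom.kerLift_injective (cellHom K n D).toRingHom
  let _ : Algebra A S := ψ.toRingHom.toAlgebra
  have : IsScalarTower K A S := IsScalarTower.of_algebraMap_eq fun c => (ψ.commutes c).symm
  have : FaithfulSMul A S := (faithfulSMul_iff_algebraMap_injective _ _).mpr hψ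
  have hC : ∀ r : K, IsAlgebraic A (MvPolynomial.C r : S) := fun r => by
    have h1 : (MvPolynomial.C r : S) = algebraMap A S (algebraMap K A r) :=
      IsScalarTower.algebraMap_apply K A S r
    rw [h1]
    exact isAlgebraic_algebraMap _
  have hX : ∀ c : CoordIndex n, IsAlgebraic A (MvPolynomial.X (Sum.inr c.1) *
      limitMinor D (genericVector K D n) c.2.1 c.2.2 : S) := by
    intro c
    have h1 : (MvPolynomial.X (Sum.inr c.1) *
        limitMinor D (genericVector K D n) c.2.1 c.2.2 : S) =
        algebraMap A S (Ideal.Quotient.mk _ (MvPolynomial.X c)) := by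
      change _ = cellHom K n D (MvPolynomial.X c)
      rw [cellHom, MvPolynomial.aeval_X]
      rfl
    rw [h1]
    exact isAlgebraic_algebraMap _
  have hlo : ∀ i < n, genericVector K D n (cutLo D i) = 1 := (isNormalVector_slotVector hD _).lo
  have hinl : ∀ j : evenSlots D n, IsAlgebraic A (MvPolynomial.X (Sum.inl j) : S) := by
    intro j
    have h1 := hX (loCoord hD j)
    have h2 := hX (slotCoord hD j)
    rw [limitMinor_loCoord hD hlo] at h1
    rw [limitMinor_slotCoord hD] at h2
    refine IsAlgebraic.of_mul (mem_nonZeroDivisors_of_ne_zero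
      (mul_ne_zero (MvPolynomial.X_ne_zero _) (tailMinor_ne_zero hD hlo j))) h1 ?_
    have h3 : genericVector K D n j = MvPolynomial.X (Sum.inl j) := slotVector_apply _ j
    rw [h3] at h2
    have h4 : (slotCoord hD j).1 = (loCoord hD j).1 := rfl
    rw [h4] at h2
    rw [mul_right_comm, mul_assoc]
    exact h2
  have hinl' : ∀ q : MvPolynomial (evenSlots D n) K, IsAlgebraic A
      (MvPolynomial.rename Sum.inl q : S) := by
    intro q
    induction q using MvPolynomial.induction_on with
    | C r =>
      rw [MvPolynomial.rename_C]
      exact hC r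
    | add g g' hg hg' => rw [map_add]; exact hg.add hg'
    | mul_X g c hg => rw [map_mul, MvPolynomial.rename_X]; exact hg.mul (hinl c)
  have hminor : ∀ c : CoordIndex n,
      IsAlgebraic A (limitMinor D (genericVector K D n) c.2.1 c.2.2) := by
    intro c
    have h1 := hinl' (limitMinor D (slotVector D n MvPolynomial.X) c.2.1 c.2.2)
    rw [← AlgHom.coe_toRingHom, map_limitMinor] at h1
    convert h1 using 2
    ext1 j
    rw [map_slotVector]
    unfold genericVector
    congr 1
    ext1 k
    simp
  have hinr : ∀ i : Fin (n - 1), IsAlgebraic A (MvPolynomial.X (Sum.inr i) : S) := by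
    intro i
    obtain ⟨I, J, hIJ⟩ := exists_limitMinor_ne_zero hD hlo (d := i + 1) (by omega)
    refine IsAlgebraic.of_mul (mem_nonZeroDivisors_of_ne_zero hIJ) (hminor ⟨i, I, J⟩) ?_
    rw [mul_comm]
    exact hX ⟨i, I, J⟩
  have : Algebra.IsAlgebraic A S := by
    refine ⟨fun q => ?_⟩
    induction q using MvPolynomial.induction_on with
    | C r => exact hC r
    | add g g' hg hg' => exact hg.add hg'
    | mul_X g c hg =>
      rcases c with c | c
      · exact hg.mul (hinl c)
      · exact hg.mul (hinr c)
  rw [← hS, ← trdeg_add_eq K A (A := S), trdeg_eq_zero (R := A) (A := S), add_zero]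

theorem exists_X_notMem_cellIdeal (hD : IsCutSet D 0 n) (i : Fin (n - 1)) :
    ∃ c : CoordIndex n, c.1 = i ∧ MvPolynomial.X c ∉ cellIdeal K n D := by
  have hlo : ∀ i < n, genericVector K D n (cutLo D i) = 1 := (isNormalVector_slotVector hD _).lo
  obtain ⟨I, J, hIJ⟩ := exists_limitMinor_ne_zero hD hlo (d := i + 1) (by omega)
  exact ⟨⟨i, I, J⟩, rfl, fun h => hIJ ((X_mem_cellIdeal_iff _).mp h)⟩

/-- A minimal prime `p` over the equation of the boundary loses at most one transcendence degree,
while the cell `E` with ideal inside `p` loses at least one. So `p` and the ideal of `E` have equal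
degree and coincide. -/
theorem exists_cellIdeal_between (h2 : (2 : K) ≠ 0) {D' : Finset ℕ} (hD : IsCutSet D 0 n)
    (ho : OddBlocks D n) (hD' : IsCutSet D' 0 n) (hDD' : D ⊂ D')
    (hle : cellIdeal K n D ≤ cellIdeal K n D') :
    ∃ E, IsCutSet E 0 n ∧ OddBlocks E n ∧ cellIdeal K n D ≤ cellIdeal K n E ∧
      cellIdeal K n E ≤ cellIdeal K n D' ∧
      (evenSlots D n).card = (evenSlots E n).card + 1 := by
  set f := boundaryPoly K hD with hf
  have hfD' : f ∈ cellIdeal K n D' := boundaryPoly_mem hD ho hD' hDD'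
  obtain ⟨p, hpmin, hpD'⟩ := Ideal.exists_minimalPrimes_le
    (show cellIdeal K n D ⊔ Ideal.span {f} ≤ cellIdeal K n D' from
      sup_le hle ((Ideal.span_singleton_le_iff_mem _).mpr hfD'))
  have hp : p.IsPrime := hpmin.1.1
  have hDp : cellIdeal K n D ≤ p := le_sup_left.trans hpmin.1.2
  have hfp : f ∈ p := hpmin.1.2 (Ideal.mem_sup_right (Ideal.mem_span_singleton_self f))
  obtain ⟨E, hE, hoE, hDE, hEp⟩ := exists_cellIdeal_le
    (algebraMap _ (FractionRing (MvPolynomial (evenSlots D n ⊕ Fin (n - 1)) K)))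
    (IsFractionRing.injective _ _) h2 hD ho p hDp (fun i => by
    obtain ⟨c, hc, h⟩ := exists_X_notMem_cellIdeal (K := K) hD' i
    exact ⟨c, hc, fun hcp => h (hpD' hcp)⟩) hfp
  -- The degree and height results concern primes of a domain, so `p` is carried over to the
  -- coordinate ring of each of the two cells.
  have key : ∀ F : Finset ℕ, cellIdeal K n F ≤ p →
      ∃ q : Ideal (MvPolynomial (CoordIndex n) K ⧸ cellIdeal K n F), q.IsPrime ∧
        q = p.map (Ideal.Quotient.mk (cellIdeal K n F)) ∧
        Algebra.trdeg K (MvPolynomial (CoordIndex n) K ⧸ p) =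
          Algebra.trdeg K ((MvPolynomial (CoordIndex n) K ⧸ cellIdeal K n F) ⧸ q) ∧
        (q = ⊥ → p ≤ cellIdeal K n F) := by
    intro F hF
    refine ⟨p.map (Ideal.Quotient.mkₐ K (cellIdeal K n F)), ?_, rfl, ?_, fun h0 => ?_⟩
    · exact Ideal.map_isPrime_of_surjective Ideal.Quotient.mk_surjective
        (Ideal.mk_ker.trans_le hF)
    · exact (DoubleQuot.quotQuotEquivQuotOfLEₐ K hF).symm.trdeg_eq
    · exact ((Ideal.map_eq_bot_iff_le_ker _).mp h0).trans Ideal.mk_ker.le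
  obtain ⟨q, hq, hqp, htr, hbot⟩ := key D hDp
  obtain ⟨q', hq', -, htr', hbot'⟩ := key E hEp
  have hq0 : q ≠ ⊥ := fun h0 => boundaryPoly_notMem hD (hbot h0 hfp)
  have h3 := trdeg_le_trdeg_quotient_add_one (K := K) hq0
    (hqp ▸ Ideal.map_height_le_one_of_mem_minimalPrimes hpmin)
  rw [← htr, trdeg_quotient_cellIdeal hD] at h3
  have hcard : (evenSlots E n).card < (evenSlots D n).card := by
    have h4 := two_mul_card_evenSlots hD ho
    have h5 := two_mul_card_evenSlots hE hoE
    have h6 := Finset.card_lt_card hDE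
    omega
  have h4 : Algebra.trdeg K (MvPolynomial (CoordIndex n) K ⧸ p) ≤
      ((evenSlots E n).card + (n - 1) : ℕ) := by
    rw [← trdeg_quotient_cellIdeal (K := K) hE]
    exact trdeg_le_of_surjective (Ideal.Quotient.factorₐ K hEp) (Ideal.Quotient.factor_surjective hEp)
  obtain ⟨m, hm⟩ := Cardinal.lt_aleph0.mp (h4.trans_lt (Cardinal.natCast_lt_aleph0))
  rw [hm] at h3 h4
  norm_cast at h3 h4
  have hpE : p ≤ cellIdeal K n E := by
    refine hbot' (ideal_eq_bot_of_trdeg_le (K := K) ?_ q' ?_)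
    · rw [trdeg_quotient_cellIdeal hE]
      exact Cardinal.natCast_lt_aleph0
    · rw [← htr', hm, trdeg_quotient_cellIdeal hE]
      norm_cast
      omega
  exact ⟨E, hE, hoE, hDp.trans hpE, hEp.trans hpD', by omega⟩

end Trdeg

end

/-! ### The poset of cells -/

noncomputable section

open CompleteQuadric

theorem mainTheorem7 {K : Type*} [Field K] [IsAlgClosed K] [CharZero K] (n : ℕ)
    (u : Matrix.SpecialLinearGroup (Fin n) K) (hu : IsRegularUnipotent u) :
    ∃ P : PartialOrder (OddComposition n),
      (∀ ρ γ : OddComposition n, ρ ≤ γ ↔ fixedCell u ρ ⊆ closure (fixedCell u γ)) ∧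
      IsGradedPoset (OddComposition n) ∧
      IsRankFunction (fun γ : OddComposition n => (n - γ.numParts) / 2) ∧
      ∀ γ : OddComposition n,
        2 * ((n - γ.numParts) / 2) + γ.numParts = n ∧
        topologicalKrullDim (fixedCell u γ) = (((n - γ.numParts) / 2 : ℕ) : WithBot ℕ∞) := by
  obtain ⟨P, hP, hchart⟩ := exists_isCellChart u hu
  have hcut : ∀ γ : OddComposition n, IsCutSet (compositionCuts γ.1) 0 n :=
    fun γ => isCutSet_compositionCuts γ.1
  have hiff : ∀ ρ γ : OddComposition n, fixedCell u ρ ⊆ closure (fixedCell u γ) ↔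
      cellIdeal K n (compositionCuts γ.1) ≤ cellIdeal K n (compositionCuts ρ.1) :=
    fun ρ γ => (hchart γ).subset_closure_iff hP (hchart ρ)
  have hsub : ∀ ρ γ : OddComposition n, fixedCell u ρ ⊆ closure (fixedCell u γ) →
      compositionCuts γ.1 ⊆ compositionCuts ρ.1 :=
    fun ρ γ h => subset_of_cellIdeal_le (hcut γ) (hcut ρ) ((hiff ρ γ).mp h)
  let _ : PartialOrder (OddComposition n) :=
    { le := fun ρ γ => fixedCell u ρ ⊆ closure (fixedCell u γ)
      le_refl := fun _ => subset_closure
      le_trans := fun _ _ _ h h' => h.trans (closure_minimal h' isClosed_closure)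
      le_antisymm := fun ρ γ h h' => Subtype.ext (compositionCuts_injective
        (Finset.Subset.antisymm (hsub γ ρ h') (hsub ρ γ h))) }
  have hlt : ∀ {ρ γ : OddComposition n}, ρ < γ →
      compositionCuts γ.1 ⊂ compositionCuts ρ.1 := fun {ρ γ} h =>
    Finset.ssubset_iff_subset_ne.mpr ⟨hsub ρ γ h.le, fun he =>
      h.ne (Subtype.ext (compositionCuts_injective he)).symm⟩
  have hrank : IsRankFunction fun γ : OddComposition n => (n - γ.numParts) / 2 := by
    constructor
    · intro ρ γ h
      simp only [← card_evenSlots_eq]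
      exact card_evenSlots_lt (hlt h)
    · intro ρ γ h
      simp only [← card_evenSlots_eq]
      obtain ⟨E, hE, hoE, h1, h2, h3⟩ := exists_cellIdeal_between (K := K) two_ne_zero (hcut γ)
        (oddBlocks_compositionCuts γ) (hcut ρ) (hlt h.lt) ((hiff ρ γ).mp h.le)
      obtain ⟨δ, rfl⟩ := exists_compositionCuts_eq hE hoE
      have hρδ : ρ ≤ δ := (hiff ρ δ).mpr h2
      have hδγ : δ ≤ γ := (hiff δ γ).mpr h1
      -- The intermediate cell must be one of the two ends of the cover; it cannot be `γ`, as its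
      -- dimension is smaller by one.
      rcases h.eq_or_eq hρδ hδγ with rfl | rfl
      · exact h3
      · omega
  refine ⟨inferInstance, fun _ _ => Iff.rfl, ⟨_, hrank⟩, hrank, fun γ => ?_⟩
  have h1 := two_mul_card_evenSlots_add_numParts γ
  have h2 := (hchart γ).topologicalKrullDim_eq hP (hcut γ)
  rw [card_evenSlots_eq] at h1 h2
  exact ⟨h1, h2⟩

end
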